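/- Fix a smooth function $h:\mathbb{R}\to\mathbb{R}$ with $h(x)>0$ for $x<0$ and $h(x)=0$ for $x\ge 0$, and consider in $\mathbb{R}^3$ the surfaces $\Sigma_1=\{z=0\}$, $\Sigma_2=\{z=h(x)\}$, $\Sigma_3=\{z=-h(y)\}$, $\Sigma_4=\{z=-h(-y)\}$, oriented so that the projection to the $(x,y)$-plane is positive. A \emph{branched surface} is a compact space $P$ with finitely many charts, which are homeomorphisms from one of the models $D=\Sigma_1$, $E=\Sigma_1\cup\Sigma_2$, $V_+=\Sigma_1\cup\Sigma_2\cup\Sigma_3$, $V_-=\Sigma_1\cup\Sigma_2\cup\Sigma_4$ onto open subsets of $P$ covering $P$, such that the coordinate changes locally map sheets $\Sigma_i$ to sheets $\Sigma_j$ and are smooth and orientation-preserving along each sheet. A function on $P$ is smooth if it is smooth along each sheet of each chart. An \emph{embedding} of $P$ in a smooth 3-manifold $N$ is a homeomorphism onto its image which is a smooth immersion along each sheet of each chart; we then regard $P$ as a subset of $N$. All sheets through a point $p\in P$ have the same tangent plane $T_pP\subset T_pN$. If $\xi$ is a cooriented plane field near $P$, defined (with its coorientation) by a smooth 1-form $\alpha$,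 i.e. $\xi=\ker\alpha$, then its \emph{characteristic foliation} $\mathcal{F}_\xi(P)$ is the oriented singular foliation of $P$ defined by the restriction of $\alpha$ to $TP$, i.e. the class of $\alpha|_{TP}$ up to multiplication by positive smooth functions on $P$. \textbf{Theorem.} Let $N$ be an oriented smooth 3-manifold (without boundary, open or closed), let $P$ be a branched surface embedded in $N$, and let $\xi_0,\xi_1$ be (cooriented, positive) contact structures on $N$ such that $\mathcal{F}_{\xi_0}(P)=\mathcal{F}_{\xi_1}(P)$. Then there exist an open neighbourhood $U_0$ of $P$ in $N$ and a smooth map $\phi:U_0\times[0,1]\to N$ such that, writing $\phi_t=\phi(\,\cdot\,,t)$: \begin{enumerate} \item for all $t\in[0,1]$ the map $\phi_t$ is a diffeomorphism of $U_0$ onto an open neighbourhood $U_t$ of $P$, and $\phi_t(P)=P$; moreover $\phi_0=\mathrm{id}$; \item $\xi_0|_{U_0}=\phi_1^*(\xi_1|_{U_1})$ (as cooriented plane fields), and $\mathcal{F}_{(\phi_t)_*(\xi_0|_{U_0})}(P)=\mathcal{F}_{\xi_0}(P)=\mathcal{F}_{\xi_1}(P)$ for all $t\in[0,1]$. \end{enumerate}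 -/

import Mathlib

open scoped Manifold ContDiff Topology
open Set

noncomputable section

namespace BranchedContact

/-! ### Oriented 3-manifolds, 1-forms and contact structures -/

/-- Euclidean 3-space, the model of the ambient manifolds. -/
abbrev E3 : Type := EuclideanSpace ℝ (Fin 3)

/-- The atlas of `N` is oriented: all coordinate changes have positive Jacobian determinant.
A smooth 3-manifold with such an atlas is an oriented 3-manifold; its positive bases are those
which are positive in the charts of the atlas. -/
def IsOrientedAtlas (N : Type*) [TopologicalSpace N] [ChartedSpace E3 N] : Prop :=
  ∀ e ∈ atlas E3 N, ∀ e' ∈ atlas E3 N, ∀ x ∈ (e.symm.trans e').source,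
    0 < (fderiv ℝ (e.symm.trans e') x).det

section Ambient

variable (N : Type*) [TopologicalSpace N] [ChartedSpace E3 N]

/-- A (not necessarily smooth) 1-form on `N`. -/
def OneForm : Type _ := ∀ q : N, TangentSpace (𝓡 3) q →L[ℝ] ℝ

/-- A cooriented field of subspaces of the tangent spaces of `N`: `plane q` is the subspace of
`T_q N`, and `pos q` is the set of the vectors positively transverse to it. -/
structure PlaneField where
  plane : ∀ q : N, Submodule ℝ (TangentSpace (𝓡 3) q)
  pos : ∀ q : N, Set (TangentSpace (𝓡 3) q)

variable {N}

/-- The expression of the 1-form `α` in the chart `e`, i.e. the pull-back of `α` under `e⁻¹`. -/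
def OneForm.inChart (α : OneForm N) (e : OpenPartialHomeomorph N E3) : E3 → (E3 →L[ℝ] ℝ) :=
  fun x => (α (e.symm x)).comp (mfderiv 𝓘(ℝ, E3) (𝓡 3) e.symm x)

/-- Smoothness of a 1-form on an (open) subset `W`: smooth coefficients in every chart. -/
def OneForm.SmoothOn (α : OneForm N) (W : Set N) : Prop :=
  ∀ e ∈ atlas E3 N, ContDiffOn ℝ ∞ (α.inChart e) (e.target ∩ e.symm ⁻¹' W)

/-- The exterior derivative `da` of a 1-form on `ℝ³`. -/
def dForm (a : E3 → (E3 →L[ℝ] ℝ)) (x v w : E3) : ℝ :=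
  fderiv ℝ a x v w - fderiv ℝ a x w v

/-- The 3-form `a ∧ da` on `ℝ³`. -/
def wedgeD (a : E3 → (E3 →L[ℝ] ℝ)) (x u v w : E3) : ℝ :=
  a x u * dForm a x v w + a x v * dForm a x w u + a x w * dForm a x u v

/-- `α` is a positive contact form: `α` is smooth and `α ∧ dα > 0` everywhere, with respect to the
orientation of `N` given by its atlas. -/
def OneForm.IsPosContact (α : OneForm N) : Prop :=
  α.SmoothOn univ ∧
    ∀ e ∈ atlas E3 N, ∀ x ∈ e.target,
      0 < wedgeD (α.inChart e) x
        (EuclideanSpace.single 0 1) (EuclideanSpace.single 1 1) (EuclideanSpace.single 2 1)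

/-- On `W`, the cooriented plane field `ξ` is the kernel of `α`, cooriented by `α`. -/
def OneForm.Defines (α : OneForm N) (ξ : PlaneField N) (W : Set N) : Prop :=
  ∀ q ∈ W, ξ.plane q = LinearMap.ker (α q).toLinearMap ∧ ξ.pos q = {v | 0 < α q v}

/-- `ξ` is a (cooriented, positive) contact structure on `N`. -/
def PlaneField.IsContact (ξ : PlaneField N) : Prop :=
  ∃ α : OneForm N, α.IsPosContact ∧ α.Defines ξ univ

/-- The pull-back `φ^* ξ`; it is meaningful where `φ` is a local diffeomorphism. -/
def PlaneField.pullback (φ : N → N) (ξ : PlaneField N) : PlaneField N where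
  plane q := (ξ.plane (φ q)).comap (mfderiv (𝓡 3) (𝓡 3) φ q).toLinearMap
  pos q := {v | mfderiv (𝓡 3) (𝓡 3) φ q v ∈ ξ.pos (φ q)}

/-- The push-forward `φ_* (ξ|_U) = (φ⁻¹)^* (ξ|_U)` under a diffeomorphism `φ : U → V` between open
subsets of `N`; it is meaningful on `V = φ.target`. -/
def PlaneField.pushforward (φ : PartialDiffeomorph (𝓡 3) (𝓡 3) N N ∞) (ξ : PlaneField N) :
    PlaneField N :=
  ξ.pullback φ.symm

/-- Two cooriented plane fields agree on `U`. -/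
def PlaneField.EqOn (ξ ξ' : PlaneField N) (U : Set N) : Prop :=
  ∀ q ∈ U, ξ.plane q = ξ'.plane q ∧ ξ.pos q = ξ'.pos q

end Ambient

/-! ### Branched surfaces -/

/-- The profile functions used in the local models: smooth, positive on the negative half-line,
zero on the non-negative half-line. -/
structure IsProfile (h : ℝ → ℝ) : Prop where
  smooth : ContDiff ℝ ∞ h
  pos : ∀ x, x < 0 → 0 < h x
  zero : ∀ x, 0 ≤ x → h x = 0

/-- The parametrizations of the four model sheets `Σ₁, Σ₂, Σ₃, Σ₄` (in this order), which are
graphs over the oriented plane. -/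
def sheetMap (h : ℝ → ℝ) : Fin 4 → ℝ × ℝ → ℝ × ℝ × ℝ
  | 0, u => (u.1, u.2, 0)
  | 1, u => (u.1, u.2, h u.1)
  | 2, u => (u.1, u.2, -h u.2)
  | 3, u => (u.1, u.2, -h (-u.2))

/-- The four kinds of local models: regular points, fold lines, vertices of the two types. -/
inductive Kind
  | D | E | Vpos | Vneg

/-- The sheets of each model: `D = Σ₁`, `E = Σ₁ ∪ Σ₂`, `V₊ = Σ₁ ∪ Σ₂ ∪ Σ₃`,
`V₋ = Σ₁ ∪ Σ₂ ∪ Σ₄`. -/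
def Kind.sheets : Kind → Finset (Fin 4)
  | .D => {0}
  | .E => {0, 1}
  | .Vpos => {0, 1, 2}
  | .Vneg => {0, 1, 3}

/-- The local model, as a subset (hence a subspace) of `ℝ³`. -/
def model (h : ℝ → ℝ) (m : Kind) : Set (ℝ × ℝ × ℝ) :=
  ⋃ k ∈ m.sheets, range (sheetMap h k)

/-- The sheet `Σ_k` as a map into the model. -/
def sheetPt (h : ℝ → ℝ) (m : Kind) (k : m.sheets) (u : ℝ × ℝ) : model h m :=
  ⟨sheetMap h k u, mem_biUnion k.2 (mem_range_self u)⟩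

/-- An oriented `C^∞` branched structure on the space `P`: a finite family of charts from the local
models onto open subsets of `P`, which cover `P`, such that the coordinate changes send sheets to
sheets (locally), smoothly and preserving the orientations of the sheets. (Branched surfaces are
finite polyhedra, i.e. `P` is moreover compact; this is assumed separately.) -/
structure BranchedSurface (h : ℝ → ℝ) (P : Type*) [TopologicalSpace P] where
  n : ℕ
  kind : Fin n → Kind
  chart : ∀ j, model h (kind j) → P
  isOpenEmbedding : ∀ j, Topology.IsOpenEmbedding (chart j)
  cover : ⋃ j, range (chart j) = univ
  compat : ∀ (a b : Fin n) (k : (kind b).sheets) (u : ℝ × ℝ),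
    chart b (sheetPt h (kind b) k u) ∈ range (chart a) →
      ∃ (l : (kind a).sheets) (τ : ℝ × ℝ → ℝ × ℝ),
        ContDiffAt ℝ ∞ τ u ∧ 0 < (fderiv ℝ τ u).det ∧
          ∀ᶠ w in 𝓝 u, chart a (sheetPt h (kind a) l (τ w)) = chart b (sheetPt h (kind b) k w)

namespace BranchedSurface

variable {h : ℝ → ℝ} {P : Type*} [TopologicalSpace P] (S : BranchedSurface h P)

/-- The `k`-th sheet of the `j`-th chart of a branched surface. -/
def sheet (j : Fin S.n) (k : (S.kind j).sheets) (u : ℝ × ℝ) : P :=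
  S.chart j (sheetPt h (S.kind j) k u)

/-- Smooth functions on a branched surface: smooth along every sheet. -/
def IsSmooth (g : P → ℝ) : Prop :=
  ∀ j k, ContDiff ℝ ∞ (g ∘ S.sheet j k)

variable {N : Type*} [TopologicalSpace N] [ChartedSpace E3 N]

/-- Embeddings of a branched surface in a 3-manifold: homeomorphisms onto the image which are
smooth immersions along every sheet. The screw-orientation of `P` (the local position of the sheets
along the fold lines and at the vertices, in oriented 3-manifolds) is the one which the embedding
induces from the orientation of `N`. -/
structure IsSmoothEmbedding (i : P → N) : Prop where
  isEmbedding : Topology.IsEmbedding i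
  smooth : ∀ j k, ContMDiff 𝓘(ℝ, ℝ × ℝ) (𝓡 3) ∞ (i ∘ S.sheet j k)
  immersion : ∀ j k u,
    Function.Injective (mfderiv 𝓘(ℝ, ℝ × ℝ) (𝓡 3) (i ∘ S.sheet j k) u)

/-- The tangent plane of the embedded branched surface `i(P)` at `i(p)`: the tangent plane of any
sheet through `p`. (All sheets through `p` have the same tangent plane, so that the sum below is
this plane.) -/
def tangentPlane (i : P → N) (p : P) : Submodule ℝ (TangentSpace (𝓡 3) (i p)) :=
  ⨆ (j : Fin S.n) (k : (S.kind j).sheets) (u : ℝ × ℝ) (_ : S.sheet j k u = p),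
    (LinearMap.range
      (mfderiv 𝓘(ℝ, ℝ × ℝ) (𝓡 3) (i ∘ S.sheet j k) u).toLinearMap : Submodule ℝ E3)

/-- The characteristic foliation induced on the embedded branched surface `i(P)` by a cooriented
plane field `ξ` defined near `i(P)`, as an oriented singular foliation: the class of the 1-forms
on `P` which are the product of the restriction to `i(P)` of a smooth 1-form defining `ξ` near
`i(P)` with a positive smooth function on `P`. A 1-form on `P` is a family of linear forms on
the tangent planes of `i(P)`. (Since `P` is oriented, such a class of 1-forms is the same as a class
of vector fields tangent to `P`, up to positive smooth functions.) -/
def charFoliation (i : P → N) (ξ : PlaneField N) :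
    Set (∀ p : P, Module.Dual ℝ (S.tangentPlane i p)) :=
  {β | ∃ (W : Set N) (α : OneForm N) (g : P → ℝ),
    IsOpen W ∧ range i ⊆ W ∧ α.SmoothOn W ∧ α.Defines ξ W ∧
      S.IsSmooth g ∧ (∀ p, 0 < g p) ∧
        ∀ (p : P) (v : S.tangentPlane i p),
          β p v = g p * α (i p) (v : TangentSpace (𝓡 3) (i p))}

end BranchedSurface

end BranchedContact

end

/-!
The isotopy is constructed by Moser's method. Choose contact forms `α₀`, `α₁` for the two structures.
Since the characteristic foliations agree, `α₁ = g α₀` on the tangent planes of the branched surface,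
with a positive function `g` which is smooth along the sheets (`BranchedSurface.exists_factor`).

If `g` extended to a smooth positive function on the ambient manifold, one could divide `α₁` by the
extension and join `α₀` to `α₁ / g` linearly. In general `g` has no smooth extension, as the sheets
are tangent to each other to infinite order along the branch curves. However, `log g` is the limit
of smooth ambient functions `F n` in the `C¹` sense along the sheets
(`BranchedSurface.exists_approx`). The 3-form of the contact condition for
`(1 - c) α₀ + c e ^ (-F n) α₁`, evaluated at a point of the branched surface, involves only the
derivative of `F n - log g` along the sheet (`wedgeD_path`). Hence for `n` large and `f = e ^ (-F n)`
these forms are contact forms near the branched surface, for all `c` between 0 and 1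
(`BranchedSurface.exists_contact_path`).

Moser's vector field for this path is the vector field `X` annihilated by the forms `a` of the path
for which `i_X da + ∂a/∂t` is a multiple of `a`. In coordinates it is the cross product of `a` and
`∂a/∂t` divided by the density of `a ∧ da` (`moserVector`, `dForm_cross`). After a cut-off it has a
global flow (`TimeField.exists_evolution`), which respects the plane fields as long as it stays near
the branched surface (`moser`). On a tangent plane of the branched surface, `a` and `∂a/∂t` are both
multiples of `α₀`, so that `X` is tangent to all the sheets
(`BranchedSurface.moserVector_tangent`). By uniqueness of solutions the flow preserves the branched
surface (`BranchedSurface.evolution_mem_range`). The forms of the path restrict on the branched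
surface to products of `α₀` with positive functions which are smooth along the sheets, so that they all
induce the same characteristic foliation (`BranchedSurface.charFoliation_eq`).
-/

open scoped Manifold ContDiff Topology
open Set

noncomputable section

namespace BranchedContact

/-! ### Smooth dependence of solutions of differential equations on initial values -/

section Superposition

universe u

/-- Pointwise application of a continuous family of operators to a continuous family of vectors,
as a bounded bilinear map. -/
def applyFamily (K : Type*) [TopologicalSpace K] [CompactSpace K]
    (E F : Type*) [NormedAddCommGroup E] [NormedSpace ℝ E]
    [NormedAddCommGroup F] [NormedSpace ℝ F] :
    C(K, E →L[ℝ] F) →L[ℝ] C(K, E) →L[ℝ] C(K, F) :=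
  LinearMap.mkContinuous₂
    (LinearMap.mk₂ ℝ (fun (A : C(K, E →L[ℝ] F)) (η : C(K, E)) =>
        (⟨fun k => A k (η k), by fun_prop⟩ : C(K, F)))
      (fun A B η => by ext; simp) (fun c A η => by ext; simp)
      (fun A η ζ => by ext; simp) (fun c A η => by ext; simp)) 1
    (fun A η => by
      rw [ContinuousMap.norm_le _ (by positivity)]
      intro k
      simpa using (A k).le_of_opNorm_le_of_le (A.norm_coe_le_norm k) (η.norm_coe_le_norm k))

variable {K : Type*} [TopologicalSpace K] [CompactSpace K]

/-- Left composition with a `C¹` map is differentiable on the space of continuous maps. -/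
lemma hasFDerivAt_comp_left {E F : Type*} [NormedAddCommGroup E] [NormedSpace ℝ E]
    [NormedAddCommGroup F] [NormedSpace ℝ F] (f : C(E, F)) (f' : C(E, E →L[ℝ] F))
    (hf : ∀ x, HasFDerivAt f (f' x) x) (γ : C(K, E)) :
    HasFDerivAt (fun γ : C(K, E) => f.comp γ) (applyFamily K E F (f'.comp γ)) γ := by
  rw [hasFDerivAt_iff_isLittleO, Asymptotics.isLittleO_iff]
  intro c hc
  have hcont : Continuous fun γ : C(K, E) => f'.comp γ := f'.continuous_postcomp
  obtain ⟨δ, hδ, hball⟩ := (Metric.continuousAt_iff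
    (f := fun γ : C(K, E) => f'.comp γ) (a := γ)).1 hcont.continuousAt c hc
  filter_upwards [Metric.ball_mem_nhds γ hδ] with η hη
  rw [ContinuousMap.norm_le _ (by positivity)]
  intro k
  have key : ∀ y ∈ segment ℝ (γ k) (η k), ‖f' y - f' (γ k)‖ ≤ c := by
    rintro y ⟨a, b, ha, hb, hab, rfl⟩
    have hζ : dist (a • γ + b • η) γ < δ := by
      have : a • γ + b • η - γ = b • (η - γ) := by
        have : a = 1 - b := by linarith
        subst this; module
      rw [dist_eq_norm, this, norm_smul, Real.norm_of_nonneg hb, ← dist_eq_norm]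
      calc b * dist η γ ≤ 1 * dist η γ := by gcongr; linarith
        _ < δ := by simpa using hη
    have h1 := (ContinuousMap.dist_lt_iff hc).1 (hball hζ) k
    rw [← dist_eq_norm]
    exact h1.le
  have := (convex_segment (γ k) (η k)).norm_image_sub_le_of_norm_hasFDerivWithin_le'
    (f := f) (f' := f') (φ := f' (γ k)) (C := c)
    (fun y _ => (hf y).hasFDerivWithinAt) key (left_mem_segment ℝ _ _) (right_mem_segment ℝ _ _)
  refine this.trans ?_
  gcongr
  exact ContinuousMap.norm_coe_le_norm (η - γ) k

/-- Left composition with a smooth map is smooth on the space of continuous maps. -/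
lemma contDiff_comp_left {E F : Type u} [NormedAddCommGroup E] [NormedSpace ℝ E]
    [NormedAddCommGroup F] [NormedSpace ℝ F] (f : C(E, F)) (hf : ContDiff ℝ ∞ f) :
    ContDiff ℝ ∞ (fun γ : C(K, E) => f.comp γ) := by
  rw [contDiff_infty]
  intro n
  induction n generalizing F with
  | zero => exact contDiff_zero.2 f.continuous_postcomp
  | succ n ih =>
    have hf' : ContDiff ℝ ∞ (fderiv ℝ f) := hf.fderiv_right (by simp)
    let f' : C(E, E →L[ℝ] F) := ⟨fderiv ℝ f, hf'.continuous⟩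
    rw [Nat.cast_succ, contDiff_succ_iff_hasFDerivAt]
    have h : ContDiff ℝ n (applyFamily K E F) := ContinuousLinearMap.contDiff _
    exact ⟨fun γ => applyFamily K E F (f'.comp γ), h.comp (ih f' hf'),
      fun γ => hasFDerivAt_comp_left f f'
        (fun x => (hf.differentiable (by simp) x).hasFDerivAt) γ⟩

end Superposition

/-- The implicit function of a smooth equation is smooth at all points of a neighbourhood. -/
lemma eventually_contDiffAt_implicitFunction {E₁ E₂ F : Type*}
    [NormedAddCommGroup E₁] [NormedSpace ℝ E₁] [CompleteSpace E₁]
    [NormedAddCommGroup E₂] [NormedSpace ℝ E₂] [CompleteSpace E₂]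
    [NormedAddCommGroup F] [NormedSpace ℝ F] [CompleteSpace F]
    {f : E₁ × E₂ → F} (hf : ContDiff ℝ ∞ f) {u : E₁ × E₂} (hn : (∞ : WithTop ℕ∞) ≠ 0)
    (hu : (fderiv ℝ f u ∘L .inr ℝ E₁ E₂).IsInvertible) :
    ∀ᶠ x in 𝓝 u.1, ContDiffAt ℝ ∞ (hf.contDiffAt.implicitFunction hn hu) x := by
  set ψ := hf.contDiffAt.implicitFunction hn hu
  have hψ : ContDiffAt ℝ ∞ ψ u.1 := hf.contDiffAt.contDiffAt_implicitFunction hn hu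
  have hψu : ψ u.1 = u.2 := hf.contDiffAt.implicitFunction_apply_self hn hu
  have h1 : ∀ᶠ x in 𝓝 u.1, ContDiffAt ℝ 1 ψ x :=
    (hψ.of_le (by exact_mod_cast le_top)).eventually (by simp)
  have hg : ContinuousAt (fun x => (x, ψ x)) u.1 := continuousAt_id.prodMk hψ.continuousAt
  have hgt : Filter.Tendsto (fun x => (x, ψ x)) (𝓝 u.1) (𝓝 u) := by
    have := hg.tendsto
    rwa [show (u.1, ψ u.1) = u from by rw [hψu]] at this
  have h2 : ∀ᶠ v in 𝓝 u, (fderiv ℝ f v ∘L .inr ℝ E₁ E₂).IsInvertible := by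
    have hc : Continuous fun v => fderiv ℝ f v ∘L .inr ℝ E₁ E₂ :=
      (hf.continuous_fderiv (by simp)).clm_comp continuous_const
    have ho : IsOpen {A : E₂ →L[ℝ] F | A.IsInvertible} := by
      have := ContinuousLinearEquiv.isOpen (𝕜 := ℝ) (E := E₂) (F := F)
      convert this using 1
      ext A
      simp [ContinuousLinearMap.IsInvertible]
    exact hc.continuousAt.eventually_mem (ho.mem_nhds hu)
  have h3 := (hf.contDiffAt.eventually_apply_eq_iff_implicitFunction hn hu).eventually_nhds
  have h4 := hf.contDiffAt.eventually_apply_implicitFunction hn hu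
  filter_upwards [h1, hgt.eventually h2, hgt.eventually h3, h4] with x k1 k2 k3 k4
  have hψ' := (hf.contDiffAt (x := (x, ψ x))).contDiffAt_implicitFunction hn k2
  set ψ' := (hf.contDiffAt (x := (x, ψ x))).implicitFunction hn k2
  refine hψ'.congr_of_eventuallyEq ?_
  have e1 := (hf.contDiffAt (x := (x, ψ x))).eventually_apply_implicitFunction hn k2
  have e0 : ψ' x = ψ x := (hf.contDiffAt (x := (x, ψ x))).implicitFunction_apply_self hn k2
  have hg' : Filter.Tendsto (fun y => (y, ψ' y)) (𝓝 x) (𝓝 (x, ψ x)) := by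
    have : ContinuousAt (fun y => (y, ψ' y)) x := continuousAt_id.prodMk hψ'.continuousAt
    have := this.tendsto
    rwa [e0] at this
  filter_upwards [e1, hg'.eventually k3] with y y1 y2
  exact y2.1 (y1.trans k4)

section LocalFlow

/-- The parameter interval of the curves used in the construction of local flows. -/
abbrev UnitIcc : Type := Icc (-1 : ℝ) 1

variable {E : Type*} [NormedAddCommGroup E] [NormedSpace ℝ E] [CompleteSpace E]

/-- The primitive vanishing at `0`, as an operator on continuous curves. -/
def primitive (E : Type*) [NormedAddCommGroup E] [NormedSpace ℝ E] [CompleteSpace E] :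
    C(UnitIcc, E) →L[ℝ] C(UnitIcc, E) :=
  LinearMap.mkContinuous
    { toFun := fun γ =>
        ⟨fun τ => ∫ σ in (0 : ℝ)..τ, IccExtend (by norm_num) γ σ, by
          have : Continuous (IccExtend (show (-1 : ℝ) ≤ 1 by norm_num) γ) :=
            γ.continuous.Icc_extend'
          exact (intervalIntegral.continuous_primitive (fun a b => this.intervalIntegrable a b)
            0).comp continuous_subtype_val⟩
      map_add' := fun γ η => by
        ext τ
        have h1 : Continuous (IccExtend (show (-1 : ℝ) ≤ 1 by norm_num) γ) :=
            γ.continuous.Icc_extend'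
        have h2 : Continuous (IccExtend (show (-1 : ℝ) ≤ 1 by norm_num) η) :=
            η.continuous.Icc_extend'
        exact intervalIntegral.integral_add (h1.intervalIntegrable _ _) (h2.intervalIntegrable _ _)
      map_smul' := fun c γ => by
        ext τ
        exact intervalIntegral.integral_smul c _ } 1
    (fun γ => by
      rw [ContinuousMap.norm_le _ (by positivity)]
      intro τ
      have := intervalIntegral.norm_integral_le_of_norm_le_const (a := 0) (b := (τ : ℝ))
        (f := IccExtend (show (-1 : ℝ) ≤ 1 by norm_num) γ) (C := ‖γ‖)
        (fun x _ => γ.norm_coe_le_norm _)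
      refine this.trans ?_
      rw [mul_comm]
      gcongr
      rw [sub_zero, abs_le]
      exact τ.2)

/-- The integral equation `γ = x + s ∫₀ f(γ)`, whose solutions are the solutions of the
differential equation `γ' = s f(γ)` with initial value `x`. -/
def flowEquation (f : C(E, E)) (v : (ℝ × E) × C(UnitIcc, E)) : C(UnitIcc, E) :=
  v.2 - ContinuousMap.const _ v.1.2 - v.1.1 • primitive E (f.comp v.2)

/-- Constant curves depend linearly on their value. -/
def constL (E : Type*) [NormedAddCommGroup E] [NormedSpace ℝ E] : E →L[ℝ] C(UnitIcc, E) :=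
  LinearMap.mkContinuous
    { toFun := ContinuousMap.const _
      map_add' := fun _ _ => rfl
      map_smul' := fun _ _ => rfl } 1
    (fun x => by
      rw [ContinuousMap.norm_le _ (by positivity)]
      exact fun τ => (one_mul ‖x‖).ge)

lemma contDiff_flowEquation (f : C(E, E)) (hf : ContDiff ℝ ∞ f) :
    ContDiff ℝ ∞ (flowEquation f) := by
  have h1 : ContDiff ℝ ∞ (fun v : (ℝ × E) × C(UnitIcc, E) => constL E v.1.2) :=
    (constL E).contDiff.comp (contDiff_snd.comp contDiff_fst)
  have h2 : ContDiff ℝ ∞ (fun v : (ℝ × E) × C(UnitIcc, E) => primitive E (f.comp v.2)) :=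
    (primitive E).contDiff.comp ((contDiff_comp_left f hf).comp contDiff_snd)
  exact (contDiff_snd.sub h1).sub ((contDiff_fst.comp contDiff_fst).smul h2)

lemma flowEquation_eq_zero_iff (f : C(E, E)) (s : ℝ) (x : E) (γ : C(UnitIcc, E)) :
    flowEquation f ((s, x), γ) = 0 ↔ ∀ τ : UnitIcc, γ τ = x + s •
      ∫ σ in (0 : ℝ)..τ, f (IccExtend (show (-1 : ℝ) ≤ 1 by norm_num) γ σ) := by
  rw [flowEquation, sub_sub, sub_eq_zero, ContinuousMap.ext_iff]
  rfl

/-- Multiplication by `a ∈ [-1, 1]` on the parameter interval. -/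
def rescale (a : UnitIcc) : C(UnitIcc, UnitIcc) :=
  ⟨fun τ => ⟨a * τ, by
    have := abs_le.2 a.2
    have h2 := abs_le.2 τ.2
    refine abs_le.1 ?_
    rw [abs_mul]
    exact mul_le_one₀ this (abs_nonneg _) h2⟩, by fun_prop⟩

lemma flowEquation_rescale (f : C(E, E)) (s : ℝ) (x : E) (γ : C(UnitIcc, E)) (a : UnitIcc)
    (h : flowEquation f ((s, x), γ) = 0) :
    flowEquation f ((a * s, x), γ.comp (rescale a)) = 0 := by
  rw [flowEquation_eq_zero_iff] at h ⊢
  intro τ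
  have h1 := h (rescale a τ)
  rw [ContinuousMap.comp_apply, h1, mul_comm, mul_smul]
  congr 2
  have h2 := intervalIntegral.smul_integral_comp_mul_left (a := 0) (b := (τ : ℝ))
    (fun σ => f (IccExtend (show (-1 : ℝ) ≤ 1 by norm_num) γ σ)) (a : ℝ)
  rw [mul_zero] at h2
  refine h2.symm.trans ?_
  congr 1
  refine intervalIntegral.integral_congr fun σ hσ => ?_
  have hσ' : σ ∈ Icc (-1 : ℝ) 1 :=
    (uIcc_subset_Icc (show (0 : ℝ) ∈ Icc (-1 : ℝ) 1 by norm_num) τ.2) hσ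
  have h3 : (a : ℝ) * σ ∈ Icc (-1 : ℝ) 1 := (rescale a ⟨σ, hσ'⟩).2
  simp only [IccExtend_of_mem _ _ hσ', IccExtend_of_mem _ _ h3]
  rfl

/-- Local flows of smooth vector fields are smooth in time and initial value jointly. The curves
`γ` on `[-1, 1]` with `γ = x + s ∫₀ f(γ)` are given near the constant solution by the implicit function
theorem in the space of continuous curves, as a smooth function of `(s, x)`. Their end points are the
values of the flow at the time `s`, since rescaling the time multiplies `s`. -/
theorem exists_local_flow {E : Type*} [NormedAddCommGroup E] [NormedSpace ℝ E] [CompleteSpace E]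
    {f : E → E} (hf : ContDiff ℝ ∞ f) (x₀ : E) :
    ∃ ε > 0, ∃ U ∈ 𝓝 x₀, ∃ θ : ℝ × E → E,
      (∀ s, |s| < ε → ∀ x ∈ U, ContDiffAt ℝ ∞ θ (s, x)) ∧ (∀ x ∈ U, θ (0, x) = x) ∧
      ∀ s, |s| < ε → ∀ x ∈ U, HasDerivAt (fun s => θ (s, x)) (f (θ (s, x))) s := by
  let F : C(E, E) := ⟨f, hf.continuous⟩
  let c : C(UnitIcc, E) := ContinuousMap.const _ x₀
  let u : (ℝ × E) × C(UnitIcc, E) := ((0, x₀), c)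
  have hΦ : ContDiff ℝ ∞ (flowEquation F) := contDiff_flowEquation F hf
  have hu0 : flowEquation F u = 0 := by
    rw [flowEquation_eq_zero_iff]; intro τ; simp [c]
  have hinv : (fderiv ℝ (flowEquation F) u ∘L .inr ℝ _ _) = ContinuousLinearMap.id ℝ _ := by
    have h1 : HasFDerivAt (fun γ => flowEquation F ((0, x₀), γ))
        (fderiv ℝ (flowEquation F) u ∘L .inr ℝ _ _) c :=
      (hΦ.differentiable (by simp) u).hasFDerivAt.comp c (hasFDerivAt_prodMk_right _ _)
    have h2 : HasFDerivAt (fun γ => flowEquation F ((0, x₀), γ))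
        (ContinuousLinearMap.id ℝ _) c := by
      simp only [flowEquation, zero_smul, sub_zero]
      exact (hasFDerivAt_id _).sub_const _
    exact h1.unique h2
  have hu : (fderiv ℝ (flowEquation F) u ∘L .inr ℝ _ _).IsInvertible := by
    rw [hinv]; exact ⟨ContinuousLinearEquiv.refl ℝ _, rfl⟩
  have hn : (∞ : WithTop ℕ∞) ≠ 0 := by simp
  set ψ := hΦ.contDiffAt.implicitFunction hn hu with hψdef
  have hψ : ∀ᶠ p in 𝓝 ((0 : ℝ), x₀), ContDiffAt ℝ ∞ ψ p :=
    eventually_contDiffAt_implicitFunction hΦ hn hu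
  have hψ0 : ψ (0, x₀) = c := hΦ.contDiffAt.implicitFunction_apply_self hn hu
  have hψc : ContinuousAt ψ (0, x₀) := hψ.self_of_nhds.continuousAt
  have hiff : ∀ᶠ v in 𝓝 u, flowEquation F v = 0 ↔ ψ v.1 = v.2 := by
    have := hΦ.contDiffAt.eventually_apply_eq_iff_implicitFunction hn hu
    rwa [hu0] at this
  rw [nhds_prod_eq] at hiff
  obtain ⟨pa, hpa, pb, hpb, hiff⟩ := Filter.eventually_prod_iff.1 hiff
  obtain ⟨r, hr, hball⟩ := Metric.eventually_nhds_iff.1 hpb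
  have hnear : ∀ᶠ p in 𝓝 ((0 : ℝ), x₀), dist (ψ p) c < r := by
    have := Metric.continuousAt_iff'.1 hψc r hr
    rwa [hψ0] at this
  have hall := hψ.and (hpa.and hnear)
  rw [nhds_prod_eq] at hall
  obtain ⟨qa, hqa, qb, hqb, hall⟩ := Filter.eventually_prod_iff.1 hall
  obtain ⟨δ', hδ', hqa⟩ := Metric.eventually_nhds_iff.1 hqa
  set δ := δ' / 2 with hδdef
  have hδ : 0 < δ := by positivity
  have hA : ∀ s, |s| ≤ δ → ∀ x, qb x → ContDiffAt ℝ ∞ ψ (s, x) ∧ pa (s, x) ∧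
      dist (ψ (s, x)) c < r := fun s hs x hx => hall (hqa (by
        rw [Real.dist_eq, sub_zero]; linarith)) hx
  have hsol : ∀ s, |s| ≤ δ → ∀ x, qb x → flowEquation F ((s, x), ψ (s, x)) = 0 :=
    fun s hs x hx => (hiff (hA s hs x hx).2.1 (hball (hA s hs x hx).2.2)).2 rfl
  have hresc : ∀ s (hs : |s| ≤ δ) x, qb x →
      ψ (s, x) = (ψ (δ, x)).comp (rescale ⟨s / δ, by
        rw [mem_Icc, ← abs_le, abs_div, abs_of_pos hδ]; exact (div_le_one hδ).2 hs⟩) := by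
    intro s hs x hx
    have hδδ : |δ| ≤ δ := (abs_of_pos hδ).le
    have h1 := flowEquation_rescale F δ x (ψ (δ, x)) ⟨s / δ, by
        rw [mem_Icc, ← abs_le, abs_div, abs_of_pos hδ]; exact (div_le_one hδ).2 hs⟩
        (hsol δ hδδ x hx)
    simp only [div_mul_cancel₀ _ hδ.ne'] at h1
    refine (hiff (hA s hs x hx).2.1 (hball ?_)).1 h1
    rw [ContinuousMap.dist_lt_iff hr]
    intro τ
    exact (ContinuousMap.dist_lt_iff hr).1 (hA δ hδδ x hx).2.2 _
  have hval : ∀ s (hs : |s| ≤ δ) x, qb x → ψ (s, x) ⟨1, by norm_num⟩ =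
      IccExtend (show (-1 : ℝ) ≤ 1 by norm_num) (ψ (δ, x)) (s / δ) := by
    intro s hs x hx
    have hm : s / δ ∈ Icc (-1 : ℝ) 1 := by
      rw [mem_Icc, ← abs_le, abs_div, abs_of_pos hδ]; exact (div_le_one hδ).2 hs
    rw [hresc s hs x hx, IccExtend_of_mem _ _ hm]
    simp [rescale]
  refine ⟨δ, hδ, {x | qb x}, hqb, fun p => ψ p ⟨1, by norm_num⟩, ?_, ?_, ?_⟩
  · intro s hs x hx
    exact (ContinuousMap.evalCLM ℝ (⟨1, by norm_num⟩ : UnitIcc)).contDiff.contDiffAt.comp _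
      (hA s hs.le x hx).1
  · intro x hx
    have := (flowEquation_eq_zero_iff F _ _ _).1 (hsol 0 (by simpa using hδ.le) x hx)
      ⟨1, by norm_num⟩
    simpa using this
  · intro s hs x hx
    have hcont : Continuous (fun σ => f (IccExtend (show (-1 : ℝ) ≤ 1 by norm_num)
        (ψ (δ, x)) σ)) := hf.continuous.comp (ψ (δ, x)).continuous.Icc_extend'
    have hder : HasDerivAt (fun s' : ℝ => x + δ • ∫ σ in (0 : ℝ)..(s' / δ),
        f (IccExtend (show (-1 : ℝ) ≤ 1 by norm_num) (ψ (δ, x)) σ))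
        (f (ψ (s, x) ⟨1, by norm_num⟩)) s := by
      have h1 := (hcont.integral_hasStrictDerivAt 0 (s / δ)).hasDerivAt
      have h2 : HasDerivAt (fun s' : ℝ => s' / δ) (1 / δ) s := (hasDerivAt_id s).div_const δ
      have h3 := ((h1.scomp s h2).const_smul δ).const_add x
      rw [smul_smul, mul_one_div_cancel hδ.ne', one_smul, ← hval s hs.le x hx] at h3
      exact h3
    refine hder.congr_of_eventuallyEq ?_
    have hev : ∀ᶠ s' in 𝓝 s, |s'| < δ := continuous_abs.continuousAt.eventually_lt
      continuousAt_const hs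
    filter_upwards [hev] with s' hs'
    have hm : s' / δ ∈ Icc (-1 : ℝ) 1 := by
      rw [mem_Icc, ← abs_le, abs_div, abs_of_pos hδ]; exact (div_le_one hδ).2 hs'.le
    rw [hval s' hs'.le x hx, IccExtend_of_mem _ _ hm]
    exact (flowEquation_eq_zero_iff F _ _ _).1 (hsol δ (abs_of_pos hδ).le x hx) ⟨s' / δ, hm⟩

end LocalFlow

/-! ### Flows of time-dependent vector fields on manifolds -/

section Flow

variable {N : Type*} [TopologicalSpace N] [ChartedSpace E3 N]

lemma contMDiffOn_chart_of_mem_atlas [IsManifold (𝓡 3) ∞ N] {e : OpenPartialHomeomorph N E3}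
    (he : e ∈ atlas E3 N) : ContMDiffOn (𝓡 3) (𝓡 3) ∞ e e.source :=
  contMDiffOn_of_mem_maximalAtlas (IsManifold.subset_maximalAtlas he)

lemma contMDiffOn_chart_symm_of_mem_atlas [IsManifold (𝓡 3) ∞ N]
    {e : OpenPartialHomeomorph N E3} (he : e ∈ atlas E3 N) :
    ContMDiffOn (𝓡 3) (𝓡 3) ∞ e.symm e.target :=
  contMDiffOn_symm_of_mem_maximalAtlas (IsManifold.subset_maximalAtlas he)

lemma contMDiffAt_chart [IsManifold (𝓡 3) ∞ N] {e : OpenPartialHomeomorph N E3}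
    (he : e ∈ atlas E3 N) {q : N} (hq : q ∈ e.source) : ContMDiffAt (𝓡 3) (𝓡 3) ∞ e q :=
  (contMDiffOn_chart_of_mem_atlas he).contMDiffAt (e.open_source.mem_nhds hq)

lemma contMDiffAt_chart_symm [IsManifold (𝓡 3) ∞ N]
    {e : OpenPartialHomeomorph N E3} (he : e ∈ atlas E3 N) {x : E3} (hx : x ∈ e.target) :
    ContMDiffAt (𝓡 3) (𝓡 3) ∞ e.symm x :=
  (contMDiffOn_chart_symm_of_mem_atlas he).contMDiffAt (e.open_target.mem_nhds hx)

/-- Coordinate changes of a smooth manifold are smooth. -/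
lemma contDiffAt_coordChange [IsManifold (𝓡 3) ∞ N] {e e' : OpenPartialHomeomorph N E3}
    (he : e ∈ atlas E3 N) (he' : e' ∈ atlas E3 N) {x : E3} (hx : x ∈ e.target)
    (hx' : e.symm x ∈ e'.source) : ContDiffAt ℝ ∞ (e' ∘ e.symm) x :=
  ((contMDiffAt_chart he' hx').comp x (contMDiffAt_chart_symm he hx)).contDiffAt

variable (N) in
/-- A smooth time-dependent vector field, given by its expressions `X e` in the charts `e`, which
transform under coordinate changes as vectors do. -/
structure TimeField where
  X : OpenPartialHomeomorph N E3 → ℝ → E3 → E3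
  smooth : ∀ e ∈ atlas E3 N, ContDiffOn ℝ ∞ (fun p : ℝ × E3 => X e p.1 p.2) (univ ×ˢ e.target)
  compat : ∀ e ∈ atlas E3 N, ∀ e' ∈ atlas E3 N, ∀ t, ∀ q ∈ e.source, q ∈ e'.source →
    X e' t (e' q) = fderiv ℝ (e' ∘ e.symm) (e q) (X e t (e q))

namespace TimeField

variable (V : TimeField N)

/-- The curve `γ` solves the differential equation given by `V` at the time `t`. -/
def IsSolAt (γ : ℝ → N) (t : ℝ) : Prop :=
  ContinuousAt γ t ∧
    ∀ e ∈ atlas E3 N, γ t ∈ e.source → HasDerivAt (e ∘ γ) (V.X e t (e (γ t))) t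

variable {V}

/-- The differential equation need only be checked in one chart. -/
lemma IsSolAt.of_chart [IsManifold (𝓡 3) ∞ N] {γ : ℝ → N} {t : ℝ} (hc : ContinuousAt γ t)
    {e : OpenPartialHomeomorph N E3} (he : e ∈ atlas E3 N) (hs : γ t ∈ e.source)
    (hd : HasDerivAt (e ∘ γ) (V.X e t (e (γ t))) t) : V.IsSolAt γ t := by
  refine ⟨hc, fun e' he' hs' => ?_⟩
  have hτ : ContDiffAt ℝ ∞ (e' ∘ e.symm) (e (γ t)) :=
    contDiffAt_coordChange he he' (e.map_source hs) (by rwa [e.left_inv hs])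
  have h1 := (hτ.differentiableAt (by simp)).hasFDerivAt.comp_hasDerivAt t hd
  rw [V.compat e he e' he' t _ hs hs']
  refine h1.congr_of_eventuallyEq ?_
  filter_upwards [hc.eventually_mem (e.open_source.mem_nhds hs)] with r hr
  simp [e.left_inv hr]

lemma IsSolAt.congr {γ γ' : ℝ → N} {t : ℝ} (h : V.IsSolAt γ t) (hγ : γ' =ᶠ[𝓝 t] γ) :
    V.IsSolAt γ' t := by
  refine ⟨h.1.congr hγ.symm, fun e he hs => ?_⟩
  rw [hγ.eq_of_nhds] at hs ⊢
  exact (h.2 e he hs).congr_of_eventuallyEq (hγ.fun_comp e)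

lemma contDiffAt_chart (V : TimeField N) {e : OpenPartialHomeomorph N E3} (he : e ∈ atlas E3 N)
    (t : ℝ) {x : E3} (hx : x ∈ e.target) :
    ContDiffAt ℝ ∞ (fun p : ℝ × E3 => V.X e p.1 p.2) (t, x) :=
  (V.smooth e he).contDiffAt ((isOpen_univ.prod e.open_target).mem_nhds ⟨mem_univ _, hx⟩)

/-- Local uniqueness of solutions. -/
lemma IsSolAt.eventuallyEq {γ γ' : ℝ → N} {t₀ : ℝ} (h : ∀ᶠ t in 𝓝 t₀, V.IsSolAt γ t)
    (h' : ∀ᶠ t in 𝓝 t₀, V.IsSolAt γ' t) (h0 : γ t₀ = γ' t₀) : γ =ᶠ[𝓝 t₀] γ' := by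
  set e := chartAt E3 (γ t₀)
  have he : e ∈ atlas E3 N := chart_mem_atlas _ _
  have hs : γ t₀ ∈ e.source := mem_chart_source _ _
  have hs' : γ' t₀ ∈ e.source := h0 ▸ hs
  let g : ℝ × E3 → ℝ × E3 := fun p => (1, V.X e p.1 p.2)
  have hg : ContDiffAt ℝ 1 g (t₀, e (γ t₀)) :=
    (contDiffAt_const.prodMk (V.contDiffAt_chart he t₀ (e.map_source hs))).of_le
      (by exact_mod_cast le_top)
  obtain ⟨K, s, hsn, hK⟩ := hg.exists_lipschitzOnWith
  have key : ∀ β : ℝ → N, (∀ᶠ t in 𝓝 t₀, V.IsSolAt β t) → β t₀ = γ t₀ →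
      (∀ᶠ t in 𝓝 t₀, HasDerivAt (fun t => (t, e (β t))) (g (t, e (β t))) t ∧
        (t, e (β t)) ∈ s) ∧ ∀ᶠ t in 𝓝 t₀, β t ∈ e.source := by
    intro β hβ hβ0
    have hβs : ∀ᶠ t in 𝓝 t₀, β t ∈ e.source :=
      hβ.self_of_nhds.1.eventually_mem (e.open_source.mem_nhds (hβ0 ▸ hs))
    refine ⟨?_, hβs⟩
    have hcont : ContinuousAt (fun t => (t, e (β t))) t₀ :=
      continuousAt_id.prodMk ((e.continuousAt (hβ0 ▸ hs)).comp hβ.self_of_nhds.1)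
    have hmem := hcont.eventually_mem (show s ∈ 𝓝 (t₀, e (β t₀)) by rw [hβ0]; exact hsn)
    filter_upwards [hβ, hβs, hmem] with t h1 h2 h3
    exact ⟨(hasDerivAt_id t).prodMk (h1.2 e he h2), h3⟩
  obtain ⟨k1, k2⟩ := key γ h rfl
  obtain ⟨k1', k2'⟩ := key γ' h' h0.symm
  have := ODE_solution_unique_of_eventually (v := fun _ => g) (s := fun _ => s) (K := K)
    (Filter.Eventually.of_forall fun _ => hK) k1 k1' (by simp [h0])
  filter_upwards [this, k2, k2'] with t ht h1 h2
  exact e.injOn h1 h2 (congrArg Prod.snd ht)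

/-- Uniqueness of solutions on open intervals. -/
lemma IsSolAt.eqOn [T2Space N] {γ γ' : ℝ → N} {J : Set ℝ} (hJ : IsOpen J) (hJ' : IsPreconnected J)
    (h : ∀ t ∈ J, V.IsSolAt γ t) (h' : ∀ t ∈ J, V.IsSolAt γ' t) {t₀ : ℝ} (ht₀ : t₀ ∈ J)
    (h0 : γ t₀ = γ' t₀) : EqOn γ γ' J := by
  have hloc : ∀ t ∈ J, γ t = γ' t → γ =ᶠ[𝓝 t] γ' := fun t ht h0 =>
    IsSolAt.eventuallyEq ((hJ.eventually_mem ht).mono h) ((hJ.eventually_mem ht).mono h') h0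
  have hsub : J ⊆ {t | γ =ᶠ[𝓝 t] γ'} := by
    refine hJ'.subset_of_closure_inter_subset ?_ ⟨t₀, ht₀, hloc t₀ ht₀ h0⟩ ?_
    · exact isOpen_iff_mem_nhds.2 fun t ht => Filter.Eventually.eventually_nhds ht
    · rintro t ⟨ht, htJ⟩
      refine hloc t htJ ?_
      by_contra hne
      obtain ⟨A, B, hA, hB, ha, hb, hAB⟩ := t2_separation hne
      have e1 := (h t htJ).1.eventually_mem (hA.mem_nhds ha)
      have e2 := (h' t htJ).1.eventually_mem (hB.mem_nhds hb)
      obtain ⟨r, ⟨hr1, hr2⟩, hr⟩ := mem_closure_iff_nhds.1 ht _ (e1.and e2)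
      have hr' : γ r = γ' r := Filter.EventuallyEq.eq_of_nhds hr
      exact disjoint_left.1 hAB hr1 (hr' ▸ hr2)
  exact fun t ht => (hsub ht).self_of_nhds

/-- Local existence of solutions, smoothly depending on the initial value. -/
lemma exists_local_evolution [IsManifold (𝓡 3) ∞ N] (V : TimeField N) (T : ℝ) (q₀ : N) :
    ∃ ε > 0, ∃ U ∈ 𝓝 q₀, ∃ Ψ : ℝ → ℝ → N → N, ∀ s ∈ Metric.ball T ε, ∀ q ∈ U,
      Ψ s s q = q ∧ ∀ t ∈ Metric.ball T ε, V.IsSolAt (fun t => Ψ s t q) t ∧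
        ContMDiffAt ((𝓡 3).prod 𝓘(ℝ, ℝ)) (𝓡 3) ∞ (fun p : N × ℝ => Ψ s p.2 p.1) (q, t) := by
  set e := chartAt E3 q₀
  have he : e ∈ atlas E3 N := chart_mem_atlas _ _
  have hq₀ : q₀ ∈ e.source := mem_chart_source _ _
  set x₀ := e q₀
  have hx₀ : x₀ ∈ e.target := e.map_source hq₀
  -- the field is cut off near `(T, x₀)`, so that it is defined on the whole space
  have hopen : IsOpen ((univ : Set ℝ) ×ˢ e.target) := isOpen_univ.prod e.open_target
  obtain ⟨R, hR, hRsub⟩ := Metric.isOpen_iff.1 hopen (T, x₀) ⟨mem_univ _, hx₀⟩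
  let bf : ContDiffBump (T, x₀) := ⟨R / 4, R / 2, by positivity, by linarith⟩
  obtain ⟨b, hbS, hbs, hb1⟩ : ∃ b : ℝ × E3 → ℝ, tsupport b ⊆ univ ×ˢ e.target ∧
      ContDiff ℝ ∞ b ∧ ∀ᶠ p in 𝓝 (T, x₀), b p = 1 := by
    refine ⟨bf, ?_, bf.contDiff, bf.eventuallyEq_one⟩
    rw [bf.tsupport_eq]
    exact (Metric.closedBall_subset_ball (by simp only [bf]; linarith)).trans hRsub
  let f : ℝ × E3 → ℝ × E3 := fun p => (1, b p • V.X e p.1 p.2)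
  have hf : ContDiff ℝ ∞ f := by
    refine contDiff_const.prodMk (contDiff_iff_contDiffAt.2 fun p => ?_)
    by_cases hp : p ∈ tsupport b
    · exact hbs.contDiffAt.smul (V.contDiffAt_chart he p.1 (hbS hp).2)
    · have : (fun p : ℝ × E3 => b p • V.X e p.1 p.2) =ᶠ[𝓝 p] fun _ => 0 := by
        filter_upwards [(isClosed_tsupport b).isOpen_compl.mem_nhds hp] with r hr
        rw [image_eq_zero_of_notMem_tsupport hr, zero_smul]
      exact contDiffAt_const.congr_of_eventuallyEq this
  obtain ⟨ε₀, hε₀, U₀, hU₀, θ, hθs, hθ0, hθd⟩ := exists_local_flow hf (T, x₀)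
  have hθc : ContinuousAt θ (0, (T, x₀)) :=
    (hθs 0 (by simpa using hε₀) _ (mem_of_mem_nhds hU₀)).continuousAt
  have hgood : ∀ᶠ p in 𝓝 (T, x₀), b p = 1 ∧ p.2 ∈ e.target :=
    hb1.and ((hopen.eventually_mem (show (T, x₀) ∈ univ ×ˢ e.target from ⟨mem_univ _, hx₀⟩)).mono
      fun p hp => hp.2)
  have hgood' : ∀ᶠ p in 𝓝 ((0 : ℝ), (T, x₀)), b (θ p) = 1 ∧ (θ p).2 ∈ e.target := by
    refine hθc.eventually (p := fun p => b p = 1 ∧ p.2 ∈ e.target) ?_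
    rwa [hθ0 _ (mem_of_mem_nhds hU₀)]
  rw [nhds_prod_eq] at hgood'
  obtain ⟨pa, hpa, pb, hpb, hgood'⟩ := Filter.eventually_prod_iff.1 hgood'
  obtain ⟨ε₁, hε₁, hpa⟩ := Metric.eventually_nhds_iff.1 hpa
  have hpb2 : ∀ᶠ p in 𝓝 (T, x₀), pb p ∧ p ∈ U₀ := hpb.and hU₀
  rw [nhds_prod_eq] at hpb2
  obtain ⟨ra, hra, rb, hrb, hpb2⟩ := Filter.eventually_prod_iff.1 hpb2
  obtain ⟨ε₂, hε₂, hra⟩ := Metric.eventually_nhds_iff.1 hra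
  set ε := min ε₂ (min ε₀ ε₁ / 2) with hεdef
  have hε : 0 < ε := by positivity
  have hst : ∀ s ∈ Metric.ball T ε, ∀ t ∈ Metric.ball T ε, |t - s| < ε₀ ∧ |t - s| < ε₁ := by
    intro s hs t ht
    rw [Metric.mem_ball, Real.dist_eq] at hs ht
    have h1 : ε ≤ min ε₀ ε₁ / 2 := min_le_right _ _
    have h2 : |t - s| < min ε₀ ε₁ := by
      have : |t - s| ≤ |t - T| + |s - T| := by
        rw [show t - s = (t - T) - (s - T) by ring]; exact abs_sub _ _
      linarith
    exact ⟨h2.trans_le (min_le_left _ _), h2.trans_le (min_le_right _ _)⟩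
  have hU : ∀ᶠ q in 𝓝 q₀, q ∈ e.source ∧ rb (e q) :=
    (e.open_source.eventually_mem hq₀).and ((e.continuousAt hq₀).eventually hrb)
  refine ⟨ε, hε, {q | q ∈ e.source ∧ rb (e q)}, hU,
    fun s t q => e.symm (θ (t - s, (s, e q))).2, ?_⟩
  rintro s hs q ⟨hq, hqb⟩
  have hsq : pb (s, e q) ∧ (s, e q) ∈ U₀ := by
    refine hpb2 (hra ?_) hqb
    exact lt_of_lt_of_le hs (min_le_left _ _)
  refine ⟨by simp [hθ0 _ hsq.2, e.left_inv hq], fun t ht => ?_⟩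
  -- the time component of the flow of the suspended field
  have htime : ∀ r, |r| < ε₀ → (θ (r, (s, e q))).1 = s + r := by
    intro r hr
    have hc : ∀ r ∈ Metric.ball (0 : ℝ) ε₀, HasDerivAt (fun r => (θ (r, (s, e q))).1 - r) 0 r := by
      intro r hr
      have h1 := hθd r (by simpa using hr) _ hsq.2
      have h2 := (hasFDerivAt_fst (𝕜 := ℝ) (p := θ (r, (s, e q)))).comp_hasDerivAt r h1
      have h3 := h2.sub (hasDerivAt_id r)
      simp only [ContinuousLinearMap.coe_fst', f, sub_self] at h3
      exact h3
    have hconv := (convex_ball (0 : ℝ) ε₀)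
    have := hconv.is_const_of_fderivWithin_eq_zero (𝕜 := ℝ)
      (f := fun r => (θ (r, (s, e q))).1 - r)
      (fun r hr => (hc r hr).differentiableAt.differentiableWithinAt)
      (fun r hr => by
        rw [fderivWithin_of_isOpen Metric.isOpen_ball hr, (hc r hr).hasFDerivAt.fderiv]; simp)
      (show r ∈ Metric.ball (0 : ℝ) ε₀ by simpa using hr)
      (show (0 : ℝ) ∈ Metric.ball (0 : ℝ) ε₀ by simpa using hε₀)
    simp only [hθ0 _ hsq.2] at this
    linarith
  obtain ⟨ht0, ht1⟩ := hst s hs t ht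
  have hg := hgood' (hpa (show dist (t - s) 0 < ε₁ by simpa [Real.dist_eq] using ht1)) hsq.1
  have hsm := hθs _ ht0 _ hsq.2
  have hder : HasDerivAt (fun t => (θ (t - s, (s, e q))).2) (V.X e t (θ (t - s, (s, e q))).2) t := by
    have h1 := hθd _ ht0 _ hsq.2
    have h2 := (hasFDerivAt_snd (𝕜 := ℝ) (p := θ (t - s, (s, e q)))).comp_hasDerivAt _ h1
    have h3 := h2.comp_sub_const t s
    have h4 : (θ (t - s, (s, e q))).1 = t := by rw [htime _ ht0]; ring
    simpa [f, hg.1, h4] using h3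
  refine ⟨IsSolAt.of_chart (e := e) ?_ he ?_ ?_, ?_⟩
  · exact (e.symm.continuousAt hg.2).comp (f := fun t => (θ (t - s, (s, e q))).2)
      hder.continuousAt
  · exact e.map_target hg.2
  · rw [e.right_inv hg.2]
    refine hder.congr_of_eventuallyEq ?_
    filter_upwards [hder.continuousAt.eventually_mem (e.open_target.mem_nhds hg.2)] with r hr
    exact e.right_inv hr
  · refine ContMDiffAt.comp (I' := 𝓡 3) (q, t) (g := e.symm)
      (f := fun p : N × ℝ => (θ (p.2 - s, (s, e p.1))).2) (contMDiffAt_chart_symm he hg.2) ?_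
    have h1 : ContMDiffAt ((𝓡 3).prod 𝓘(ℝ, ℝ)) 𝓘(ℝ, ℝ × ℝ × E3) ∞
        (fun p : N × ℝ => (p.2 - s, (s, e p.1))) (q, t) := by
      refine ContMDiffAt.prodMk_space ?_ (ContMDiffAt.prodMk_space contMDiffAt_const ?_)
      · exact contMDiffAt_snd.sub contMDiffAt_const
      · exact (contMDiffAt_chart he hq).comp (q, t) contMDiffAt_fst
    have h2 : ContDiffAt ℝ ∞ (fun p : ℝ × ℝ × E3 => (θ p).2) (t - s, (s, e q)) :=
      contDiffAt_snd.comp _ hsm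
    exact ContMDiffAt.comp (I' := 𝓘(ℝ, ℝ × ℝ × E3)) (g := fun p : ℝ × ℝ × E3 => (θ p).2)
      (f := fun p : N × ℝ => (p.2 - s, (s, e p.1))) (q, t) h2.contMDiffAt h1

/-- `Φ t q` is the value at the time `t ∈ J` of the solution which is at `q` at the time `s`; it
depends smoothly on `(q, t)`. -/
structure IsEvolution (V : TimeField N) (s : ℝ) (J : Set ℝ) (Φ : ℝ → N → N) : Prop where
  init : ∀ q, Φ s q = q
  sol : ∀ q, ∀ t ∈ J, V.IsSolAt (fun t => Φ t q) t
  smooth : ∀ q, ∀ t ∈ J,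
    ContMDiffAt ((𝓡 3).prod 𝓘(ℝ, ℝ)) (𝓡 3) ∞ (fun p : N × ℝ => Φ p.2 p.1) (q, t)

/-- Away from the support of the field, constant curves are solutions. -/
lemma isSolAt_const {K : Set N} (hV : ∀ e ∈ atlas E3 N, ∀ t, ∀ q ∈ e.source, q ∉ K →
    V.X e t (e q) = 0) {q : N} (hq : q ∉ K) (t : ℝ) : V.IsSolAt (fun _ => q) t := by
  refine ⟨continuousAt_const, fun e he hs => ?_⟩
  rw [hV e he t q hs hq]
  exact hasDerivAt_const _ _

/-- For a field of compact support, solutions starting at nearby times exist for a time which does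
not depend on the starting point. -/
lemma exists_uniform_evolution [T2Space N] [IsManifold (𝓡 3) ∞ N] {K : Set N} (hK : IsCompact K)
    (hV : ∀ e ∈ atlas E3 N, ∀ t, ∀ q ∈ e.source, q ∉ K → V.X e t (e q) = 0) (T : ℝ) :
    ∃ ε > 0, ∀ s ∈ Metric.ball T ε, ∃ Φ, V.IsEvolution s (Metric.ball T ε) Φ := by
  choose ε hε U hU Ψ hΨ using fun q₀ => V.exists_local_evolution T q₀
  obtain ⟨F, -, hF⟩ := hK.elim_nhds_subcover (fun q => interior (U q))
    (fun q _ => interior_mem_nhds.2 (hU q))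
  obtain ⟨ε', hε', hεF⟩ : ∃ ε' > 0, ∀ a ∈ F, ε' ≤ ε a := by
    rcases F.eq_empty_or_nonempty with rfl | hne
    · exact ⟨1, one_pos, by simp⟩
    · obtain ⟨a, ha, hmin⟩ := F.exists_min_image ε hne
      exact ⟨ε a, hε a, hmin⟩
  refine ⟨ε', hε', fun s hs => ?_⟩
  -- near every point there is an evolution on the whole time interval
  have hloc : ∀ q, ∃ W : Set N, W ∈ 𝓝 q ∧ ∃ Φ : ℝ → N → N, ∀ r ∈ W, Φ s r = r ∧
      ∀ t ∈ Metric.ball T ε', V.IsSolAt (fun t => Φ t r) t ∧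
        ContMDiffAt ((𝓡 3).prod 𝓘(ℝ, ℝ)) (𝓡 3) ∞ (fun p : N × ℝ => Φ p.2 p.1) (r, t) := by
    intro q
    by_cases hq : q ∈ K
    · obtain ⟨a, ha, hqa⟩ := mem_iUnion₂.1 (hF hq)
      have hb : Metric.ball T ε' ⊆ Metric.ball T (ε a) := Metric.ball_subset_ball (hεF a ha)
      refine ⟨interior (U a), isOpen_interior.mem_nhds hqa, Ψ a s, fun r hr => ?_⟩
      have := hΨ a s (hb hs) r (interior_subset hr)
      exact ⟨this.1, fun t ht => this.2 t (hb ht)⟩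
    · exact ⟨Kᶜ, hK.isClosed.isOpen_compl.mem_nhds hq, fun _ r => r, fun r hr =>
        ⟨rfl, fun t _ => ⟨isSolAt_const hV hr t, contMDiffAt_fst⟩⟩⟩
  choose W hW Φ hΦ using hloc
  refine ⟨fun t q => Φ q t q, fun q => (hΦ q q (mem_of_mem_nhds (hW q))).1,
    fun q t ht => ((hΦ q q (mem_of_mem_nhds (hW q))).2 t ht).1, fun q t ht => ?_⟩
  refine ((hΦ q q (mem_of_mem_nhds (hW q))).2 t ht).2.congr_of_eventuallyEq ?_
  have h1 : ∀ᶠ p : N × ℝ in 𝓝 (q, t), p.1 ∈ W q ∧ p.2 ∈ Metric.ball T ε' :=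
    (continuousAt_fst.eventually_mem (hW q)).and
      (continuousAt_snd.eventually_mem (Metric.isOpen_ball.mem_nhds ht))
  filter_upwards [h1] with p hp
  have hp' := mem_of_mem_nhds (hW p.1)
  refine IsSolAt.eqOn (V := V) (γ := fun t => Φ p.1 t p.1) (γ' := fun t => Φ q t p.1)
    Metric.isOpen_ball (convex_ball T ε').isPreconnected
    (fun t ht => ((hΦ p.1 p.1 hp').2 t ht).1) (fun t ht => ((hΦ q p.1 hp.1).2 t ht).1) hs ?_ hp.2
  rw [(hΦ p.1 p.1 hp').1, (hΦ q p.1 hp.1).1]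

/-- Evolutions on overlapping time intervals can be glued. -/
lemma IsEvolution.glue [T2Space N] {s s' : ℝ} {J J' : Set ℝ} {Φ Ψ : ℝ → N → N}
    (h : V.IsEvolution s J Φ) (h' : V.IsEvolution s' J' Ψ) (hJ : IsOpen J) (hJ' : IsOpen J')
    (hJp : IsPreconnected J) (hJp' : IsPreconnected J') (hs : s ∈ J) (hs' : s' ∈ J)
    (hs'' : s' ∈ J') : ∃ Φ', V.IsEvolution s (J ∪ J') Φ' := by
  classical
  have hcap : IsPreconnected (J ∩ J') := (hJp.ordConnected.inter hJp'.ordConnected).isPreconnected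
  have hagree : ∀ q, EqOn (fun t => Φ t q) (fun t => Ψ t (Φ s' q)) (J ∩ J') := fun q =>
    IsSolAt.eqOn (hJ.inter hJ') hcap (fun t ht => h.sol q t ht.1) (fun t ht => h'.sol _ t ht.2)
      ⟨hs', hs''⟩ (h'.init _).symm
  let Φ' : ℝ → N → N := fun t q => if t ∈ J then Φ t q else Ψ t (Φ s' q)
  have e1 : ∀ t ∈ J, ∀ q, Φ' t q = Φ t q := fun t ht q => if_pos ht
  have e2 : ∀ t ∈ J', ∀ q, Φ' t q = Ψ t (Φ s' q) := fun t ht q => by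
    by_cases htJ : t ∈ J
    · rw [e1 t htJ]; exact hagree q ⟨htJ, ht⟩
    · exact if_neg htJ
  have hsm : ContMDiff (𝓡 3) (𝓡 3) ∞ (Φ s') := fun q =>
    ContMDiffAt.comp (g := fun p : N × ℝ => Φ p.2 p.1) (f := fun r : N => (r, s')) q
      (h.smooth q s' hs') (contMDiffAt_id.prodMk contMDiffAt_const)
  refine ⟨Φ', fun q => by rw [e1 s hs, h.init], fun q t ht => ?_, fun q t ht => ?_⟩
  · rcases ht with ht | ht
    · refine (h.sol q t ht).congr ?_
      filter_upwards [hJ.mem_nhds ht] with r hr using e1 r hr q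
    · refine (h'.sol (Φ s' q) t ht).congr ?_
      filter_upwards [hJ'.mem_nhds ht] with r hr using e2 r hr q
  · rcases ht with ht | ht
    · refine (h.smooth q t ht).congr_of_eventuallyEq ?_
      filter_upwards [continuousAt_snd.eventually_mem (hJ.mem_nhds ht)] with p hp
        using e1 p.2 hp p.1
    · refine ContMDiffAt.congr_of_eventuallyEq (f := fun p : N × ℝ => Ψ p.2 (Φ s' p.1)) ?_ ?_
      · exact ContMDiffAt.comp (g := fun p : N × ℝ => Ψ p.2 p.1)
          (f := fun p : N × ℝ => (Φ s' p.1, p.2)) (q, t) (h'.smooth (Φ s' q) t ht)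
          (((hsm q).comp (q, t) contMDiffAt_fst).prodMk contMDiffAt_snd)
      · filter_upwards [continuousAt_snd.eventually_mem (hJ'.mem_nhds ht)] with p hp
          using e2 p.2 hp p.1

/-- Smooth vector fields of compact support have a smooth evolution for all times. -/
theorem exists_evolution [T2Space N] [IsManifold (𝓡 3) ∞ N] {K : Set N} (hK : IsCompact K)
    (hV : ∀ e ∈ atlas E3 N, ∀ t, ∀ q ∈ e.source, q ∉ K → V.X e t (e q) = 0) (s : ℝ) :
    ∃ Φ, V.IsEvolution s univ Φ := by
  choose ε hε hball using exists_uniform_evolution (V := V) hK hV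
  let A : Set ℝ := {t | ∃ J, IsOpen J ∧ IsPreconnected J ∧ s ∈ J ∧ t ∈ J ∧
    ∃ Φ, V.IsEvolution s J Φ}
  have hsA : s ∈ A := ⟨_, Metric.isOpen_ball, (convex_ball s (ε s)).isPreconnected,
    Metric.mem_ball_self (hε s), Metric.mem_ball_self (hε s), hball s s (Metric.mem_ball_self (hε s))⟩
  have hAo : IsOpen A := isOpen_iff_mem_nhds.2 fun t ⟨J, hJ, hJp, hs, ht, h⟩ =>
    Filter.mem_of_superset (hJ.mem_nhds ht) fun r hr => ⟨J, hJ, hJp, hs, hr, h⟩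
  have hAc : IsClosed A := by
    refine isClosed_of_closure_subset fun t ht => ?_
    obtain ⟨s', hs', J, hJ, hJp, hs, hs'J, Φ, hΦ⟩ :=
      mem_closure_iff_nhds.1 ht _ (Metric.ball_mem_nhds t (hε t))
    obtain ⟨Ψ, hΨ⟩ := hball t s' hs'
    have hb := (convex_ball t (ε t)).isPreconnected
    exact ⟨_, hJ.union Metric.isOpen_ball, hJp.union s' hs'J hs' hb, Or.inl hs,
      Or.inr (Metric.mem_ball_self (hε t)),
      hΦ.glue hΨ hJ Metric.isOpen_ball hJp hb hs hs'J hs'⟩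
  have hA : A = univ := IsClopen.eq_univ ⟨hAc, hAo⟩ ⟨s, hsA⟩
  have hA' : ∀ t, t ∈ A := fun t => hA ▸ mem_univ t
  choose J hJ hJp hsJ htJ Φ hΦ using hA'
  have hag : ∀ t, ∀ r ∈ J t, ∀ q, Φ r r q = Φ t r q := fun t r hr q =>
    IsSolAt.eqOn ((hJ r).inter (hJ t))
      ((hJp r).ordConnected.inter (hJp t).ordConnected).isPreconnected
      (fun a ha => (hΦ r).sol q a ha.1) (fun a ha => (hΦ t).sol q a ha.2) ⟨hsJ r, hsJ t⟩
      (by rw [(hΦ r).init, (hΦ t).init]) ⟨htJ r, hr⟩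
  refine ⟨fun t q => Φ t t q, fun q => (hΦ s).init q, fun q t _ => ?_, fun q t _ => ?_⟩
  · refine ((hΦ t).sol q t (htJ t)).congr ?_
    filter_upwards [(hJ t).mem_nhds (htJ t)] with r hr using hag t r hr q
  · refine ((hΦ t).smooth q t (htJ t)).congr_of_eventuallyEq ?_
    filter_upwards [continuousAt_snd.eventually_mem ((hJ t).mem_nhds (htJ t))] with p hp
      using hag t p.2 hp p.1

end TimeField
end Flow

/-! ### Differential forms in charts -/

section LocalForms

/-- Exterior differentiation commutes with pull-backs. -/
lemma dForm_pullback {F : Type*} [NormedAddCommGroup F] [NormedSpace ℝ F]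
    {a : E3 → (E3 →L[ℝ] ℝ)} {σ : F → E3} {u : F} (hσ : ContDiffAt ℝ ∞ σ u)
    (ha : DifferentiableAt ℝ a (σ u)) (v w : F) :
    fderiv ℝ (fun u => (a (σ u)).comp (fderiv ℝ σ u)) u v w -
      fderiv ℝ (fun u => (a (σ u)).comp (fderiv ℝ σ u)) u w v =
      dForm a (σ u) (fderiv ℝ σ u v) (fderiv ℝ σ u w) := by
  have h1 : HasFDerivAt (fun u => a (σ u)) ((fderiv ℝ a (σ u)).comp (fderiv ℝ σ u)) u :=
    ha.hasFDerivAt.comp u (hσ.differentiableAt (by simp)).hasFDerivAt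
  have h2 : HasFDerivAt (fderiv ℝ σ) (fderiv ℝ (fderiv ℝ σ) u) u :=
    ((hσ.fderiv_right (m := ∞) (by simp)).differentiableAt (by simp)).hasFDerivAt
  have hsymm : IsSymmSndFDerivAt ℝ σ u :=
    hσ.isSymmSndFDerivAt (by
      rw [minSmoothness_of_isRCLikeNormedField]
      exact ENat.LEInfty.out)
  have h3 := (h1.clm_comp h2).fderiv
  rw [h3]
  simp only [dForm, add_apply, ContinuousLinearMap.comp_apply,
    ContinuousLinearMap.compL_apply, ContinuousLinearMap.flip_apply]
  rw [hsymm.eq v w]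
  ring

/-- The standard basis of `ℝ³`. -/
abbrev stdE (n : Fin 3) : E3 := EuclideanSpace.single n 1

lemma eq_sum_stdE (v : E3) : v = v 0 • stdE 0 + v 1 • stdE 1 + v 2 • stdE 2 := by
  ext n; fin_cases n <;> simp

/-- The determinant of three vectors of `ℝ³`. -/
def det3 (u v w : E3) : ℝ :=
  u 0 * (v 1 * w 2 - v 2 * w 1) + u 1 * (v 2 * w 0 - v 0 * w 2) + u 2 * (v 0 * w 1 - v 1 * w 0)

/-- A 3-form on `ℝ³` is the determinant times its value on the standard basis. -/
lemma wedgeD_eq_det3_mul (a : E3 → (E3 →L[ℝ] ℝ)) (x u v w : E3) :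
    wedgeD a x u v w = det3 u v w * wedgeD a x (stdE 0) (stdE 1) (stdE 2) := by
  conv_lhs => rw [eq_sum_stdE u, eq_sum_stdE v, eq_sum_stdE w]
  simp only [wedgeD, dForm, map_add, map_smul, add_apply,
    smul_apply, smul_eq_mul, det3]
  ring

lemma wedgeD_pullback {a b : E3 → (E3 →L[ℝ] ℝ)} {τ : E3 → E3} {x : E3}
    (hτ : ContDiffAt ℝ ∞ τ x) (ha : DifferentiableAt ℝ a (τ x))
    (hb : b =ᶠ[𝓝 x] fun y => (a (τ y)).comp (fderiv ℝ τ y)) (u v w : E3) :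
    wedgeD b x u v w =
      wedgeD a (τ x) (fderiv ℝ τ x u) (fderiv ℝ τ x v) (fderiv ℝ τ x w) := by
  have h : ∀ v w, dForm b x v w = dForm a (τ x) (fderiv ℝ τ x v) (fderiv ℝ τ x w) := by
    intro v w
    rw [← dForm_pullback hτ ha, dForm, hb.fderiv_eq]
  simp only [wedgeD, h, hb.eq_of_nhds, ContinuousLinearMap.comp_apply]

/-- Two non-zero covectors with the same kernel and the same coorientation are positively
proportional. -/
lemma exists_pos_smul_of_ker_eq {E : Type*} [AddCommGroup E] [Module ℝ E] [TopologicalSpace E]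
    {A B : E →L[ℝ] ℝ} (hA : A ≠ 0)
    (hk : LinearMap.ker A.toLinearMap = LinearMap.ker B.toLinearMap)
    (hp : {v | 0 < A v} = {v | 0 < B v}) : ∃ f : ℝ, 0 < f ∧ B = f • A := by
  obtain ⟨y, hy⟩ : ∃ y, 0 < A y := by
    by_contra! h
    refine hA (ContinuousLinearMap.ext fun v => le_antisymm (h v) ?_)
    simpa using h (-v)
  have hBy : 0 < B y := by
    have : y ∈ {v | 0 < B v} := hp ▸ hy
    exact this
  refine ⟨B y / A y, by positivity, ContinuousLinearMap.ext fun v => ?_⟩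
  have h1 : v - (A v / A y) • y ∈ LinearMap.ker A.toLinearMap := by
    simp [hy.ne']
  rw [hk] at h1
  have h2 : B v - A v / A y * B y = 0 := by simpa using h1
  simp only [smul_apply, smul_eq_mul]
  field_simp at h2 ⊢
  linarith

end LocalForms

section Forms

variable {N : Type*} [TopologicalSpace N] [ChartedSpace E3 N]

lemma mfderiv_chart_symm_comp [IsManifold (𝓡 3) ∞ N] {e : OpenPartialHomeomorph N E3}
    (he : e ∈ atlas E3 N) {q : N} (hq : q ∈ e.source) (v : TangentSpace (𝓡 3) q) :
    mfderiv 𝓘(ℝ, E3) (𝓡 3) e.symm (e q) (mfderiv (𝓡 3) 𝓘(ℝ, E3) e q v) = v := by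
  have h1 : MDifferentiableAt (𝓡 3) 𝓘(ℝ, E3) e q := (contMDiffAt_chart he hq).mdifferentiableAt
    (by simp)
  have h2 : MDifferentiableAt 𝓘(ℝ, E3) (𝓡 3) e.symm (e q) :=
    (contMDiffAt_chart_symm he (e.map_source hq)).mdifferentiableAt (by simp)
  have h3 := mfderiv_comp q h2 h1
  have h4 : (e.symm ∘ e) =ᶠ[𝓝 q] id := by
    filter_upwards [e.open_source.mem_nhds hq] with r hr using e.left_inv hr
  rw [h4.mfderiv_eq, mfderiv_id] at h3
  exact (DFunLike.congr_fun h3 v).symm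

/-- The value of a form on a tangent vector, computed in a chart. -/
lemma OneForm.inChart_mfderiv [IsManifold (𝓡 3) ∞ N] (α : OneForm N)
    {e : OpenPartialHomeomorph N E3} (he : e ∈ atlas E3 N) {q : N} (hq : q ∈ e.source)
    (v : TangentSpace (𝓡 3) q) :
    α.inChart e (e q) (mfderiv (𝓡 3) 𝓘(ℝ, E3) e q v) = α q v := by
  have h := mfderiv_chart_symm_comp he hq v
  have hq' := e.left_inv hq
  rw [OneForm.inChart]
  change α (e.symm (e q)) _ = α q v
  have h5 : (mfderiv 𝓘(ℝ, E3) (𝓡 3) e.symm (e q) (mfderiv (𝓡 3) 𝓘(ℝ, E3) e q v) : E3) = v := h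
  refine Eq.trans (congrArg (α (e.symm (e q)) : E3 → ℝ) h5) ?_
  have : ∀ q', q' = q → (α q' : E3 → ℝ) v = (α q : E3 → ℝ) v := by rintro _ rfl; rfl
  exact this _ hq'

/-- The value of a form on the derivative of a map, computed in a chart. -/
lemma OneForm.inChart_mfderiv_comp [IsManifold (𝓡 3) ∞ N] (α : OneForm N)
    {e : OpenPartialHomeomorph N E3} (he : e ∈ atlas E3 N)
    {F : Type*} [NormedAddCommGroup F] [NormedSpace ℝ F] {H : Type*} [TopologicalSpace H]
    {I : ModelWithCorners ℝ F H} {M : Type*} [TopologicalSpace M] [ChartedSpace H M]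
    {c : M → N} {m : M} (hc : MDifferentiableAt I (𝓡 3) c m) (hq : c m ∈ e.source)
    (w : TangentSpace I m) :
    α.inChart e (e (c m)) (mfderiv I 𝓘(ℝ, E3) (e ∘ c) m w) = α (c m) (mfderiv I (𝓡 3) c m w) := by
  rw [mfderiv_comp m ((contMDiffAt_chart he hq).mdifferentiableAt (by simp)) hc]
  exact α.inChart_mfderiv he hq _

/-- Transformation of forms under coordinate changes. -/
lemma OneForm.inChart_compat [IsManifold (𝓡 3) ∞ N] (α : OneForm N)
    {e e' : OpenPartialHomeomorph N E3} (he : e ∈ atlas E3 N) (he' : e' ∈ atlas E3 N) {x : E3}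
    (hx : x ∈ e.target) (hx' : e.symm x ∈ e'.source) :
    α.inChart e x = (α.inChart e' ((e' ∘ e.symm) x)).comp (fderiv ℝ (e' ∘ e.symm) x) := by
  ext w
  have := α.inChart_mfderiv_comp he' (c := e.symm) (m := x) (I := 𝓘(ℝ, E3))
    ((contMDiffAt_chart_symm he hx).mdifferentiableAt (by simp)) hx' w
  rw [mfderiv_eq_fderiv] at this
  exact this.symm

lemma OneForm.SmoothOn.contDiffAt {α : OneForm N} {W : Set N} (hα : α.SmoothOn W) (hW : IsOpen W)
    {e : OpenPartialHomeomorph N E3} (he : e ∈ atlas E3 N) {x : E3} (hx : x ∈ e.target)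
    (hxW : e.symm x ∈ W) : ContDiffAt ℝ ∞ (α.inChart e) x :=
  (hα e he).contDiffAt ((e.isOpen_inter_preimage_symm hW).mem_nhds ⟨hx, hxW⟩)

lemma OneForm.IsPosContact.ne_zero [IsManifold (𝓡 3) ∞ N] {α : OneForm N} (hα : α.IsPosContact)
    (q : N) : α q ≠ 0 := by
  intro h
  have he := chart_mem_atlas E3 q
  have hq := mem_chart_source E3 q
  have h1 := hα.2 _ he _ ((chartAt E3 q).map_source hq)
  have h2 : α.inChart (chartAt E3 q) (chartAt E3 q q) = 0 := by
    have h3 : ∀ q', q' = q → (α q' : E3 →L[ℝ] ℝ) = 0 := by rintro _ rfl; exact h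
    rw [OneForm.inChart]
    have h4 := h3 _ ((chartAt E3 q).left_inv hq)
    ext v
    exact DFunLike.congr_fun h4 _
  simp [wedgeD, h2] at h1

/-- Two smooth forms defining the same cooriented plane field differ by a smooth positive factor. -/
lemma OneForm.exists_ratio [IsManifold (𝓡 3) ∞ N] {α β : OneForm N} {W : Set N} (hW : IsOpen W)
    (hα : α.SmoothOn W) (hβ : β.SmoothOn W) (hα0 : ∀ q ∈ W, α q ≠ 0) {ξ : PlaneField N}
    (hαξ : α.Defines ξ W) (hβξ : β.Defines ξ W) :
    ∃ f : N → ℝ, (∀ q ∈ W, 0 < f q ∧ ∀ v, β q v = f q * α q v) ∧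
      ContMDiffOn (𝓡 3) 𝓘(ℝ, ℝ) ∞ f W := by
  have h : ∀ q, ∃ r : ℝ, q ∈ W → 0 < r ∧ β q = r • α q := by
    intro q
    by_cases hq : q ∈ W
    · obtain ⟨r, hr⟩ := exists_pos_smul_of_ker_eq (hα0 q hq)
        ((hαξ q hq).1.symm.trans (hβξ q hq).1) ((hαξ q hq).2.symm.trans (hβξ q hq).2)
      exact ⟨r, fun _ => hr⟩
    · exact ⟨0, fun h => absurd h hq⟩
  choose f hf using h
  have hf' : ∀ q ∈ W, ∀ v, β q v = f q * α q v := fun q hq v => by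
    rw [(hf q hq).2]; rfl
  refine ⟨f, fun q hq => ⟨(hf q hq).1, hf' q hq⟩, fun q hq => ContMDiffAt.contMDiffWithinAt ?_⟩
  set e := chartAt E3 q
  have he : e ∈ atlas E3 N := chart_mem_atlas E3 q
  have hqe : q ∈ e.source := mem_chart_source E3 q
  have hqW : e.symm (e q) ∈ W := by rwa [e.left_inv hqe]
  have h1 := hα.contDiffAt hW he (e.map_source hqe) hqW
  have h2 := hβ.contDiffAt hW he (e.map_source hqe) hqW
  obtain ⟨v, hv⟩ : ∃ v, α q v ≠ 0 := by
    by_contra! h0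
    exact hα0 q hq (ContinuousLinearMap.ext h0)
  -- near `q` the factor is the quotient of the values on a constant vector of the chart
  set y : E3 := mfderiv (𝓡 3) 𝓘(ℝ, E3) e q v
  have hy : α.inChart e (e q) y ≠ 0 := by rwa [α.inChart_mfderiv he hqe]
  have h3 : ContDiffAt ℝ ∞ (fun x => β.inChart e x y / α.inChart e x y) (e q) :=
    (h2.clm_apply contDiffAt_const).div (h1.clm_apply contDiffAt_const) hy
  have h4 : ContMDiffAt (𝓡 3) 𝓘(ℝ, ℝ) ∞ (fun r => β.inChart e (e r) y / α.inChart e (e r) y) q :=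
    ContMDiffAt.comp (I' := 𝓘(ℝ, E3)) (g := fun x => β.inChart e x y / α.inChart e x y) q
      h3.contMDiffAt (contMDiffAt_chart he hqe)
  refine h4.congr_of_eventuallyEq ?_
  have h5 : ∀ᶠ r in 𝓝 q, α.inChart e (e r) y ≠ 0 :=
    ((h1.clm_apply contDiffAt_const).continuousAt.comp
      (f := e) (g := fun x => α.inChart e x y) (e.continuousAt hqe)).eventually_ne hy
  filter_upwards [hW.mem_nhds hq, e.open_source.mem_nhds hqe, h5] with r hr hre h6
  rw [eq_div_iff h6]
  have h7 : e.symm (e r) = r := e.left_inv hre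
  have h8 : ∀ (γ : OneForm N) (z : E3), γ.inChart e (e r) z =
      (γ r : E3 → ℝ) (mfderiv 𝓘(ℝ, E3) (𝓡 3) e.symm (e r) z) := by
    intro γ z
    have : ∀ q', q' = r → ∀ z : E3, (γ q' : E3 → ℝ) z = (γ r : E3 → ℝ) z := by
      rintro _ rfl z; rfl
    exact this _ h7 _
  rw [h8, h8]
  exact (hf' r hr _).symm

end Forms

/-! ### Characteristic foliations -/

namespace BranchedSurface

variable {h : ℝ → ℝ} {P : Type*} [TopologicalSpace P] (S : BranchedSurface h P)
variable {N : Type*} [TopologicalSpace N] [ChartedSpace E3 N]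

lemma mem_tangentPlane (i : P → N) (j : Fin S.n) (k : (S.kind j).sheets) (u w : ℝ × ℝ) :
    mfderiv 𝓘(ℝ, ℝ × ℝ) (𝓡 3) (i ∘ S.sheet j k) u w ∈ S.tangentPlane i (S.sheet j k u) := by
  have h1 : (LinearMap.range
      (mfderiv 𝓘(ℝ, ℝ × ℝ) (𝓡 3) (i ∘ S.sheet j k) u).toLinearMap : Submodule ℝ E3) ≤
      S.tangentPlane i (S.sheet j k u) :=
    le_iSup_of_le j (le_iSup_of_le k (le_iSup_of_le u (le_iSup_of_le rfl le_rfl)))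
  exact h1 ⟨w, rfl⟩

lemma exists_sheet_eq (p : P) : ∃ j k u, S.sheet j k u = p := by
  obtain ⟨j, ⟨w, hw⟩⟩ := mem_iUnion.1 (S.cover ▸ mem_univ p : p ∈ ⋃ j, range (S.chart j))
  obtain ⟨k, hk, u, hu⟩ := mem_iUnion₂.1 w.2
  exact ⟨j, ⟨k, hk⟩, u, by rw [← hw]; exact congrArg _ (Subtype.ext hu)⟩

variable {S}
variable {i : P → N}

lemma IsSmoothEmbedding.mdifferentiableAt (hi : S.IsSmoothEmbedding i) (j) (k) (u : ℝ × ℝ) :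
    MDifferentiableAt 𝓘(ℝ, ℝ × ℝ) (𝓡 3) (i ∘ S.sheet j k) u :=
  (hi.smooth j k).mdifferentiableAt (by simp)

lemma IsSmoothEmbedding.contDiffAt_chart [IsManifold (𝓡 3) ∞ N] (hi : S.IsSmoothEmbedding i) {j}
    {k} {u : ℝ × ℝ} {e : OpenPartialHomeomorph N E3} (he : e ∈ atlas E3 N)
    (hu : i (S.sheet j k u) ∈ e.source) : ContDiffAt ℝ ∞ (e ∘ i ∘ S.sheet j k) u :=
  (ContMDiffAt.comp (I' := 𝓡 3) (g := e) (f := i ∘ S.sheet j k) u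
    (contMDiffAt_chart he hu) (hi.smooth j k u)).contDiffAt

/-- Restrictions of smooth functions to a branched surface are smooth. -/
lemma IsSmoothEmbedding.isSmooth_comp (hi : S.IsSmoothEmbedding i) {f : N → ℝ} {W : Set N}
    (hW : IsOpen W) (hiW : range i ⊆ W) (hf : ContMDiffOn (𝓡 3) 𝓘(ℝ, ℝ) ∞ f W) :
    S.IsSmooth (f ∘ i) := fun j k => by
  rw [← contMDiff_iff_contDiff]
  intro u
  exact ContMDiffAt.comp (I' := 𝓡 3) (g := f) (f := i ∘ S.sheet j k) u
    (hf.contMDiffAt (hW.mem_nhds (hiW (mem_range_self _)))) (hi.smooth j k u)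

lemma IsSmooth.mul {f g : P → ℝ} (hf : S.IsSmooth f) (hg : S.IsSmooth g) :
    S.IsSmooth (fun p => f p * g p) := fun j k => (hf j k).mul (hg j k)

lemma IsSmooth.inv {f : P → ℝ} (hf : S.IsSmooth f) (hpos : ∀ p, 0 < f p) :
    S.IsSmooth (fun p => (f p)⁻¹) := fun j k => (hf j k).inv fun _ => (hpos _).ne'

/-- Contact forms whose kernels induce the same characteristic foliation have proportional
restrictions to the branched surface. The factor is smooth on the branched surface; in general it
does not extend to a smooth function on the ambient manifold. -/
lemma exists_factor [IsManifold (𝓡 3) ∞ N] (hi : S.IsSmoothEmbedding i) {ξ₀ ξ₁ : PlaneField N}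
    {α₀ α₁ : OneForm N} (hα₀ : α₀.IsPosContact) (hα₁ : α₁.IsPosContact)
    (hξ₀ : α₀.Defines ξ₀ univ) (hξ₁ : α₁.Defines ξ₁ univ)
    (hF : S.charFoliation i ξ₀ = S.charFoliation i ξ₁) :
    ∃ g : P → ℝ, S.IsSmooth g ∧ (∀ p, 0 < g p) ∧
      ∀ (p : P) (v : S.tangentPlane i p),
        α₁ (i p) (v : TangentSpace (𝓡 3) (i p)) = g p * α₀ (i p) (v : TangentSpace (𝓡 3) (i p)) := by
  have hmem : (fun p => (α₀ (i p)).toLinearMap.comp (S.tangentPlane i p).subtype) ∈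
      S.charFoliation i ξ₀ :=
    ⟨univ, α₀, fun _ => 1, isOpen_univ, subset_univ _, hα₀.1, hξ₀, fun _ _ => contDiff_const,
      fun _ => one_pos, fun p v => (one_mul _).symm⟩
  rw [hF] at hmem
  obtain ⟨W, β, g, hW, hiW, hβ, hβξ, hg, hgpos, hgv⟩ := hmem
  have hsub : α₁.Defines ξ₁ W := fun q _ => hξ₁ q (mem_univ q)
  obtain ⟨f, hf, hfs⟩ := OneForm.exists_ratio hW
    (fun e he => (hα₁.1 e he).mono (by simp)) hβ (fun q _ => hα₁.ne_zero q) hsub hβξ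
  have hpos : ∀ p, 0 < g p * f (i p) := fun p =>
    mul_pos (hgpos p) (hf _ (hiW (mem_range_self p))).1
  refine ⟨fun p => (g p * f (i p))⁻¹, (hg.mul (hi.isSmooth_comp hW hiW hfs)).inv hpos,
    fun p => inv_pos.2 (hpos p), fun p v => ?_⟩
  have h1 : α₀ (i p) (v : TangentSpace (𝓡 3) (i p)) =
      g p * β (i p) (v : TangentSpace (𝓡 3) (i p)) := hgv p v
  rw [h1, (hf _ (hiW (mem_range_self p))).2, ← mul_assoc (g p), inv_mul_cancel_left₀ (hpos p).ne']

/-- One half of `charFoliation_eq`. The factors in the definition of the characteristic foliation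
absorb both the factor `g` and the quotient of two defining forms of `ξ`. -/
lemma charFoliation_subset [IsManifold (𝓡 3) ∞ N] (hi : S.IsSmoothEmbedding i)
    {ξ ξ' : PlaneField N} {α α' : OneForm N} {W W' : Set N} (hW : IsOpen W) (hW' : IsOpen W')
    (hiW : range i ⊆ W) (hiW' : range i ⊆ W') (hα : α.SmoothOn W) (hα' : α'.SmoothOn W')
    (hα0 : ∀ q ∈ W, α q ≠ 0) (hξ : α.Defines ξ W) (hξ' : α'.Defines ξ' W') {g : P → ℝ}
    (hg : S.IsSmooth g) (hgpos : ∀ p, 0 < g p)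
    (hgα : ∀ (p : P) (v : S.tangentPlane i p),
      α' (i p) (v : TangentSpace (𝓡 3) (i p)) = g p * α (i p) (v : TangentSpace (𝓡 3) (i p))) :
    S.charFoliation i ξ ⊆ S.charFoliation i ξ' := by
  rintro β ⟨W₂, α₂, g₂, hW₂, hiW₂, hα₂, hξ₂, hg₂, hg₂pos, hβ⟩
  have hcap : IsOpen (W ∩ W₂) := hW.inter hW₂
  have hi2 : range i ⊆ W ∩ W₂ := subset_inter hiW hiW₂
  obtain ⟨f, hf, hfs⟩ := OneForm.exists_ratio (ξ := ξ) hcap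
    (fun e he => (hα e he).mono (inter_subset_inter_right _ (preimage_mono inter_subset_left)))
    (fun e he => (hα₂ e he).mono (inter_subset_inter_right _ (preimage_mono inter_subset_right)))
    (fun q hq => hα0 q hq.1) (fun q hq => hξ q hq.1) (fun q hq => hξ₂ q hq.2)
  have hfpos : ∀ p, 0 < f (i p) := fun p => (hf _ (hi2 (mem_range_self p))).1
  refine ⟨W', α', fun p => g₂ p * f (i p) * (g p)⁻¹, hW', hiW', hα', hξ',
    (hg₂.mul (hi.isSmooth_comp hcap hi2 hfs)).mul (hg.inv hgpos),
    fun p => mul_pos (mul_pos (hg₂pos p) (hfpos p)) (inv_pos.2 (hgpos p)), fun p v => ?_⟩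
  rw [hβ, hgα, (hf _ (hi2 (mem_range_self p))).2, mul_assoc (g₂ p * f (i p)),
    inv_mul_cancel_left₀ (hgpos p).ne', mul_assoc]

/-- Two plane fields have the same characteristic foliation if the restrictions of defining forms to
the branched surface differ by a smooth positive factor. -/
lemma charFoliation_eq [IsManifold (𝓡 3) ∞ N] (hi : S.IsSmoothEmbedding i)
    {ξ ξ' : PlaneField N} {α α' : OneForm N} {W W' : Set N} (hW : IsOpen W) (hW' : IsOpen W')
    (hiW : range i ⊆ W) (hiW' : range i ⊆ W') (hα : α.SmoothOn W) (hα' : α'.SmoothOn W')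
    (hα0 : ∀ q ∈ W, α q ≠ 0) (hα0' : ∀ q ∈ W', α' q ≠ 0)
    (hξ : α.Defines ξ W) (hξ' : α'.Defines ξ' W') {g : P → ℝ}
    (hg : S.IsSmooth g) (hgpos : ∀ p, 0 < g p)
    (hgα : ∀ (p : P) (v : S.tangentPlane i p),
      α' (i p) (v : TangentSpace (𝓡 3) (i p)) = g p * α (i p) (v : TangentSpace (𝓡 3) (i p))) :
    S.charFoliation i ξ = S.charFoliation i ξ' := by
  refine Subset.antisymm
    (charFoliation_subset hi hW hW' hiW hiW' hα hα' hα0 hξ hξ' hg hgpos hgα)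
    (charFoliation_subset hi hW' hW hiW' hiW hα' hα hα0' hξ' hξ (hg.inv hgpos)
      (fun p => inv_pos.2 (hgpos p)) fun p v => ?_)
  rw [hgα, inv_mul_cancel_left₀ (hgpos p).ne']

end BranchedSurface

/-! ### Contact forms in a path between two contact forms -/

lemma dForm_add_smul {a b : E3 → (E3 →L[ℝ] ℝ)} {f : E3 → ℝ} {x : E3} (c : ℝ)
    (ha : DifferentiableAt ℝ a x) (hb : DifferentiableAt ℝ b x) (hf : DifferentiableAt ℝ f x)
    (v w : E3) :
    dForm (fun y => c • a y + f y • b y) x v w =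
      c * dForm a x v w + f x * dForm b x v w + (fderiv ℝ f x v * b x w - fderiv ℝ f x w * b x v) := by
  have h : HasFDerivAt (fun y => c • a y + f y • b y)
      (c • fderiv ℝ a x + (f x • fderiv ℝ b x + (fderiv ℝ f x).smulRight (b x))) x :=
    (ha.hasFDerivAt.const_smul c).add (hf.hasFDerivAt.smul hb.hasFDerivAt)
  simp only [dForm, h.fderiv, add_apply, smul_apply, smul_eq_mul,
    ContinuousLinearMap.smulRight_apply]
  ring

/-- Let the restrictions of `a₀` and `a₁` to a surface satisfy `a₁ = e ^ G a₀`. Then the 3-form of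
the contact condition for `c₀ a₀ + c₁ e ^ (-F) a₁` depends at the points of the surface only on the
derivatives of `F - G` along the surface, and is positive if these derivatives vanish. -/
lemma wedgeD_path {a₀ a₁ : E3 → (E3 →L[ℝ] ℝ)} {F : E3 → ℝ} {σ : ℝ × ℝ → E3} {u : ℝ × ℝ}
    {G : ℝ × ℝ → ℝ} (hσ : ContDiffAt ℝ ∞ σ u) (ha₀ : DifferentiableAt ℝ a₀ (σ u))
    (ha₁ : DifferentiableAt ℝ a₁ (σ u)) (hF : DifferentiableAt ℝ F (σ u))
    (hG : DifferentiableAt ℝ G u)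
    (hrel : ∀ᶠ u' in 𝓝 u, ∀ w, a₁ (σ u') (fderiv ℝ σ u' w) =
      Real.exp (G u') * a₀ (σ u') (fderiv ℝ σ u' w)) (c₀ c₁ : ℝ) (ν : E3) :
    wedgeD (fun x => c₀ • a₀ x + (c₁ * Real.exp (-F x)) • a₁ x) (σ u)
      (fderiv ℝ σ u (1, 0)) (fderiv ℝ σ u (0, 1)) ν =
    c₀ ^ 2 * wedgeD a₀ (σ u) (fderiv ℝ σ u (1, 0)) (fderiv ℝ σ u (0, 1)) ν +
    (c₁ * Real.exp (-F (σ u))) ^ 2 *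
      wedgeD a₁ (σ u) (fderiv ℝ σ u (1, 0)) (fderiv ℝ σ u (0, 1)) ν +
    c₀ * (c₁ * Real.exp (-F (σ u))) *
      (Real.exp (-G u) * wedgeD a₁ (σ u) (fderiv ℝ σ u (1, 0)) (fderiv ℝ σ u (0, 1)) ν +
       Real.exp (G u) * wedgeD a₀ (σ u) (fderiv ℝ σ u (1, 0)) (fderiv ℝ σ u (0, 1)) ν +
       (a₁ (σ u) ν - Real.exp (G u) * a₀ (σ u) ν) *
        (fderiv ℝ (fun u' => F (σ u') - G u') u (1, 0) * a₀ (σ u) (fderiv ℝ σ u (0, 1)) -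
         fderiv ℝ (fun u' => F (σ u') - G u') u (0, 1) * a₀ (σ u) (fderiv ℝ σ u (1, 0)))) := by
  have hσd := (hσ.differentiableAt (by simp)).hasFDerivAt
  -- exterior derivative of the relation between the restrictions
  have hd : dForm a₁ (σ u) (fderiv ℝ σ u (1, 0)) (fderiv ℝ σ u (0, 1)) =
      Real.exp (G u) * (fderiv ℝ G u (1, 0) * a₀ (σ u) (fderiv ℝ σ u (0, 1)) -
        fderiv ℝ G u (0, 1) * a₀ (σ u) (fderiv ℝ σ u (1, 0)) +
        dForm a₀ (σ u) (fderiv ℝ σ u (1, 0)) (fderiv ℝ σ u (0, 1))) := by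
    rw [← dForm_pullback hσ ha₁, ← dForm_pullback hσ ha₀]
    have heq : (fun u' => (a₁ (σ u')).comp (fderiv ℝ σ u')) =ᶠ[𝓝 u]
        fun u' => Real.exp (G u') • (a₀ (σ u')).comp (fderiv ℝ σ u') := by
      filter_upwards [hrel] with u' hu'
      exact ContinuousLinearMap.ext fun w => by simpa using hu' w
    have h0 : DifferentiableAt ℝ (fun u' => (a₀ (σ u')).comp (fderiv ℝ σ u')) u :=
      (ha₀.comp u hσd.differentiableAt).clm_comp
        ((hσ.fderiv_right (m := ∞) (by simp)).differentiableAt (by simp))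
    have h1 := hG.hasFDerivAt.exp.fun_smul h0.hasFDerivAt
    rw [heq.fderiv_eq, h1.fderiv]
    simp only [add_apply, smul_apply, smul_eq_mul,
      ContinuousLinearMap.smulRight_apply, ContinuousLinearMap.comp_apply]
    ring
  have hΔ : fderiv ℝ (fun u' => F (σ u') - G u') u =
      (fderiv ℝ F (σ u)).comp (fderiv ℝ σ u) - fderiv ℝ G u :=
    ((hF.hasFDerivAt.comp u hσd).sub hG.hasFDerivAt).fderiv
  have hexp : HasFDerivAt (fun x => c₁ * Real.exp (-F x))
      (c₁ • (Real.exp (-F (σ u)) • -fderiv ℝ F (σ u))) (σ u) :=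
    hF.hasFDerivAt.neg.exp.const_mul c₁
  have r1 := hrel.self_of_nhds (1, 0)
  have r2 := hrel.self_of_nhds (0, 1)
  have hG0 : Real.exp (-G u) = (Real.exp (G u))⁻¹ := Real.exp_neg _
  have hGne := (Real.exp_pos (G u)).ne'
  simp only [wedgeD, dForm_add_smul c₀ ha₀ ha₁ hexp.differentiableAt, hexp.fderiv, hΔ, hd, r1, r2,
    hG0, add_apply, smul_apply, smul_eq_mul, sub_apply,
    neg_apply, ContinuousLinearMap.comp_apply]
  field_simp
  ring

lemma exists_det3_pos {E₁ E₂ : E3} (h : ∀ s t : ℝ, s • E₁ + t • E₂ = 0 → s = 0 ∧ t = 0) :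
    ∃ ν, 0 < det3 E₁ E₂ ν := by
  have key : ∃ ν, det3 E₁ E₂ ν ≠ 0 := by
    by_contra! h0
    have h1 := h0 (stdE 0)
    have h2 := h0 (stdE 1)
    have h3 := h0 (stdE 2)
    simp [det3] at h1 h2 h3
    have hz : ∀ m, E₁ m = 0 := by
      intro m
      have hc : (-(E₂ m)) • E₁ + (E₁ m) • E₂ = 0 := by
        ext n
        fin_cases m <;> fin_cases n <;> simp <;> linarith
      exact (h _ _ hc).2
    have := h 1 0 (by ext n; simp [hz n])
    exact one_ne_zero this.1
  obtain ⟨ν, hν⟩ := key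
  rcases hν.lt_or_gt with h1 | h1
  · refine ⟨-ν, ?_⟩
    have : det3 E₁ E₂ (-ν) = -det3 E₁ E₂ ν := by simp [det3]; ring
    linarith
  · exact ⟨ν, h1⟩

lemma continuousAt_wedgeD {Z : Type*} [TopologicalSpace Z] {a : E3 → (E3 →L[ℝ] ℝ)} {z : Z}
    {x u v w : Z → E3} (ha : ContDiffAt ℝ ∞ a (x z)) (hx : ContinuousAt x z)
    (hu : ContinuousAt u z) (hv : ContinuousAt v z) (hw : ContinuousAt w z) :
    ContinuousAt (fun z => wedgeD a (x z) (u z) (v z) (w z)) z := by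
  have h1 : ContinuousAt (fun z => a (x z)) z := ha.continuousAt.comp hx
  have h2 : ContinuousAt (fun z => fderiv ℝ a (x z)) z :=
    ((ha.fderiv_right (m := ∞) (by simp)).continuousAt).comp hx
  unfold wedgeD dForm
  fun_prop

namespace BranchedSurface

variable {h : ℝ → ℝ} {P : Type*} [TopologicalSpace P] {S : BranchedSurface h P}
variable {N : Type*} [TopologicalSpace N] [ChartedSpace E3 N]
variable {i : P → N}

lemma IsSmoothEmbedding.injective_fderiv_chart [IsManifold (𝓡 3) ∞ N]
    (hi : S.IsSmoothEmbedding i) {j}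
    {k} {u : ℝ × ℝ} {e : OpenPartialHomeomorph N E3} (he : e ∈ atlas E3 N)
    (hu : i (S.sheet j k u) ∈ e.source) :
    Function.Injective (fderiv ℝ (e ∘ i ∘ S.sheet j k) u) := by
  rw [← mfderiv_eq_fderiv, mfderiv_comp u (g := e) (f := i ∘ S.sheet j k) (I' := 𝓡 3)
    ((contMDiffAt_chart he hu).mdifferentiableAt (by simp)) (hi.mdifferentiableAt j k u)]
  refine Function.Injective.comp (g := mfderiv (𝓡 3) 𝓘(ℝ, E3) e ((i ∘ S.sheet j k) u))
    (fun v w hvw => ?_) (hi.immersion j k u)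
  have h1 := mfderiv_chart_symm_comp he hu v
  have h2 := mfderiv_chart_symm_comp he hu w
  rw [← h1, ← h2]
  exact congrArg _ hvw

lemma IsSmoothEmbedding.exists_det3_pos [IsManifold (𝓡 3) ∞ N] (hi : S.IsSmoothEmbedding i) {j}
    {k} {u : ℝ × ℝ} {e : OpenPartialHomeomorph N E3} (he : e ∈ atlas E3 N)
    (hu : i (S.sheet j k u) ∈ e.source) : ∃ ν, 0 < det3 (fderiv ℝ (e ∘ i ∘ S.sheet j k) u (1, 0))
      (fderiv ℝ (e ∘ i ∘ S.sheet j k) u (0, 1)) ν := by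
  refine BranchedContact.exists_det3_pos fun s t hst => ?_
  have h1 : fderiv ℝ (e ∘ i ∘ S.sheet j k) u (s, t) = 0 := by
    rw [← hst, ← map_smul, ← map_smul, ← map_add]; simp
  have h2 := hi.injective_fderiv_chart he hu (h1.trans (map_zero _).symm)
  simpa using h2

/-- The relation between the restrictions of two forms along a sheet, in a chart. -/
lemma IsSmoothEmbedding.inChart_sheet [IsManifold (𝓡 3) ∞ N] (hi : S.IsSmoothEmbedding i)
    {j} {k} {u : ℝ × ℝ} {e : OpenPartialHomeomorph N E3} (he : e ∈ atlas E3 N)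
    (hu : i (S.sheet j k u) ∈ e.source) (α : OneForm N) (w : ℝ × ℝ) :
    α.inChart e ((e ∘ i ∘ S.sheet j k) u) (fderiv ℝ (e ∘ i ∘ S.sheet j k) u w) =
      α (i (S.sheet j k u)) (mfderiv 𝓘(ℝ, ℝ × ℝ) (𝓡 3) (i ∘ S.sheet j k) u w) := by
  rw [← mfderiv_eq_fderiv]
  exact α.inChart_mfderiv_comp he (c := i ∘ S.sheet j k) (hi.mdifferentiableAt j k u) hu w

/-- If the functions `F n` approximate `log g` to first order along the sheets, then the
combinations of `α₀` and `e ^ (-F n) α₁` are contact forms along the branched surface for large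
`n`, locally uniformly. -/
lemma eventually_wedgeD_pos [IsManifold (𝓡 3) ∞ N] (hi : S.IsSmoothEmbedding i)
    {α₀ α₁ : OneForm N} (hα₀ : α₀.IsPosContact) (hα₁ : α₁.IsPosContact) {g : P → ℝ}
    (hg : S.IsSmooth g) (hgpos : ∀ p, 0 < g p)
    (hgα : ∀ (p : P) (v : S.tangentPlane i p),
      α₁ (i p) (v : TangentSpace (𝓡 3) (i p)) = g p * α₀ (i p) (v : TangentSpace (𝓡 3) (i p)))
    {F : ℕ → N → ℝ} (hF : ∀ n, ContMDiff (𝓡 3) 𝓘(ℝ, ℝ) ∞ (F n)) {j} {k} {u : ℝ × ℝ}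
    (hconv : Filter.Tendsto (fun z : (ℝ × ℝ) × ℕ => fderiv ℝ (fun u' =>
      F z.2 (i (S.sheet j k u')) - Real.log (g (S.sheet j k u'))) z.1)
      (𝓝 u ×ˢ Filter.atTop) (𝓝 0))
    {e : OpenPartialHomeomorph N E3} (he : e ∈ atlas E3 N) (hu : i (S.sheet j k u) ∈ e.source) :
    ∀ᶠ z : (ℝ × ℝ) × ℕ in 𝓝 u ×ˢ Filter.atTop, i (S.sheet j k z.1) ∈ e.source ∧
      ∀ c₀ c₁ : ℝ, 0 ≤ c₀ → 0 ≤ c₁ → 0 < c₀ + c₁ →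
        0 < wedgeD (fun x => c₀ • α₀.inChart e x +
          (c₁ * Real.exp (-F z.2 (e.symm x))) • α₁.inChart e x) (e (i (S.sheet j k z.1)))
          (stdE 0) (stdE 1) (stdE 2) := by
  set σ := e ∘ i ∘ S.sheet j k with hσdef
  set a₀ := α₀.inChart e
  set a₁ := α₁.inChart e
  set G : ℝ × ℝ → ℝ := fun u => Real.log (g (S.sheet j k u)) with hGdef
  have hG : ContDiff ℝ ∞ G := (hg j k).log fun _ => (hgpos _).ne'
  have hexpG : ∀ u, Real.exp (G u) = g (S.sheet j k u) := fun u => Real.exp_log (hgpos _)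
  have hsrc : ∀ᶠ u' in 𝓝 u, i (S.sheet j k u') ∈ e.source :=
    (hi.smooth j k).continuous.continuousAt.eventually_mem (e.open_source.mem_nhds hu)
  have hσ : ∀ u', i (S.sheet j k u') ∈ e.source → ContDiffAt ℝ ∞ σ u' :=
    fun u' hu' => hi.contDiffAt_chart he hu'
  have hsm : ∀ {α : OneForm N}, α.IsPosContact → ∀ u', i (S.sheet j k u') ∈ e.source →
      ContDiffAt ℝ ∞ (α.inChart e) (σ u') := fun hα u' hu' =>
    hα.1.contDiffAt isOpen_univ he (e.map_source hu') (mem_univ _)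
  have hrel : ∀ u', i (S.sheet j k u') ∈ e.source → ∀ w, a₁ (σ u') (fderiv ℝ σ u' w) =
      Real.exp (G u') * a₀ (σ u') (fderiv ℝ σ u' w) := by
    intro u' hu' w
    rw [hi.inChart_sheet he hu' α₁ w, hi.inChart_sheet he hu' α₀ w, hexpG]
    exact hgα _ ⟨_, S.mem_tangentPlane i j k u' w⟩
  obtain ⟨ν, hν⟩ := hi.exists_det3_pos he hu
  -- continuity of all the terms along the sheet
  have cσ : ContinuousAt σ u := (hσ u hu).continuousAt
  have cdσ : ContinuousAt (fderiv ℝ σ) u :=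
    ((hσ u hu).fderiv_right (m := ∞) (by simp)).continuousAt
  have c1 : ContinuousAt (fun u' => fderiv ℝ σ u' (1, 0)) u := cdσ.clm_apply continuousAt_const
  have c2 : ContinuousAt (fun u' => fderiv ℝ σ u' (0, 1)) u := cdσ.clm_apply continuousAt_const
  have cν : ContinuousAt (fun _ : ℝ × ℝ => ν) u := continuousAt_const
  have cA₀ := continuousAt_wedgeD (hsm hα₀ u hu) cσ c1 c2 cν
  have cA₁ := continuousAt_wedgeD (hsm hα₁ u hu) cσ c1 c2 cν
  have ca₀ : ContinuousAt (fun u' => a₀ (σ u')) u :=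
    (hsm hα₀ u hu).continuousAt.comp cσ
  have ca₁ : ContinuousAt (fun u' => a₁ (σ u')) u :=
    (hsm hα₁ u hu).continuousAt.comp cσ
  have cG : ContinuousAt G u := hG.continuous.continuousAt
  have cdet : ContinuousAt (fun u' => det3 (fderiv ℝ σ u' (1, 0)) (fderiv ℝ σ u' (0, 1)) ν) u := by
    have cc : ∀ (v : ℝ × ℝ → E3) (m : Fin 3), ContinuousAt v u → ContinuousAt (fun u' => v u' m) u :=
      fun v m hv => (EuclideanSpace.proj (𝕜 := ℝ) m).continuous.continuousAt.comp hv
    have d1 := fun m => cc _ m c1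
    have d2 := fun m => cc _ m c2
    unfold det3
    fun_prop
  have hpos : ∀ {α : OneForm N}, α.IsPosContact → ∀ u', i (S.sheet j k u') ∈ e.source →
      0 < det3 (fderiv ℝ σ u' (1, 0)) (fderiv ℝ σ u' (0, 1)) ν →
      0 < wedgeD (α.inChart e) (σ u') (fderiv ℝ σ u' (1, 0)) (fderiv ℝ σ u' (0, 1)) ν := by
    intro α hα u' hu' hd
    rw [wedgeD_eq_det3_mul]
    exact mul_pos hd (hα.2 e he _ (e.map_source hu'))
  have tfst : Filter.Tendsto (fun z : (ℝ × ℝ) × ℕ => z.1) (𝓝 u ×ˢ Filter.atTop) (𝓝 u) :=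
    Filter.tendsto_fst
  -- the cross term tends to a positive limit
  let Q : (ℝ × ℝ) → ((ℝ × ℝ) →L[ℝ] ℝ) → ℝ := fun u' D =>
    Real.exp (-G u') * wedgeD a₁ (σ u') (fderiv ℝ σ u' (1, 0)) (fderiv ℝ σ u' (0, 1)) ν +
       Real.exp (G u') * wedgeD a₀ (σ u') (fderiv ℝ σ u' (1, 0)) (fderiv ℝ σ u' (0, 1)) ν +
       (a₁ (σ u') ν - Real.exp (G u') * a₀ (σ u') ν) *
        (D (1, 0) * a₀ (σ u') (fderiv ℝ σ u' (0, 1)) -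
         D (0, 1) * a₀ (σ u') (fderiv ℝ σ u' (1, 0)))
  have hQc : ContinuousAt (fun p : (ℝ × ℝ) × ((ℝ × ℝ) →L[ℝ] ℝ) => Q p.1 p.2) (u, 0) := by
    have hf : ContinuousAt (fun p : (ℝ × ℝ) × ((ℝ × ℝ) →L[ℝ] ℝ) => p.1) (u, 0) :=
      continuousAt_fst
    have b1 := ContinuousAt.comp (f := fun p : (ℝ × ℝ) × ((ℝ × ℝ) →L[ℝ] ℝ) => p.1) (x := (u, 0))
      cA₀ hf
    have b2 := ContinuousAt.comp (f := fun p : (ℝ × ℝ) × ((ℝ × ℝ) →L[ℝ] ℝ) => p.1) (x := (u, 0))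
      cA₁ hf
    have b3 := ContinuousAt.comp (f := fun p : (ℝ × ℝ) × ((ℝ × ℝ) →L[ℝ] ℝ) => p.1) (x := (u, 0))
      ca₀ hf
    have b4 := ContinuousAt.comp (f := fun p : (ℝ × ℝ) × ((ℝ × ℝ) →L[ℝ] ℝ) => p.1) (x := (u, 0))
      ca₁ hf
    have b5 := ContinuousAt.comp (f := fun p : (ℝ × ℝ) × ((ℝ × ℝ) →L[ℝ] ℝ) => p.1) (x := (u, 0))
      cG hf
    have b6 := ContinuousAt.comp (f := fun p : (ℝ × ℝ) × ((ℝ × ℝ) →L[ℝ] ℝ) => p.1) (x := (u, 0))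
      c1 hf
    have b7 := ContinuousAt.comp (f := fun p : (ℝ × ℝ) × ((ℝ × ℝ) →L[ℝ] ℝ) => p.1) (x := (u, 0))
      c2 hf
    simp only [Function.comp_def] at b1 b2 b3 b4 b5 b6 b7
    have b8 : ContinuousAt (fun p : (ℝ × ℝ) × ((ℝ × ℝ) →L[ℝ] ℝ) => Real.exp (G p.1)) (u, 0) :=
      b5.rexp
    have b9 : ContinuousAt (fun p : (ℝ × ℝ) × ((ℝ × ℝ) →L[ℝ] ℝ) => Real.exp (-G p.1)) (u, 0) :=
      b5.neg.rexp
    refine ((b9.mul b2).add (b8.mul b1)).add (((b4.clm_apply continuousAt_const).sub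
      (b8.mul (b3.clm_apply continuousAt_const))).mul ?_)
    exact ((continuousAt_snd.clm_apply continuousAt_const).mul (b3.clm_apply b7)).sub
      ((continuousAt_snd.clm_apply continuousAt_const).mul (b3.clm_apply b6))
  have hQ0 : 0 < Q u 0 := by
    have := hpos hα₀ u hu hν
    have := hpos hα₁ u hu hν
    simp only [Q, zero_apply, zero_mul, sub_zero, mul_zero, add_zero]
    positivity
  have hQev : ∀ᶠ p in 𝓝 (u, (0 : (ℝ × ℝ) →L[ℝ] ℝ)), 0 < Q p.1 p.2 :=
    hQc.eventually_const_lt hQ0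
  have hQev' := (tfst.prodMk_nhds hconv).eventually hQev
  filter_upwards [hQev', tfst.eventually hsrc, tfst.eventually (cdet.eventually_const_lt hν)]
    with z hz1 hz2 hz3
  refine ⟨hz2, fun c₀ c₁ hc₀ hc₁ hc => ?_⟩
  have hA₀ := hpos hα₀ z.1 hz2 hz3
  have hA₁ := hpos hα₁ z.1 hz2 hz3
  refine pos_of_mul_pos_right (a := det3 (fderiv ℝ σ z.1 (1, 0)) (fderiv ℝ σ z.1 (0, 1)) ν) ?_
    hz3.le
  rw [← wedgeD_eq_det3_mul]
  have hsrc' : ∀ᶠ u' in 𝓝 z.1, i (S.sheet j k u') ∈ e.source :=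
    (hi.smooth j k).continuous.continuousAt.eventually_mem (e.open_source.mem_nhds hz2)
  have hFd : DifferentiableAt ℝ (fun x => F z.2 (e.symm x)) (σ z.1) := by
    have : ContMDiffAt 𝓘(ℝ, E3) 𝓘(ℝ, ℝ) ∞ (F z.2 ∘ e.symm) (σ z.1) :=
      (hF z.2 _).comp _ (contMDiffAt_chart_symm he (e.map_source hz2))
    exact this.contDiffAt.differentiableAt (by simp)
  have hid := wedgeD_path (hσ z.1 hz2) ((hsm hα₀ z.1 hz2).differentiableAt (by simp))
    ((hsm hα₁ z.1 hz2).differentiableAt (by simp)) hFd (hG.differentiable (by simp) z.1)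
    (hsrc'.mono hrel) c₀ c₁ ν
  have hΔ : fderiv ℝ (fun u' => F z.2 (e.symm (σ u')) - G u') z.1 =
      fderiv ℝ (fun u' => F z.2 (i (S.sheet j k u')) - G u') z.1 := by
    refine Filter.EventuallyEq.fderiv_eq ?_
    filter_upwards [hsrc'] with u' hu'
    simp only [hσdef, Function.comp_apply, e.left_inv hu']
  rw [hΔ] at hid
  refine lt_of_lt_of_eq ?_ hid.symm
  have hE := Real.exp_pos (-F z.2 (e.symm (σ z.1)))
  change 0 < _ + _ + _ * Q z.1 _
  rcases hc₀.eq_or_lt with rfl | hc₀'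
  · have : 0 < c₁ := by linarith
    have : 0 < (c₁ * Real.exp (-F z.2 (e.symm (σ z.1)))) ^ 2 *
      wedgeD a₁ (σ z.1) (fderiv ℝ σ z.1 (1, 0)) (fderiv ℝ σ z.1 (0, 1)) ν := by positivity
    simpa using this
  · have h1 : 0 < c₀ ^ 2 *
      wedgeD a₀ (σ z.1) (fderiv ℝ σ z.1 (1, 0)) (fderiv ℝ σ z.1 (0, 1)) ν := by positivity
    have h2 : 0 ≤ (c₁ * Real.exp (-F z.2 (e.symm (σ z.1)))) ^ 2 *
      wedgeD a₁ (σ z.1) (fderiv ℝ σ z.1 (1, 0)) (fderiv ℝ σ z.1 (0, 1)) ν := by positivity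
    have h3 := mul_nonneg (mul_nonneg hc₀'.le (mul_nonneg hc₁ hE.le)) hz1.le
    exact add_pos_of_pos_of_nonneg (add_pos_of_pos_of_nonneg h1 h2) h3

end BranchedSurface

/-! ### Approximation of smooth functions on a branched surface by ambient smooth functions -/

/-- The functions `E n` of two variables tend to zero in the `C¹` sense, locally uniformly
near `u`. -/
structure C1Conv (E : ℕ → ℝ × ℝ → ℝ) (u : ℝ × ℝ) : Prop where
  differentiableAt : ∀ᶠ z : (ℝ × ℝ) × ℕ in 𝓝 u ×ˢ Filter.atTop, DifferentiableAt ℝ (E z.2) z.1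
  tendsto : Filter.Tendsto (fun z : (ℝ × ℝ) × ℕ => E z.2 z.1) (𝓝 u ×ˢ Filter.atTop) (𝓝 0)
  tendsto_fderiv : Filter.Tendsto (fun z : (ℝ × ℝ) × ℕ => fderiv ℝ (E z.2) z.1)
    (𝓝 u ×ˢ Filter.atTop) (𝓝 0)

namespace C1Conv

variable {E E' : ℕ → ℝ × ℝ → ℝ} {u : ℝ × ℝ}

lemma congr (h : C1Conv E u) (hE : ∀ᶠ u' in 𝓝 u, ∀ n, E' n u' = E n u') : C1Conv E' u := by
  have h1 : ∀ᶠ z : (ℝ × ℝ) × ℕ in 𝓝 u ×ˢ Filter.atTop, E' z.2 =ᶠ[𝓝 z.1] E z.2 := by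
    have : ∀ᶠ z : (ℝ × ℝ) × ℕ in 𝓝 u ×ˢ Filter.atTop, ∀ᶠ u' in 𝓝 z.1, ∀ n, E' n u' = E n u' :=
      Filter.tendsto_fst.eventually hE.eventually_nhds
    filter_upwards [this] with z hz
    filter_upwards [hz] with u' hu' using hu' _
  refine ⟨?_, h.tendsto.congr' ?_, h.tendsto_fderiv.congr' ?_⟩
  · filter_upwards [h.differentiableAt, h1] with z h2 h3 using h2.congr_of_eventuallyEq h3
  · filter_upwards [h1] with z hz using hz.eq_of_nhds.symm
  · filter_upwards [h1] with z hz using hz.fderiv_eq.symm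

lemma zero : C1Conv (fun _ _ => 0) u :=
  ⟨Filter.Eventually.of_forall fun _ => differentiableAt_const _, tendsto_const_nhds, by simp⟩

lemma add (h : C1Conv E u) (h' : C1Conv E' u) : C1Conv (fun n u => E n u + E' n u) u := by
  refine ⟨?_, by simpa using h.tendsto.add h'.tendsto, ?_⟩
  · filter_upwards [h.differentiableAt, h'.differentiableAt] with z h1 h2 using h1.add h2
  · have := h.tendsto_fderiv.add h'.tendsto_fderiv
    rw [add_zero] at this
    refine this.congr' ?_
    filter_upwards [h.differentiableAt, h'.differentiableAt] with z h1 h2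
    exact (fderiv_fun_add h1 h2).symm

lemma sum {ι : Type*} (s : Finset ι) {E : ι → ℕ → ℝ × ℝ → ℝ} (h : ∀ a ∈ s, C1Conv (E a) u) :
    C1Conv (fun n u => ∑ a ∈ s, E a n u) u := by
  classical
  induction s using Finset.induction_on with
  | empty => simpa using zero
  | insert a s ha ih =>
    simp only [Finset.sum_insert ha]
    exact (h a (by simp)).add (ih fun b hb => h b (by simp [hb]))

lemma mul_left (h : C1Conv E u) {χ : ℝ × ℝ → ℝ} (hχ : ContDiff ℝ ∞ χ) :
    C1Conv (fun n u => χ u * E n u) u := by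
  have t1 : Filter.Tendsto (fun z : (ℝ × ℝ) × ℕ => χ z.1) (𝓝 u ×ˢ Filter.atTop) (𝓝 (χ u)) :=
    (hχ.continuous.tendsto u).comp Filter.tendsto_fst
  have t2 : Filter.Tendsto (fun z : (ℝ × ℝ) × ℕ => fderiv ℝ χ z.1) (𝓝 u ×ˢ Filter.atTop)
      (𝓝 (fderiv ℝ χ u)) :=
    ((hχ.continuous_fderiv (by simp)).tendsto u).comp Filter.tendsto_fst
  refine ⟨?_, by simpa using t1.mul h.tendsto, ?_⟩
  · filter_upwards [h.differentiableAt] with z h1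
      using (hχ.differentiable (by simp) _).mul h1
  · have := (t1.smul h.tendsto_fderiv).add (h.tendsto.smul t2)
    rw [smul_zero, zero_smul, add_zero] at this
    refine this.congr' ?_
    filter_upwards [h.differentiableAt] with z h1
    exact (fderiv_fun_mul (hχ.differentiable (by simp) _) h1).symm

lemma comp {τ : ℝ × ℝ → ℝ × ℝ} (h : C1Conv E (τ u)) (hτ : ContDiffAt ℝ ∞ τ u) :
    C1Conv (fun n u => E n (τ u)) u := by
  have t1 : Filter.Tendsto (fun z : (ℝ × ℝ) × ℕ => (τ z.1, z.2)) (𝓝 u ×ˢ Filter.atTop)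
      (𝓝 (τ u) ×ˢ Filter.atTop) :=
    (hτ.continuousAt.tendsto.comp Filter.tendsto_fst).prodMk Filter.tendsto_snd
  have t2 : Filter.Tendsto (fun z : (ℝ × ℝ) × ℕ => fderiv ℝ τ z.1) (𝓝 u ×ˢ Filter.atTop)
      (𝓝 (fderiv ℝ τ u)) :=
    ((hτ.fderiv_right (m := ∞) (by simp)).continuousAt.tendsto).comp Filter.tendsto_fst
  have d1 : ∀ᶠ z : (ℝ × ℝ) × ℕ in 𝓝 u ×ˢ Filter.atTop, DifferentiableAt ℝ τ z.1 := by
    have : ∀ᶠ u' in 𝓝 u, ContDiffAt ℝ 1 τ u' :=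
      (hτ.of_le (by exact_mod_cast le_top)).eventually (by simp)
    filter_upwards [Filter.tendsto_fst.eventually this] with z hz using
      hz.differentiableAt (by simp)
  have d2 := t1.eventually h.differentiableAt
  refine ⟨?_, h.tendsto.comp t1, ?_⟩
  · filter_upwards [d1, d2] with z h1 h2 using DifferentiableAt.comp z.1 h2 h1
  · have t3 := h.tendsto_fderiv.comp t1
    have hcc : Continuous fun p : ((ℝ × ℝ) →L[ℝ] ℝ) × ((ℝ × ℝ) →L[ℝ] (ℝ × ℝ)) => p.1.comp p.2 :=
      continuous_fst.clm_comp continuous_snd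
    have := (hcc.tendsto (0, fderiv ℝ τ u)).comp (t3.prodMk_nhds t2)
    rw [ContinuousLinearMap.zero_comp] at this
    refine this.congr' ?_
    filter_upwards [d1, d2] with z h1 h2 using (fderiv_comp z.1 h2 h1).symm

/-- A function is approximated by its translates, in the `C¹` sense. -/
lemma shift {D : ℝ × ℝ → ℝ} (hD : ∀ᶠ u' in 𝓝 u, ContDiffAt ℝ ∞ D u') (w : ℝ × ℝ) :
    C1Conv (fun n u' => D (u' + (1 / ((n : ℝ) + 1)) • w) - D u') u := by
  have t0 : Filter.Tendsto (fun z : (ℝ × ℝ) × ℕ => z.1) (𝓝 u ×ˢ Filter.atTop) (𝓝 u) :=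
    Filter.tendsto_fst
  have t1 : Filter.Tendsto (fun z : (ℝ × ℝ) × ℕ => z.1 + (1 / ((z.2 : ℝ) + 1)) • w)
      (𝓝 u ×ˢ Filter.atTop) (𝓝 u) := by
    have : Filter.Tendsto (fun z : (ℝ × ℝ) × ℕ => (1 / ((z.2 : ℝ) + 1)) • w)
        (𝓝 u ×ˢ Filter.atTop) (𝓝 ((0 : ℝ) • w)) :=
      (tendsto_one_div_add_atTop_nhds_zero_nat.comp Filter.tendsto_snd).smul_const w
    simpa using t0.add this
  have hDu := hD.self_of_nhds
  have hc : ContinuousAt (fderiv ℝ D) u := (hDu.fderiv_right (m := ∞) (by simp)).continuousAt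
  have hd : ∀ᶠ u' in 𝓝 u, DifferentiableAt ℝ D u' :=
    hD.mono fun u' h => h.differentiableAt (by simp)
  have h2 : ∀ᶠ z : (ℝ × ℝ) × ℕ in 𝓝 u ×ˢ Filter.atTop,
      DifferentiableAt ℝ (fun u' => D (u' + (1 / ((z.2 : ℝ) + 1)) • w)) z.1 := by
    filter_upwards [t1.eventually hd] with z hz
    exact DifferentiableAt.comp z.1 hz (differentiableAt_id.add_const _)
  refine ⟨?_, ?_, ?_⟩
  · filter_upwards [h2, t0.eventually hd] with z h1 h3 using h1.sub h3
  · have := (hDu.continuousAt.tendsto.comp t1).sub (hDu.continuousAt.tendsto.comp t0)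
    simpa using this
  · have := (hc.tendsto.comp t1).sub (hc.tendsto.comp t0)
    rw [sub_self] at this
    refine this.congr' ?_
    filter_upwards [h2, t0.eventually hd] with z h1 h3
    rw [fderiv_fun_sub h1 h3]
    simp [fderiv_comp_add_right]

end C1Conv

/-- A smooth map of the plane to `ℝ³` which is an immersion at `u` has a smooth left inverse near
the image of `u`. -/
lemma exists_local_left_inverse {σ : ℝ × ℝ → E3} {u : ℝ × ℝ}
    (hσ : ∀ᶠ u' in 𝓝 u, ContDiffAt ℝ ∞ σ u') (hinj : Function.Injective (fderiv ℝ σ u)) :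
    ∃ (O : Set E3) (ρ : E3 → ℝ × ℝ), IsOpen O ∧ σ u ∈ O ∧ ContDiffOn ℝ ∞ ρ O ∧
      ∀ᶠ u' in 𝓝 u, ρ (σ u') = u' := by
  obtain ⟨L', hL'⟩ := (fderiv ℝ σ u).toLinearMap.exists_leftInverse_of_injective
    (LinearMap.ker_eq_bot.2 hinj)
  set L : E3 →L[ℝ] ℝ × ℝ := LinearMap.toContinuousLinearMap L'
  have hL : L.comp (fderiv ℝ σ u) = ContinuousLinearMap.id ℝ (ℝ × ℝ) :=
    ContinuousLinearMap.ext fun w => LinearMap.congr_fun hL' w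
  set ψ : ℝ × ℝ → ℝ × ℝ := fun u' => L (σ u')
  have hψ : ∀ᶠ u' in 𝓝 u, ContDiffAt ℝ ∞ ψ u' :=
    hσ.mono fun u' h => L.contDiff.contDiffAt.comp u' h
  have hψu := hψ.self_of_nhds
  have hσu := hσ.self_of_nhds
  have hd : HasFDerivAt ψ
      ((ContinuousLinearEquiv.refl ℝ (ℝ × ℝ) : (ℝ × ℝ) ≃L[ℝ] (ℝ × ℝ)) : (ℝ × ℝ) →L[ℝ] (ℝ × ℝ)) u := by
    have := L.hasFDerivAt.comp u (hσu.differentiableAt (by simp)).hasFDerivAt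
    rw [hL] at this
    exact this
  set Φ := hψu.toOpenPartialHomeomorph ψ hd (by simp) with hΦdef
  have hΦ : ∀ u', Φ u' = ψ u' := fun _ => rfl
  have huΦ : u ∈ Φ.source := hψu.mem_toOpenPartialHomeomorph_source hd (by simp)
  have hequiv : ∀ᶠ u' in 𝓝 u, fderiv ℝ ψ u' ∈
      range ((↑) : ((ℝ × ℝ) ≃L[ℝ] (ℝ × ℝ)) → ((ℝ × ℝ) →L[ℝ] (ℝ × ℝ))) := by
    refine (hψu.fderiv_right (m := ∞) (by simp)).continuousAt.eventually_mem
      (ContinuousLinearEquiv.isOpen.mem_nhds ⟨ContinuousLinearEquiv.refl ℝ _, hd.fderiv.symm⟩)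
  obtain ⟨B, hB, hBo, huB⟩ := eventually_nhds_iff.1 (hψ.and hequiv)
  have hopen : IsOpen (Φ.target ∩ Φ.symm ⁻¹' B) := Φ.isOpen_inter_preimage_symm hBo
  refine ⟨L ⁻¹' (Φ.target ∩ Φ.symm ⁻¹' B), Φ.symm ∘ L, hopen.preimage L.continuous, ?_, ?_, ?_⟩
  · change Φ u ∈ Φ.target ∩ Φ.symm ⁻¹' B
    exact ⟨Φ.map_source huΦ, by rw [mem_preimage, Φ.left_inv huΦ]; exact huB⟩
  · intro x hx
    obtain ⟨h1, A, hA⟩ := hB _ hx.2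
    have h2 : ContDiffAt ℝ ∞ Φ.symm (L x) := Φ.contDiffAt_symm (f₀' := A) hx.1
      (by rw [hA]; exact (h1.differentiableAt (by simp)).hasFDerivAt) h1
    exact (h2.comp x L.contDiff.contDiffAt).contDiffWithinAt
  · filter_upwards [Φ.open_source.mem_nhds huΦ] with u' hu'
    exact Φ.left_inv hu'

namespace BranchedSurface

variable {h : ℝ → ℝ} {P : Type*} [TopologicalSpace P] {S : BranchedSurface h P}
variable {N : Type*} [TopologicalSpace N] [ChartedSpace E3 N]
variable {i : P → N}

/-- Local smooth retractions onto the sheets of an embedded branched surface. -/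
lemma IsSmoothEmbedding.exists_retraction [IsManifold (𝓡 3) ∞ N] (hi : S.IsSmoothEmbedding i)
    (j) (k) (u : ℝ × ℝ) : ∃ (W : Set N) (π : N → ℝ × ℝ), IsOpen W ∧ i (S.sheet j k u) ∈ W ∧
      ContMDiffOn (𝓡 3) 𝓘(ℝ, ℝ × ℝ) ∞ π W ∧ ∀ᶠ u' in 𝓝 u, π (i (S.sheet j k u')) = u' := by
  set e := chartAt E3 (i (S.sheet j k u))
  have he : e ∈ atlas E3 N := chart_mem_atlas _ _
  have hu : i (S.sheet j k u) ∈ e.source := mem_chart_source _ _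
  have hsrc : ∀ᶠ u' in 𝓝 u, i (S.sheet j k u') ∈ e.source :=
    (hi.smooth j k).continuous.continuousAt.eventually_mem (e.open_source.mem_nhds hu)
  obtain ⟨O, ρ, hO, huO, hρ, hinv⟩ := exists_local_left_inverse (σ := e ∘ i ∘ S.sheet j k) (u := u)
    (hsrc.mono fun u' hu' => hi.contDiffAt_chart he hu') (hi.injective_fderiv_chart he hu)
  refine ⟨e.source ∩ e ⁻¹' O, ρ ∘ e, e.isOpen_inter_preimage hO, ⟨hu, huO⟩, ?_, hinv⟩
  exact (contMDiffOn_iff_contDiffOn.2 hρ).comp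
    ((contMDiffOn_chart_of_mem_atlas he).mono inter_subset_left) inter_subset_right

end BranchedSurface

/-- The third coordinate of the points of the model sheets. -/
def sheetHeight (h : ℝ → ℝ) : Fin 4 → ℝ × ℝ → ℝ
  | 0, _ => 0
  | 1, u => h u.1
  | 2, u => -h u.2
  | 3, u => -h (-u.2)

/-- The linear function which is non-negative exactly where the model sheet `Σ_k` agrees with `Σ₁`; it is
zero for `Σ₁` itself. -/
def branchCoord : Fin 4 → ℝ × ℝ → ℝ
  | 0, _ => 0
  | 1, u => u.1
  | 2, u => u.2
  | 3, u => -u.2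

/-- The unit vector in the direction in which `branchCoord k` increases; it is zero for `Σ₁`. -/
def branchDir : Fin 4 → ℝ × ℝ
  | 0 => (0, 0)
  | 1 => (1, 0)
  | 2 => (0, 1)
  | 3 => (0, -1)

lemma sheetMap_eq (h : ℝ → ℝ) (k : Fin 4) (u : ℝ × ℝ) :
    sheetMap h k u = (u.1, u.2, sheetHeight h k u) := by
  fin_cases k <;> rfl

lemma sheetMap_fst_inj {h : ℝ → ℝ} {k k' : Fin 4} {u u' : ℝ × ℝ}
    (hu : sheetMap h k u = sheetMap h k' u') : u = u' := by
  rw [sheetMap_eq, sheetMap_eq, Prod.mk.injEq, Prod.mk.injEq] at hu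
  exact Prod.ext hu.1 hu.2.1

lemma branchCoord_add {k : Fin 4} (hk : k ≠ 0) (u : ℝ × ℝ) (r : ℝ) :
    branchCoord k (u + r • branchDir k) = branchCoord k u + r := by
  fin_cases k <;> simp [branchCoord, branchDir] at hk ⊢
  ring

lemma norm_branchDir_le (k : Fin 4) : ‖branchDir k‖ ≤ 1 := by
  fin_cases k <;> simp [branchDir, Prod.norm_def]

lemma continuous_branchCoord (k : Fin 4) : Continuous (branchCoord k) := by
  fin_cases k
  · exact continuous_const
  · exact continuous_fst
  · exact continuous_snd
  · exact continuous_snd.neg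

lemma IsProfile.continuous_sheetHeight {h : ℝ → ℝ} (hh : IsProfile h) (k : Fin 4) :
    Continuous (sheetHeight h k) := by
  have := hh.smooth.continuous
  fin_cases k
  · exact continuous_const
  · exact this.comp continuous_fst
  · exact (this.comp continuous_snd).neg
  · exact (this.comp continuous_snd.neg).neg

lemma IsProfile.sheetMap_eq_zero {h : ℝ → ℝ} (hh : IsProfile h) {k : Fin 4} {u : ℝ × ℝ}
    (hu : 0 ≤ branchCoord k u) : sheetMap h k u = sheetMap h 0 u := by
  rw [sheetMap_eq, sheetMap_eq]
  fin_cases k <;> simp [branchCoord, sheetHeight] at hu ⊢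
  · exact hh.zero _ hu
  · exact hh.zero _ hu
  · exact hh.zero _ (by linarith)

/-- Two sheets of a local model meet only where both agree with `Σ₁`. -/
lemma IsProfile.branchCoord_nonneg {h : ℝ → ℝ} (hh : IsProfile h) {m : Kind} {k k' : Fin 4}
    (hk : k ∈ m.sheets) (hk' : k' ∈ m.sheets) (hne : k ≠ k') {u u' : ℝ × ℝ}
    (hu : sheetMap h k u = sheetMap h k' u') : 0 ≤ branchCoord k u := by
  obtain rfl := sheetMap_fst_inj hu
  have hnn : ∀ x, 0 ≤ h x := fun x => by
    rcases lt_or_ge x 0 with hx | hx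
    · exact (hh.pos x hx).le
    · exact (hh.zero x hx).ge
  have hz : ∀ x, h x = 0 → 0 ≤ x := fun x hx => by
    by_contra! hlt
    exact (hh.pos x hlt).ne' hx
  rw [sheetMap_eq, sheetMap_eq, Prod.mk.injEq, Prod.mk.injEq] at hu
  have h3 := hu.2.2
  have a1 := hnn u.1
  have a2 := hnn u.2
  have a3 := hnn (-u.2)
  cases m <;> fin_cases k <;> fin_cases k' <;>
    simp [Kind.sheets, sheetHeight, branchCoord] at hk hk' hne h3 ⊢ <;>
    first
      | exact hz _ (by linarith)
      | (have := hz (-u.2) (by linarith); linarith)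

namespace BranchedSurface

variable {h : ℝ → ℝ} {P : Type*} [TopologicalSpace P] {S : BranchedSurface h P}

lemma sheet_eq_iff {j : Fin S.n} {k k' : (S.kind j).sheets} {u u' : ℝ × ℝ} :
    S.sheet j k u = S.sheet j k' u' ↔ sheetMap h k u = sheetMap h k' u' :=
  ((S.isOpenEmbedding j).injective.eq_iff).trans Subtype.ext_iff

/-- Near `p`, a branched surface consists of the sheets of a chart through `p`, with parameters
near the parameter of `p`. -/
lemma eventually_sheet (hh : IsProfile h) (j : Fin S.n) (k₀ : (S.kind j).sheets) (u₀ : ℝ × ℝ)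
    {r : ℝ} (hr : 0 < r) : ∀ᶠ p in 𝓝 (S.sheet j k₀ u₀), p ∈ range (S.chart j) ∧
      ∀ k u, S.sheet j k u = p → dist u u₀ < r ∧ S.sheet j k u₀ = S.sheet j k₀ u₀ := by
  classical
  rw [show 𝓝 (S.sheet j k₀ u₀) = Filter.map (S.chart j) (𝓝 (sheetPt h (S.kind j) k₀ u₀)) from
    ((S.isOpenEmbedding j).map_nhds_eq _).symm, Filter.eventually_map]
  let pr : model h (S.kind j) → ℝ × ℝ := fun w => (w.1.1, w.1.2.1)
  have hpr : Continuous pr := by fun_prop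
  have hpr' : ∀ k u, pr (sheetPt h (S.kind j) k u) = u := fun k u => by
    simp [pr, sheetPt, sheetMap_eq]
  have h1 : ∀ᶠ w in 𝓝 (sheetPt h (S.kind j) k₀ u₀), dist (pr w) u₀ < r := by
    have := (hpr.tendsto (sheetPt h (S.kind j) k₀ u₀)).eventually
      (Metric.ball_mem_nhds (pr (sheetPt h (S.kind j) k₀ u₀)) hr)
    rwa [hpr'] at this
  have h2 : ∀ k : (S.kind j).sheets, ∀ᶠ w in 𝓝 (sheetPt h (S.kind j) k₀ u₀),
      sheetHeight h k u₀ ≠ sheetHeight h k₀ u₀ → w.1.2.2 ≠ sheetHeight h k (pr w) := by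
    intro k
    by_cases hk : sheetHeight h k u₀ = sheetHeight h k₀ u₀
    · exact Filter.Eventually.of_forall fun w hw => absurd hk hw
    · have hc : Continuous fun w : model h (S.kind j) => w.1.2.2 - sheetHeight h k (pr w) :=
        (by fun_prop : Continuous fun w : model h (S.kind j) => w.1.2.2).sub
          ((hh.continuous_sheetHeight k).comp hpr)
      have hne : (sheetPt h (S.kind j) k₀ u₀).1.2.2 -
          sheetHeight h k (pr (sheetPt h (S.kind j) k₀ u₀)) ≠ 0 := by
        rw [hpr', sub_ne_zero]
        simpa [sheetPt, sheetMap_eq] using fun hx => hk hx.symm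
      filter_upwards [hc.continuousAt.eventually_ne hne] with w hw _ hw'
      exact hw (sub_eq_zero.2 hw')
  filter_upwards [h1, Filter.eventually_all.2 h2] with w hw1 hw2
  refine ⟨mem_range_self _, fun k u hu => ?_⟩
  obtain rfl : sheetPt h (S.kind j) k u = w := (S.isOpenEmbedding j).injective hu
  rw [hpr'] at hw1
  refine ⟨hw1, ?_⟩
  rw [sheet_eq_iff, sheetMap_eq, sheetMap_eq]
  by_contra hne
  refine hw2 k (fun h0 => hne (by rw [h0])) ?_
  rw [hpr']
  simp [sheetPt, sheetMap_eq]

variable {N : Type*} [TopologicalSpace N] [ChartedSpace E3 N]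
variable {i : P → N}

/-- Local approximation: near a point of the branched surface, a smooth function `G` on it is the
`C¹` limit along the sheets of smooth functions `F n` of the ambient manifold. On a base sheet the
`F n` restrict to `G`. On every other sheet, `G` differs from the extension from the base sheet by a
function `D` which vanishes on a half-plane; translating `D` makes it vanish on a larger
half-plane, whose complement is at a positive distance from the other sheets, so that the translated
function can be added with the help of a cut-off function. -/
lemma exists_local_approx [T2Space N] [SigmaCompactSpace N] [IsManifold (𝓡 3) ∞ N]
    (hh : IsProfile h) (hi : S.IsSmoothEmbedding i) {G : P → ℝ} (hG : S.IsSmooth G) (p : P) :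
    ∃ (W : Set N) (F : ℕ → N → ℝ), IsOpen W ∧ i p ∈ W ∧
      (∀ n, ContMDiffOn (𝓡 3) 𝓘(ℝ, ℝ) ∞ (F n) W) ∧
      ∀ j k u, i (S.sheet j k u) ∈ W →
        C1Conv (fun n u' => F n (i (S.sheet j k u')) - G (S.sheet j k u')) u := by
  classical
  obtain ⟨j, k₀, u₀, hp⟩ := S.exists_sheet_eq p
  let K : Type := (S.kind j).sheets
  let s : K → ℝ × ℝ → P := fun k => S.sheet j k
  have hsc : ∀ k, Continuous fun u => i (s k u) := fun k => (hi.smooth j k).continuous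
  have hinj : Function.Injective i := hi.isEmbedding.injective
  -- the sheets through `p`, and the base sheet among them
  let Kp : Finset K := Finset.univ.filter fun k => s k u₀ = p
  have hKp : ∀ k, k ∈ Kp ↔ s k u₀ = p := fun k => by simp [Kp]
  have h0mem : (0 : Fin 4) ∈ (S.kind j).sheets := by cases S.kind j <;> simp [Kind.sheets]
  let z : K := ⟨0, h0mem⟩
  obtain ⟨b, hb, hbz⟩ : ∃ b ∈ Kp, ∀ k ∈ Kp, k ≠ b → (k : Fin 4) ≠ 0 ∧ b = z := by
    by_cases hz : s z u₀ = p
    · exact ⟨z, (hKp z).2 hz, fun k _ hkz => ⟨fun h0 => hkz (Subtype.ext h0), rfl⟩⟩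
    · refine ⟨k₀, (hKp k₀).2 hp, fun k hk hne => absurd ?_ hz⟩
      have h1 : S.sheet j k u₀ = S.sheet j k₀ u₀ := ((hKp k).1 hk).trans hp.symm
      have h2 := hh.branchCoord_nonneg k.2 k₀.2 (fun h0 => hne (Subtype.ext h0))
        (sheet_eq_iff.1 h1)
      have h3 : S.sheet j k u₀ = S.sheet j z u₀ := sheet_eq_iff.2 (hh.sheetMap_eq_zero h2)
      exact h3.symm.trans ((hKp k).1 hk)
  have hsb : ∀ k ∈ Kp, k ≠ b → ∀ u, 0 ≤ branchCoord k u → s k u = s b u := by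
    intro k hk hne u hu
    rw [(hbz k hk hne).2]
    exact sheet_eq_iff.2 (hh.sheetMap_eq_zero hu)
  choose Wr π hWr hmemWr hπ hπs using fun k : K => hi.exists_retraction j k u₀
  have hmemWr' : ∀ k ∈ Kp, i p ∈ Wr k := fun k hk => by
    have := hmemWr k
    rwa [show S.sheet j k u₀ = p from (hKp k).1 hk] at this
  have hπp : ∀ k ∈ Kp, π k (i p) = u₀ := fun k hk => by
    have := (hπs k).self_of_nhds
    rwa [show S.sheet j k u₀ = p from (hKp k).1 hk] at this
  -- the radius in the parameter plane
  have hev : ∀ᶠ u in 𝓝 u₀, ∀ k ∈ Kp, π k (i (s k u)) = u ∧ i (s k u) ∈ Wr b := by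
    rw [Filter.eventually_all_finset]
    intro k hk
    refine (hπs k).and ((hsc k).continuousAt.eventually_mem ((hWr b).mem_nhds ?_))
    rw [show s k u₀ = p from (hKp k).1 hk]
    exact hmemWr' b hb
  obtain ⟨R, hR, hball⟩ := Metric.eventually_nhds_iff.1 hev
  set r := R / 3 with hrdef
  have hr : 0 < r := by positivity
  have hπball : ∀ k ∈ Kp, ∀ u, dist u u₀ < R → π k (i (s k u)) = u := fun k hk u hu =>
    (hball hu k hk).1
  -- the defect of the extension from the base sheet
  let D : K → ℝ × ℝ → ℝ := fun k u => G (s k u) - G (s b (π b (i (s k u))))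
  have hD : ∀ k ∈ Kp, ∀ u, dist u u₀ < R → ContDiffAt ℝ ∞ (D k) u := by
    intro k hk u hu
    refine ((hG j k).contDiffAt).sub ?_
    have h1 : ContMDiffAt 𝓘(ℝ, ℝ × ℝ) 𝓘(ℝ, ℝ × ℝ) ∞ (π b ∘ i ∘ s k) u :=
      ContMDiffAt.comp (I' := 𝓡 3) (g := π b) (f := i ∘ s k) u
        ((hπ b).contMDiffAt ((hWr b).mem_nhds (hball hu k hk).2)) (hi.smooth j k u)
    exact ((hG j b).contDiffAt).comp u h1.contDiffAt
  have hD0 : ∀ k ∈ Kp, k ≠ b → ∀ u, dist u u₀ < R → 0 ≤ branchCoord k u → D k u = 0 := by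
    intro k hk hne u hu hu'
    simp only [D, hsb k hk hne u hu', hπball b hb u hu, sub_self]
  -- the neighbourhood
  obtain ⟨W₁, hW₁, hpW₁, hW₁s⟩ : ∃ W₁ : Set N, IsOpen W₁ ∧ i p ∈ W₁ ∧ ∀ p', i p' ∈ W₁ →
      p' ∈ range (S.chart j) ∧ ∀ k u, s k u = p' → dist u u₀ < r ∧ k ∈ Kp := by
    have h1 := eventually_sheet hh j k₀ u₀ hr
    rw [hi.isEmbedding.isInducing.nhds_eq_comap, Filter.eventually_comap] at h1
    obtain ⟨W₁, hW, hWo, hpW⟩ := eventually_nhds_iff.1 h1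
    rw [hp] at hpW
    refine ⟨W₁, hWo, hpW, fun p' hp' => ?_⟩
    obtain ⟨h2, h3⟩ := hW _ hp' p' rfl
    exact ⟨h2, fun k u hk => ⟨(h3 k u hk).1, (hKp k).2 ((h3 k u hk).2.trans hp)⟩⟩
  let W : Set N := W₁ ∩ ⋂ k ∈ Kp, (Wr k ∩ π k ⁻¹' Metric.ball u₀ r)
  have hWo : IsOpen W := hW₁.inter (isOpen_biInter_finset fun k _ =>
    (hπ k).continuousOn.isOpen_inter_preimage (hWr k) Metric.isOpen_ball)
  have hWk : ∀ q ∈ W, ∀ k ∈ Kp, q ∈ Wr k ∧ dist (π k q) u₀ < r := fun q hq k hk =>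
    mem_iInter₂.1 hq.2 k hk
  have hWs : ∀ k u, i (s k u) ∈ W → dist u u₀ < r ∧ k ∈ Kp := fun k u hu =>
    (hW₁s _ hu.1).2 k u rfl
  -- the translations
  let t : ℕ → K → ℝ × ℝ := fun n k => (1 / ((n : ℝ) + 1)) • (r • branchDir k)
  have ht : ∀ n k, ‖t n k‖ ≤ r := fun n k => by
    have h1 : (1 / ((n : ℝ) + 1)) ≤ 1 := by
      rw [div_le_one (by positivity)]; linarith [(Nat.cast_nonneg n : (0 : ℝ) ≤ n)]
    calc ‖t n k‖ = (1 / ((n : ℝ) + 1)) * (r * ‖branchDir k‖) := by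
          simp only [t]
          rw [norm_smul, norm_smul, Real.norm_of_nonneg hr.le, Real.norm_of_nonneg (by positivity)]
      _ ≤ 1 * (r * 1) := by gcongr; exact norm_branchDir_le _
      _ = r := by ring
  have htR : ∀ n k u, dist u u₀ < r → dist (u + t n k) u₀ < R := fun n k u hu => by
    calc dist (u + t n k) u₀ ≤ dist (u + t n k) u + dist u u₀ := dist_triangle _ _ _
      _ < r + r := by
        have : dist (u + t n k) u = ‖t n k‖ := by rw [dist_eq_norm]; simp
        have := ht n k
        linarith
      _ < R := by rw [hrdef]; linarith
  -- the cut-off functions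
  have hθ : ∀ (n : ℕ) (k : K), ∃ θ : N → ℝ, ContMDiff (𝓡 3) 𝓘(ℝ, ℝ) ∞ θ ∧ (k ∈ Kp → k ≠ b →
      (∀ k' ∈ Kp, k' ≠ k → ∀ u, dist u u₀ < r → θ (i (s k' u)) = 0) ∧
      ∀ u, dist u u₀ < r → branchCoord k u + r / (n + 1) ≤ 0 → θ (i (s k u)) = 1) := by
    intro n k
    by_cases hk : k ∈ Kp ∧ k ≠ b
    · let A : Set N := ⋃ k' ∈ Kp.erase k, (fun u => i (s k' u)) '' Metric.closedBall u₀ r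
      let B : Set N := (fun u => i (s k u)) ''
        (Metric.closedBall u₀ r ∩ {u | branchCoord k u + r / (n + 1) ≤ 0})
      have hA : IsClosed A := (Kp.erase k).finite_toSet.isClosed_biUnion fun k' _ =>
        ((isCompact_closedBall u₀ r).image (hsc k')).isClosed
      have hB : IsClosed B := (((isCompact_closedBall u₀ r).inter_right (isClosed_le
        ((continuous_branchCoord k).add continuous_const) continuous_const)).image (hsc k)).isClosed
      have hAB : Disjoint A B := by
        rw [disjoint_left]
        rintro q hqA ⟨u, ⟨hu, hu'⟩, rfl⟩
        obtain ⟨k', hk', u', hu'', heq⟩ := mem_iUnion₂.1 hqA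
        have h1 : s k u = s k' u' := hinj heq.symm
        have h2 := hh.branchCoord_nonneg k.2 k'.2
          (fun h0 => (Finset.mem_erase.1 hk').1 (Subtype.ext h0.symm)) (sheet_eq_iff.1 h1)
        have h3 : 0 < r / ((n : ℝ) + 1) := by positivity
        have h4 : branchCoord k u + r / (n + 1) ≤ 0 := hu'
        linarith
      obtain ⟨θ, hθA, hθB, -⟩ := exists_contMDiffMap_zero_one_of_isClosed (n := ⊤) (𝓡 3) hA hB hAB
      refine ⟨θ, θ.contMDiff, fun _ _ => ⟨fun k' hk' hne u hu => ?_, fun u hu hu' => ?_⟩⟩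
      · exact hθA (mem_iUnion₂.2 ⟨k', Finset.mem_erase.2 ⟨hne, hk'⟩, u,
          Metric.mem_closedBall.2 hu.le, rfl⟩)
      · exact hθB ⟨u, ⟨Metric.mem_closedBall.2 hu.le, hu'⟩, rfl⟩
    · exact ⟨fun _ => 0, contMDiff_const, fun h1 h2 => absurd ⟨h1, h2⟩ hk⟩
  choose θ hθs hθ using hθ
  let F : ℕ → N → ℝ := fun n q =>
    G (s b (π b q)) + ∑ k ∈ Kp.erase b, θ n k q * D k (π k q + t n k)
  have hF : ∀ n, ContMDiffOn (𝓡 3) 𝓘(ℝ, ℝ) ∞ (F n) W := by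
    intro n q hq
    refine ContMDiffAt.contMDiffWithinAt ?_
    have hπq : ∀ k ∈ Kp, ContMDiffAt (𝓡 3) 𝓘(ℝ, ℝ × ℝ) ∞ (π k) q := fun k hk =>
      (hπ k).contMDiffAt ((hWr k).mem_nhds (hWk q hq k hk).1)
    refine ContMDiffAt.add ?_ (contMDiffAt_finsetSum fun k hk => ?_)
    · exact ContMDiffAt.comp (g := G ∘ s b) (f := π b) q
        ((hG j b).contMDiff.contMDiffAt) (hπq b hb)
    · have hk' := (Finset.mem_erase.1 hk).2
      refine (hθs n k q).mul ?_
      have h1 : ContDiffAt ℝ ∞ (fun u => D k (u + t n k)) (π k q) :=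
        ContDiffAt.comp (g := D k) (f := fun u => u + t n k) (π k q)
          (hD k hk' _ (htR n k _ (hWk q hq k hk').2)) (contDiffAt_id.add contDiffAt_const)
      exact ContMDiffAt.comp (g := fun u => D k (u + t n k)) (f := π k) q h1.contMDiffAt
        (hπq k hk')
  -- the estimate for the sheets of the chart
  have hmain : ∀ k u, i (s k u) ∈ W → C1Conv (fun n u' => F n (i (s k u')) - G (s k u')) u := by
    intro k u hu
    have hev : ∀ᶠ u' in 𝓝 u, dist u' u₀ < r := by
      filter_upwards [(hsc k).continuousAt.eventually_mem (hWo.mem_nhds hu)] with u' hu'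
      exact (hWs k u' hu').1
    have hk := (hWs k u hu).2
    by_cases hkb : k = b
    · refine C1Conv.zero.congr ?_
      filter_upwards [hev] with u' hu' n
      have h1 : ∑ k' ∈ Kp.erase b, θ n k' (i (s k u')) * D k' (π k' (i (s k u')) + t n k') = 0 :=
        Finset.sum_eq_zero fun k' hk' => by
          obtain ⟨h2, h3⟩ := Finset.mem_erase.1 hk'
          rw [(hθ n k' h3 h2).1 k hk (fun h0 => h2 (h0.symm.trans hkb)) u' hu', zero_mul]
      simp only [F, h1]
      rw [hkb, hπball b hb u' (by linarith)]
      ring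
    · have hDev : ∀ᶠ u' in 𝓝 u, ContDiffAt ℝ ∞ (D k) u' :=
        hev.mono fun u' hu' => hD k hk u' (by linarith)
      refine (C1Conv.shift hDev (r • branchDir k)).congr ?_
      filter_upwards [hev] with u' hu' n
      have h1 : ∑ k' ∈ Kp.erase b, θ n k' (i (s k u')) * D k' (π k' (i (s k u')) + t n k') =
          D k (u' + t n k) := by
        rw [Finset.sum_eq_single_of_mem k (Finset.mem_erase.2 ⟨hkb, hk⟩)]
        · rw [hπball k hk u' (by linarith)]
          by_cases hneg : branchCoord k u' + r / (n + 1) ≤ 0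
          · rw [(hθ n k hk hkb).2 u' hu' hneg, one_mul]
          · rw [hD0 k hk hkb _ (htR n k u' hu'), mul_zero]
            simp only [t]
            rw [smul_smul, branchCoord_add (hbz k hk hkb).1]
            push Not at hneg
            rw [one_div_mul_eq_div]
            exact hneg.le
        · intro k' hk' hne
          obtain ⟨h2, h3⟩ := Finset.mem_erase.1 hk'
          rw [(hθ n k' h3 h2).1 k hk hne.symm u' hu', zero_mul]
      simp only [F, h1]
      simp only [D, t]
      ring
  refine ⟨W, F, hWo, ⟨hpW₁, mem_iInter₂.2 fun k hk => ⟨hmemWr' k hk, ?_⟩⟩, hF, ?_⟩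
  · rw [mem_preimage, hπp k hk]; exact Metric.mem_ball_self hr
  · intro j' k' u hu
    obtain ⟨l, τ, hτ, -, hτe⟩ := S.compat j j' k' u (hW₁s _ hu.1).1
    have h1 : i (s l (τ u)) ∈ W := by
      have := hτe.self_of_nhds
      change i (S.chart j _) ∈ W
      rw [this]; exact hu
    refine ((hmain l (τ u) h1).comp hτ).congr ?_
    filter_upwards [hτe] with u' hu' n
    have : s l (τ u') = S.sheet j' k' u' := hu'
    rw [this]

/-- Smooth functions on an embedded compact branched surface are `C¹` limits along the sheets of
smooth functions on the ambient manifold. The local approximations are glued by a partition of unity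
of the ambient manifold. -/
theorem exists_approx [T2Space N] [SigmaCompactSpace N] [IsManifold (𝓡 3) ∞ N] [CompactSpace P]
    (hh : IsProfile h) (hi : S.IsSmoothEmbedding i) {G : P → ℝ} (hG : S.IsSmooth G) :
    ∃ F : ℕ → N → ℝ, (∀ n, ContMDiff (𝓡 3) 𝓘(ℝ, ℝ) ∞ (F n)) ∧
      ∀ j k u, C1Conv (fun n u' => F n (i (S.sheet j k u')) - G (S.sheet j k u')) u := by
  choose W F hWo hpW hF hconv using fun p => exists_local_approx hh hi hG p
  have hK : IsCompact (range i) := isCompact_range hi.isEmbedding.continuous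
  obtain ⟨A, hA⟩ := hK.elim_finite_subcover W hWo
    (by rintro _ ⟨p, rfl⟩; exact mem_iUnion.2 ⟨p, hpW p⟩)
  obtain ⟨χ, hχ⟩ := SmoothPartitionOfUnity.exists_isSubordinate (𝓡 3) hK.isClosed
    (fun a : A => W a) (fun a => hWo a) (by simpa [iUnion_subtype] using hA)
  refine ⟨fun n q => ∑ a : A, χ a q * F a n q, fun n => ?_, fun j k u => ?_⟩
  · refine contMDiff_finsetSum fun a _ => ?_
    exact χ.contMDiff_smul fun x hx => (hF a n).contMDiffAt ((hWo a).mem_nhds (hχ a hx))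
  · have hsum : ∀ u', ∑ a : A, χ a (i (S.sheet j k u')) = 1 := fun u' => by
      have := χ.sum_eq_one (mem_range_self (f := i) (S.sheet j k u'))
      rwa [finsum_eq_sum_of_fintype] at this
    have hterm : ∀ a ∈ (Finset.univ : Finset A), C1Conv (fun n u' => χ a (i (S.sheet j k u')) *
        (F a n (i (S.sheet j k u')) - G (S.sheet j k u'))) u := by
      intro a _
      by_cases hu : i (S.sheet j k u) ∈ tsupport (χ a)
      · have hχs : ContDiff ℝ ∞ (fun u' => χ a (i (S.sheet j k u'))) := by
          rw [← contMDiff_iff_contDiff]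
          exact (χ a).contMDiff.comp (hi.smooth j k)
        exact (hconv a j k u (hχ a hu)).mul_left hχs
      · refine C1Conv.zero.congr ?_
        filter_upwards [(hi.smooth j k).continuous.continuousAt.eventually_mem
          ((isClosed_tsupport (χ a)).isOpen_compl.mem_nhds hu)] with u' hu' n
        have : χ a (i (S.sheet j k u')) = 0 := image_eq_zero_of_notMem_tsupport hu'
        rw [this, zero_mul]
    refine (C1Conv.sum Finset.univ hterm).congr (Filter.Eventually.of_forall fun u' n => ?_)
    simp only [mul_sub, Finset.sum_sub_distrib, ← Finset.sum_mul, hsum, one_mul]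

end BranchedSurface

/-! ### The path of contact forms -/

section PathForm

/-- Partial derivatives with respect to the second variable, as restrictions of the derivative. -/
lemma eventually_fderiv_slice {F : Type*} [NormedAddCommGroup F] [NormedSpace ℝ F]
    {A : ℝ × E3 → F} {p : ℝ × E3} (hA : ContDiffAt ℝ ∞ A p) :
    ∀ᶠ p' in 𝓝 p, fderiv ℝ (fun y => A (p'.1, y)) p'.2 =
      (fderiv ℝ A p').comp (ContinuousLinearMap.inr ℝ ℝ E3) := by
  have : ∀ᶠ p' in 𝓝 p, ContDiffAt ℝ 1 A p' :=
    (hA.of_le (by exact_mod_cast le_top)).eventually (by simp)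
  filter_upwards [this] with p' hp'
  exact ((hp'.differentiableAt (by simp)).hasFDerivAt.comp p'.2
    (hasFDerivAt_prodMk_right p'.1 p'.2)).fderiv

lemma contDiffAt_dForm_family {A : ℝ × E3 → (E3 →L[ℝ] ℝ)} {p : ℝ × E3} (hA : ContDiffAt ℝ ∞ A p)
    (x y : E3) : ContDiffAt ℝ ∞ (fun p => dForm (fun y => A (p.1, y)) p.2 x y) p := by
  have h1 : ContDiffAt ℝ ∞ (fun p => (fderiv ℝ A p).comp (ContinuousLinearMap.inr ℝ ℝ E3)) p :=
    (hA.fderiv_right (m := ∞) (by simp)).clm_comp contDiffAt_const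
  refine (((h1.clm_apply (contDiffAt_const (c := x))).clm_apply (contDiffAt_const (c := y))).sub
    ((h1.clm_apply (contDiffAt_const (c := y))).clm_apply
      (contDiffAt_const (c := x)))).congr_of_eventuallyEq ?_
  filter_upwards [eventually_fderiv_slice hA] with p' hp'
  simp only [dForm, hp']

lemma contDiffAt_wedgeD_family {A : ℝ × E3 → (E3 →L[ℝ] ℝ)} {p : ℝ × E3} (hA : ContDiffAt ℝ ∞ A p)
    (u v w : E3) : ContDiffAt ℝ ∞ (fun p => wedgeD (fun y => A (p.1, y)) p.2 u v w) p := by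
  have ha : ∀ x : E3, ContDiffAt ℝ ∞ (fun p : ℝ × E3 => A (p.1, p.2) x) p := fun x =>
    hA.clm_apply contDiffAt_const
  exact (((ha u).mul (contDiffAt_dForm_family hA v w)).add
    ((ha v).mul (contDiffAt_dForm_family hA w u))).add
    ((ha w).mul (contDiffAt_dForm_family hA u v))

variable {N : Type*} [TopologicalSpace N] [ChartedSpace E3 N]

/-- The form `(1 - c) α₀ + c f α₁`. -/
def pathForm (α₀ α₁ : OneForm N) (f : N → ℝ) (c : ℝ) : OneForm N := fun q =>
  (1 - c) • α₀ q + (c * f q) • α₁ q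

variable {α₀ α₁ : OneForm N} {f : N → ℝ}

lemma pathForm_apply (c : ℝ) (q : N) (v : TangentSpace (𝓡 3) q) :
    pathForm α₀ α₁ f c q v = (1 - c) * α₀ q v + c * f q * α₁ q v := rfl

lemma contDiffAt_comp_chart_symm [IsManifold (𝓡 3) ∞ N] (hf : ContMDiff (𝓡 3) 𝓘(ℝ, ℝ) ∞ f)
    {e : OpenPartialHomeomorph N E3} (he : e ∈ atlas E3 N) {x : E3} (hx : x ∈ e.target) :
    ContDiffAt ℝ ∞ (fun y => f (e.symm y)) x :=
  (ContMDiffAt.comp (I' := 𝓡 3) (g := f) (f := e.symm) x (hf _)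
    (contMDiffAt_chart_symm he hx)).contDiffAt

lemma contDiffAt_pathForm [IsManifold (𝓡 3) ∞ N] (hα₀ : α₀.SmoothOn univ) (hα₁ : α₁.SmoothOn univ)
    (hf : ContMDiff (𝓡 3) 𝓘(ℝ, ℝ) ∞ f) {e : OpenPartialHomeomorph N E3} (he : e ∈ atlas E3 N)
    {p : ℝ × E3} (hp : p.2 ∈ e.target) :
    ContDiffAt ℝ ∞ (fun p : ℝ × E3 => (pathForm α₀ α₁ f p.1).inChart e p.2) p := by
  have h0 := (hα₀.contDiffAt isOpen_univ he hp (mem_univ _)).comp p contDiffAt_snd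
  have h1 := (hα₁.contDiffAt isOpen_univ he hp (mem_univ _)).comp p contDiffAt_snd
  have h2 := (contDiffAt_comp_chart_symm hf he hp).comp p contDiffAt_snd
  exact ((contDiffAt_const.sub contDiffAt_fst).smul h0).add ((contDiffAt_fst.mul h2).smul h1)

lemma smoothOn_pathForm [IsManifold (𝓡 3) ∞ N] (hα₀ : α₀.SmoothOn univ) (hα₁ : α₁.SmoothOn univ)
    (hf : ContMDiff (𝓡 3) 𝓘(ℝ, ℝ) ∞ f) (c : ℝ) (W : Set N) :
    (pathForm α₀ α₁ f c).SmoothOn W := fun _ he x hx =>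
  ((contDiffAt_pathForm hα₀ hα₁ hf he (p := (c, x)) hx.1).comp x
    (contDiffAt_const.prodMk contDiffAt_id)).contDiffWithinAt

/-- Transformation of the 3-form of the contact condition under coordinate changes. -/
lemma OneForm.SmoothOn.wedgeD_inChart [IsManifold (𝓡 3) ∞ N] {α : OneForm N} (hα : α.SmoothOn univ)
    {e e' : OpenPartialHomeomorph N E3} (he : e ∈ atlas E3 N) (he' : e' ∈ atlas E3 N) {q : N}
    (hq : q ∈ e.source) (hq' : q ∈ e'.source) (u v w : E3) :
    wedgeD (α.inChart e) (e q) u v w =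
      wedgeD (α.inChart e') (e' q) (fderiv ℝ (e' ∘ e.symm) (e q) u)
        (fderiv ℝ (e' ∘ e.symm) (e q) v) (fderiv ℝ (e' ∘ e.symm) (e q) w) := by
  have hx : e q ∈ e.target := e.map_source hq
  have hx' : e.symm (e q) ∈ e'.source := by rwa [e.left_inv hq]
  have hτ : (e' ∘ e.symm) (e q) = e' q := congrArg e' (e.left_inv hq)
  have hev : α.inChart e =ᶠ[𝓝 (e q)]
      fun y => (α.inChart e' ((e' ∘ e.symm) y)).comp (fderiv ℝ (e' ∘ e.symm) y) := by
    filter_upwards [(e.isOpen_inter_preimage_symm e'.open_source).mem_nhds ⟨hx, hx'⟩] with y hy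
    exact α.inChart_compat he he' hy.1 hy.2
  rw [wedgeD_pullback (contDiffAt_coordChange he he' hx hx') ?_ hev, hτ]
  rw [hτ]
  exact (hα.contDiffAt isOpen_univ he' (e'.map_source hq') (mem_univ _)).differentiableAt (by simp)

/-- The contact condition at a point, regardless of orientations. -/
def OneForm.IsContactAt (α : OneForm N) (q : N) : Prop :=
  ∀ e ∈ atlas E3 N, q ∈ e.source → wedgeD (α.inChart e) (e q) (stdE 0) (stdE 1) (stdE 2) ≠ 0

/-- The contact condition need only be checked in one chart. -/
lemma OneForm.isContactAt_of_chart [IsManifold (𝓡 3) ∞ N] {α : OneForm N} (hα : α.SmoothOn univ)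
    {e : OpenPartialHomeomorph N E3} (he : e ∈ atlas E3 N) {q : N} (hq : q ∈ e.source)
    (h : wedgeD (α.inChart e) (e q) (stdE 0) (stdE 1) (stdE 2) ≠ 0) : α.IsContactAt q := by
  intro e' he' hq' h0
  rw [hα.wedgeD_inChart he he' hq hq', wedgeD_eq_det3_mul, h0, mul_zero] at h
  exact h rfl

lemma OneForm.IsContactAt.ne_zero {α : OneForm N} {q : N} (h : α.IsContactAt q) : α q ≠ 0 := by
  intro h0
  have hq := mem_chart_source E3 q
  refine h _ (chart_mem_atlas E3 q) hq ?_
  have h2 : α.inChart (chartAt E3 q) (chartAt E3 q q) = 0 := by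
    have h3 : ∀ q', q' = q → (α q' : E3 →L[ℝ] ℝ) = 0 := by rintro _ rfl; exact h0
    have h4 := h3 _ ((chartAt E3 q).left_inv hq)
    ext v
    exact DFunLike.congr_fun h4 _
  simp [wedgeD, h2]

/-- If all the forms of the path are contact at a point, then so they are at the points nearby. -/
lemma eventually_isContactAt [IsManifold (𝓡 3) ∞ N] (hα₀ : α₀.SmoothOn univ)
    (hα₁ : α₁.SmoothOn univ) (hf : ContMDiff (𝓡 3) 𝓘(ℝ, ℝ) ∞ f) {q : N}
    (h : ∀ c ∈ Icc (0 : ℝ) 1, (pathForm α₀ α₁ f c).IsContactAt q) :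
    ∀ᶠ q' in 𝓝 q, ∀ c ∈ Icc (0 : ℝ) 1, (pathForm α₀ α₁ f c).IsContactAt q' := by
  set e := chartAt E3 q
  have he : e ∈ atlas E3 N := chart_mem_atlas _ _
  have hq : q ∈ e.source := mem_chart_source _ _
  have key : ∀ᶠ x in 𝓝 (e q), ∀ c ∈ Icc (0 : ℝ) 1,
      wedgeD ((pathForm α₀ α₁ f c).inChart e) x (stdE 0) (stdE 1) (stdE 2) ≠ 0 := by
    refine isCompact_Icc.eventually_forall_of_forall_eventually fun c hc => ?_
    have h1 := (contDiffAt_wedgeD_family (contDiffAt_pathForm hα₀ hα₁ hf he (p := (c, e q))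
      (e.map_source hq)) (stdE 0) (stdE 1) (stdE 2)).continuousAt.eventually_ne (h c hc e he hq)
    exact (continuous_swap.tendsto (e q, c)).eventually h1
  filter_upwards [(e.continuousAt hq).eventually key, e.open_source.mem_nhds hq] with q' h1 h2 c hc
  exact OneForm.isContactAt_of_chart (smoothOn_pathForm hα₀ hα₁ hf c univ) he h2 (h1 c hc)

end PathForm

namespace BranchedSurface

variable {h : ℝ → ℝ} {P : Type*} [TopologicalSpace P] {S : BranchedSurface h P}
variable {N : Type*} [TopologicalSpace N] [ChartedSpace E3 N]
variable {i : P → N}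

/-- A compact branched surface is covered by bounded parts of its sheets. -/
lemma exists_bounded_sheets [CompactSpace P] (S : BranchedSurface h P) :
    ∃ R : ℝ, ∀ p : P, ∃ j k, ∃ u ∈ Metric.closedBall (0 : ℝ × ℝ) R, S.sheet j k u = p := by
  let pr : ∀ j, model h (S.kind j) → ℝ × ℝ := fun j x => (x.1.1, x.1.2.1)
  have hpr : ∀ j, Continuous (pr j) := fun j => by fun_prop
  let O : ℕ → Set P := fun R => ⋃ j, S.chart j '' (pr j ⁻¹' Metric.ball 0 R)
  have hO : ∀ R, IsOpen (O R) := fun R => isOpen_iUnion fun j =>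
    (S.isOpenEmbedding j).isOpenMap _ (Metric.isOpen_ball.preimage (hpr j))
  have hmono : Monotone O := fun R R' hR => iUnion_mono fun j =>
    image_mono (preimage_mono (Metric.ball_subset_ball (by exact_mod_cast hR)))
  have hcov : (univ : Set P) ⊆ ⋃ R, O R := fun p _ => by
    obtain ⟨j, ⟨w, hw⟩⟩ := mem_iUnion.1 (S.cover ▸ mem_univ p : p ∈ ⋃ j, range (S.chart j))
    obtain ⟨R, hR⟩ := exists_nat_gt ‖pr j w‖
    exact mem_iUnion.2 ⟨R, mem_iUnion.2 ⟨j, w, by simpa using hR, hw⟩⟩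
  obtain ⟨R, hR⟩ := isCompact_univ.elim_directed_cover O hO hcov hmono.directed_le
  refine ⟨R, fun p => ?_⟩
  obtain ⟨j, w, hw, rfl⟩ := mem_iUnion.1 (hR (mem_univ p))
  obtain ⟨k, hk, u, hu⟩ := mem_iUnion₂.1 w.2
  refine ⟨j, ⟨k, hk⟩, u, ?_, congrArg _ (Subtype.ext hu)⟩
  have h1 : pr j w = u := by
    simp only [pr, ← hu]
    fin_cases k <;> rfl
  rw [← h1]
  exact Metric.ball_subset_closedBall hw

/-- There is a positive function `f` on the ambient manifold such that the forms between `α₀` and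
`f α₁` are contact forms near the branched surface. -/
theorem exists_contact_path [T2Space N] [SigmaCompactSpace N] [IsManifold (𝓡 3) ∞ N]
    [CompactSpace P] (hh : IsProfile h) (hi : S.IsSmoothEmbedding i) {α₀ α₁ : OneForm N}
    (hα₀ : α₀.IsPosContact) (hα₁ : α₁.IsPosContact) {g : P → ℝ}
    (hg : S.IsSmooth g) (hgpos : ∀ p, 0 < g p)
    (hgα : ∀ (p : P) (v : S.tangentPlane i p),
      α₁ (i p) (v : TangentSpace (𝓡 3) (i p)) = g p * α₀ (i p) (v : TangentSpace (𝓡 3) (i p))) :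
    ∃ f : N → ℝ, ContMDiff (𝓡 3) 𝓘(ℝ, ℝ) ∞ f ∧ (∀ q, 0 < f q) ∧ ∃ O : Set N, IsOpen O ∧
      range i ⊆ O ∧ ∀ q ∈ O, ∀ c ∈ Icc (0 : ℝ) 1, (pathForm α₀ α₁ f c).IsContactAt q := by
  have hG : S.IsSmooth fun p => Real.log (g p) := fun j k => (hg j k).log fun _ => (hgpos _).ne'
  obtain ⟨F, hF, hconv⟩ := exists_approx hh hi hG
  obtain ⟨R, hR⟩ := exists_bounded_sheets S
  have hfs : ∀ n, ContMDiff (𝓡 3) 𝓘(ℝ, ℝ) ∞ fun q => Real.exp (-F n q) := fun n =>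
    (Real.contDiff_exp.comp contDiff_neg).contMDiff.comp (hF n)
  have hev : ∀ᶠ n in Filter.atTop, ∀ j k, ∀ u ∈ Metric.closedBall (0 : ℝ × ℝ) R,
      ∀ c ∈ Icc (0 : ℝ) 1,
        (pathForm α₀ α₁ (fun q => Real.exp (-F n q)) c).IsContactAt (i (S.sheet j k u)) := by
    refine Filter.eventually_all.2 fun j => Filter.eventually_all.2 fun k => ?_
    have h1 : {z : (ℝ × ℝ) × ℕ | ∀ c ∈ Icc (0 : ℝ) 1, (pathForm α₀ α₁
        (fun q => Real.exp (-F z.2 q)) c).IsContactAt (i (S.sheet j k z.1))} ∈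
        𝓝ˢ (Metric.closedBall (0 : ℝ × ℝ) R) ×ˢ Filter.atTop := by
      refine (isCompact_closedBall _ _).mem_nhdsSet_prod_of_forall fun u _ => ?_
      have he := chart_mem_atlas E3 (i (S.sheet j k u))
      filter_upwards [eventually_wedgeD_pos hi hα₀ hα₁ hg hgpos hgα hF
        (hconv j k u).tendsto_fderiv he (mem_chart_source _ _)] with z hz c hc
      exact OneForm.isContactAt_of_chart (smoothOn_pathForm hα₀.1 hα₁.1 (hfs z.2) c univ) he hz.1
        (hz.2 (1 - c) c (by linarith [hc.2]) hc.1 (by linarith)).ne'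
    obtain ⟨A, hA, B, hB, hAB⟩ := Filter.mem_prod_iff.1 h1
    filter_upwards [hB] with n hn u hu
    exact hAB (show (u, n) ∈ A ×ˢ B from ⟨subset_of_mem_nhdsSet hA hu, hn⟩)
  obtain ⟨n, hn⟩ := hev.exists
  refine ⟨fun q => Real.exp (-F n q), hfs n, fun q => Real.exp_pos _, interior {q | ∀ c ∈ Icc (0 : ℝ) 1,
    (pathForm α₀ α₁ (fun q => Real.exp (-F n q)) c).IsContactAt q}, isOpen_interior, ?_,
    fun q hq => interior_subset hq⟩
  rintro _ ⟨p, rfl⟩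
  obtain ⟨j, k, u, hu, rfl⟩ := hR p
  exact mem_interior_iff_mem_nhds.2
    (eventually_isContactAt hα₀.1 hα₁.1 (hfs n) fun c hc => hn j k u hu c hc)

end BranchedSurface

/-! ### The vector field of Moser's method -/

section Cross

/-- The cross product of two linear forms on `ℝ³`. -/
def cross (a b : E3 →L[ℝ] ℝ) : E3 :=
  !₂[a (stdE 1) * b (stdE 2) - a (stdE 2) * b (stdE 1),
    a (stdE 2) * b (stdE 0) - a (stdE 0) * b (stdE 2),
    a (stdE 0) * b (stdE 1) - a (stdE 1) * b (stdE 0)]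

lemma det3_cross (a b : E3 →L[ℝ] ℝ) (u w : E3) :
    det3 (cross a b) u w = a u * b w - a w * b u := by
  conv_rhs => rw [eq_sum_stdE u, eq_sum_stdE w]
  simp only [cross, det3, map_add, map_smul, smul_eq_mul, PiLp.toLp_apply, Matrix.cons_val]
  ring

lemma apply_cross_self (a b : E3 →L[ℝ] ℝ) : a (cross a b) = 0 := by
  rw [eq_sum_stdE (cross a b)]
  simp only [cross, map_add, map_smul, smul_eq_mul, PiLp.toLp_apply, Matrix.cons_val]
  ring

lemma det3_smul (c : ℝ) (u v w : E3) : det3 (c • u) v w = c * det3 u v w := by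
  simp only [det3, PiLp.smul_apply, smul_eq_mul]; ring

lemma eq_of_det3_eq {u u' : E3} (h : ∀ v w, det3 u v w = det3 u' v w) : u = u' := by
  have h0 := h (stdE 1) (stdE 2)
  have h1 := h (stdE 2) (stdE 0)
  have h2 := h (stdE 0) (stdE 1)
  simp [det3] at h0 h1 h2
  ext n
  fin_cases n <;> simpa

/-- The algebraic identity behind Moser's method: the contraction of `da` with `a × b` is a
combination of `a` and `b`. -/
lemma dForm_cross (a : E3 → (E3 →L[ℝ] ℝ)) (x : E3) (b : E3 →L[ℝ] ℝ) (w : E3) :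
    dForm a x (cross (a x) b) w + wedgeD a x (stdE 0) (stdE 1) (stdE 2) * b w =
      (b (stdE 0) * dForm a x (stdE 1) (stdE 2) + b (stdE 1) * dForm a x (stdE 2) (stdE 0) +
        b (stdE 2) * dForm a x (stdE 0) (stdE 1)) * a x w := by
  rw [eq_sum_stdE (cross (a x) b), eq_sum_stdE w]
  simp only [dForm, wedgeD, cross, map_add, map_smul, add_apply, smul_apply, smul_eq_mul,
    PiLp.toLp_apply, Matrix.cons_val]
  ring

lemma contDiffAt_cross {F : Type*} [NormedAddCommGroup F] [NormedSpace ℝ F]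
    {a b : F → (E3 →L[ℝ] ℝ)} {z : F} (ha : ContDiffAt ℝ ∞ a z) (hb : ContDiffAt ℝ ∞ b z) :
    ContDiffAt ℝ ∞ (fun z => cross (a z) (b z)) z := by
  have ha' : ∀ v : E3, ContDiffAt ℝ ∞ (fun z => a z v) z := fun v => ha.clm_apply contDiffAt_const
  have hb' : ∀ v : E3, ContDiffAt ℝ ∞ (fun z => b z v) z := fun v => hb.clm_apply contDiffAt_const
  have key : ∀ n m, ContDiffAt ℝ ∞ (fun z => a z (stdE n) * b z (stdE m) -
      a z (stdE m) * b z (stdE n)) z := fun n m =>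
    ((ha' _).mul (hb' _)).sub ((ha' _).mul (hb' _))
  rw [contDiffAt_euclidean]
  intro n
  fin_cases n
  · exact key 1 2
  · exact key 2 0
  · exact key 0 1

end Cross

section MoserField

variable {N : Type*} [TopologicalSpace N] [ChartedSpace E3 N]

/-- The velocity `f α₁ - α₀` of the path `(1 - c) α₀ + c f α₁`. -/
def pathVelocity (α₀ α₁ : OneForm N) (f : N → ℝ) : OneForm N := fun q => f q • α₁ q - α₀ q

/-- The vector field of Moser's method for a path of contact forms `a`, with velocity `b`: it is
the contact-geometric dual of `b`, annihilated by `a`. -/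
def moserVector (α₀ α₁ : OneForm N) (f : N → ℝ) (e : OpenPartialHomeomorph N E3) (c : ℝ) (x : E3) :
    E3 :=
  (wedgeD ((pathForm α₀ α₁ f c).inChart e) x (stdE 0) (stdE 1) (stdE 2))⁻¹ •
    cross ((pathForm α₀ α₁ f c).inChart e x) ((pathVelocity α₀ α₁ f).inChart e x)

variable {α₀ α₁ : OneForm N} {f : N → ℝ}

lemma contDiffAt_pathVelocity [IsManifold (𝓡 3) ∞ N] (hα₀ : α₀.SmoothOn univ)
    (hα₁ : α₁.SmoothOn univ) (hf : ContMDiff (𝓡 3) 𝓘(ℝ, ℝ) ∞ f)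
    {e : OpenPartialHomeomorph N E3} (he : e ∈ atlas E3 N) {x : E3} (hx : x ∈ e.target) :
    ContDiffAt ℝ ∞ ((pathVelocity α₀ α₁ f).inChart e) x :=
  ((contDiffAt_comp_chart_symm hf he hx).smul (hα₁.contDiffAt isOpen_univ he hx (mem_univ _))).sub
    (hα₀.contDiffAt isOpen_univ he hx (mem_univ _))

lemma contDiffAt_moserVector [IsManifold (𝓡 3) ∞ N] (hα₀ : α₀.SmoothOn univ)
    (hα₁ : α₁.SmoothOn univ) (hf : ContMDiff (𝓡 3) 𝓘(ℝ, ℝ) ∞ f)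
    {e : OpenPartialHomeomorph N E3} (he : e ∈ atlas E3 N) {c : ℝ} {x : E3} (hx : x ∈ e.target)
    (hc : (pathForm α₀ α₁ f c).IsContactAt (e.symm x)) :
    ContDiffAt ℝ ∞ (fun p : ℝ × E3 => moserVector α₀ α₁ f e p.1 p.2) (c, x) := by
  have h1 := contDiffAt_pathForm hα₀ hα₁ hf he (p := (c, x)) hx
  have h2 := contDiffAt_wedgeD_family h1 (stdE 0) (stdE 1) (stdE 2)
  have h3 := hc e he (e.map_target hx)
  rw [e.right_inv hx] at h3
  exact (h2.inv h3).smul (contDiffAt_cross h1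
    ((contDiffAt_pathVelocity hα₀ hα₁ hf he hx).comp (c, x) contDiffAt_snd))

/-- Moser's vector field is independent of the chart. For a form `a` with velocity `b` it is the vector
`X` with `(a ∧ da) (X, u, w) = a u * b w - a w * b u` for all `u`, `w`. -/
lemma moserVector_compat [IsManifold (𝓡 3) ∞ N] (hα₀ : α₀.SmoothOn univ)
    (hα₁ : α₁.SmoothOn univ) (hf : ContMDiff (𝓡 3) 𝓘(ℝ, ℝ) ∞ f)
    {e e' : OpenPartialHomeomorph N E3} (he : e ∈ atlas E3 N) (he' : e' ∈ atlas E3 N) {c : ℝ} {q : N}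
    (hq : q ∈ e.source) (hq' : q ∈ e'.source) (hc : (pathForm α₀ α₁ f c).IsContactAt q) :
    moserVector α₀ α₁ f e' c (e' q) =
      fderiv ℝ (e' ∘ e.symm) (e q) (moserVector α₀ α₁ f e c (e q)) := by
  have hx : e q ∈ e.target := e.map_source hq
  have hx' : e.symm (e q) ∈ e'.source := by rwa [e.left_inv hq]
  have hτ : (e' ∘ e.symm) (e q) = e' q := congrArg e' (e.left_inv hq)
  set D := fderiv ℝ (e' ∘ e.symm) (e q)
  have hW := hc e he hq
  have hW' := hc e' he' hq'
  have hdet : ∀ u v w, det3 u v w * wedgeD ((pathForm α₀ α₁ f c).inChart e) (e q)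
      (stdE 0) (stdE 1) (stdE 2) = det3 (D u) (D v) (D w) *
        wedgeD ((pathForm α₀ α₁ f c).inChart e') (e' q) (stdE 0) (stdE 1) (stdE 2) := by
    intro u v w
    rw [← wedgeD_eq_det3_mul, ← wedgeD_eq_det3_mul]
    exact (smoothOn_pathForm hα₀ hα₁ hf c univ).wedgeD_inChart he he' hq hq' u v w
  have hinj : Function.Injective D := by
    refine (injective_iff_map_eq_zero D).2 fun u hu => eq_of_det3_eq fun v w => ?_
    have h1 := hdet u v w
    rw [hu] at h1
    have h2 : det3 (0 : E3) (D v) (D w) = 0 := by simp [det3]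
    have h3 : det3 (0 : E3) v w = 0 := by simp [det3]
    rw [h2, zero_mul] at h1
    rw [h3]
    exact (mul_eq_zero.1 h1).resolve_right hW
  have hsurj : Function.Surjective D := (LinearMap.injective_iff_surjective (f := D.toLinearMap)).1 hinj
  have ha := (pathForm α₀ α₁ f c).inChart_compat he he' hx hx'
  have hb := (pathVelocity α₀ α₁ f).inChart_compat he he' hx hx'
  rw [hτ] at ha hb
  refine eq_of_det3_eq fun y z => ?_
  obtain ⟨v, rfl⟩ := hsurj y
  obtain ⟨w, rfl⟩ := hsurj z
  have h1 := hdet (moserVector α₀ α₁ f e c (e q)) v w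
  refine mul_right_cancel₀ hW' (Eq.trans ?_ h1)
  simp only [moserVector, det3_smul, det3_cross]
  rw [mul_right_comm, inv_mul_cancel₀ hW', mul_right_comm, inv_mul_cancel₀ hW, ha, hb]
  rfl

/-- The vector field of Moser's method, cut off near a compact set, for the reparametrized path
`c = τ t`. -/
theorem exists_moserField [T2Space N] [SigmaCompactSpace N] [IsManifold (𝓡 3) ∞ N]
    (hα₀ : α₀.SmoothOn univ) (hα₁ : α₁.SmoothOn univ) (hf : ContMDiff (𝓡 3) 𝓘(ℝ, ℝ) ∞ f)
    {τ : ℝ → ℝ} (hτ : ContDiff ℝ ∞ τ) (hτ1 : ∀ t, τ t ∈ Icc (0 : ℝ) 1) {K₀ O : Set N}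
    (hK₀ : IsCompact K₀) (hO : IsOpen O) (hKO : K₀ ⊆ O)
    (hc : ∀ q ∈ O, ∀ c ∈ Icc (0 : ℝ) 1, (pathForm α₀ α₁ f c).IsContactAt q) :
    ∃ (V : TimeField N) (K O' : Set N), IsCompact K ∧
      (∀ e ∈ atlas E3 N, ∀ t, ∀ q ∈ e.source, q ∉ K → V.X e t (e q) = 0) ∧
      IsOpen O' ∧ K₀ ⊆ O' ∧ O' ⊆ O ∧ ∀ e ∈ atlas E3 N, ∀ t, ∀ x ∈ e.target, e.symm x ∈ O' →
        V.X e t x = deriv τ t • moserVector α₀ α₁ f e (τ t) x := by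
  have : LocallyCompactSpace N := ChartedSpace.locallyCompactSpace E3 N
  obtain ⟨K₁, hK₁, hK₀₁, hK₁O⟩ := exists_compact_between hK₀ hO hKO
  obtain ⟨K, hK, hK₁K, hKO⟩ := exists_compact_between hK₁ hO hK₁O
  obtain ⟨χ, hχ0, hχ1, -⟩ := exists_contMDiffMap_zero_one_of_isClosed (n := ⊤) (𝓡 3)
    isOpen_interior.isClosed_compl hK₁.isClosed (disjoint_compl_left_iff_subset.2 hK₁K)
  have hχ0' : ∀ q, q ∉ K → χ q = 0 := fun q hq => hχ0 fun h => hq (interior_subset h)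
  have hτ' : ContDiff ℝ ∞ (deriv τ) := (contDiff_infty_iff_deriv.1 hτ).2
  let X : OpenPartialHomeomorph N E3 → ℝ → E3 → E3 := fun e t x =>
    χ (e.symm x) • deriv τ t • moserVector α₀ α₁ f e (τ t) x
  have hX0 : ∀ e ∈ atlas E3 N, ∀ t, ∀ q ∈ e.source, q ∉ K → X e t (e q) = 0 := by
    intro e _ t q hq hqK
    simp only [X, e.left_inv hq, hχ0' q hqK, zero_smul]
  refine ⟨⟨X, fun e he p hp => ContDiffAt.contDiffWithinAt ?_, fun e he e' he' t q hq hq' => ?_⟩,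
    K, interior K₁, hK, hX0, isOpen_interior, hK₀₁, interior_subset.trans hK₁O,
    fun e he t x hx hxO => ?_⟩
  · have hx : p.2 ∈ e.target := hp.2
    by_cases hpK : e.symm p.2 ∈ K
    · have h1 := contDiffAt_moserVector hα₀ hα₁ hf he hx (hc _ (hKO hpK) _ (hτ1 p.1))
      have h2 : ContDiffAt ℝ ∞ (fun p : ℝ × E3 => (τ p.1, p.2)) p :=
        (hτ.contDiffAt.comp p contDiffAt_fst).prodMk contDiffAt_snd
      have h3 : ContDiffAt ℝ ∞ (fun p : ℝ × E3 => moserVector α₀ α₁ f e (τ p.1) p.2) p :=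
        ContDiffAt.comp (g := fun p : ℝ × E3 => moserVector α₀ α₁ f e p.1 p.2)
          (f := fun p : ℝ × E3 => (τ p.1, p.2)) p h1 h2
      have h4 : ContDiffAt ℝ ∞ (fun p : ℝ × E3 => deriv τ p.1) p :=
        ContDiffAt.comp (g := deriv τ) p hτ'.contDiffAt contDiffAt_fst
      have h5 : ContDiffAt ℝ ∞ (fun p : ℝ × E3 => χ (e.symm p.2)) p :=
        ContDiffAt.comp (g := fun x => χ (e.symm x)) p
          (contDiffAt_comp_chart_symm χ.contMDiff he hx) contDiffAt_snd
      exact h5.smul (h4.smul h3)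
    · refine (contDiffAt_const (c := 0)).congr_of_eventuallyEq ?_
      have hcont : ContinuousAt (fun p : ℝ × E3 => e.symm p.2) p :=
        ContinuousAt.comp (g := e.symm) (e.symm.continuousAt hx) continuousAt_snd
      filter_upwards [hcont.eventually_mem (hK.isClosed.isOpen_compl.mem_nhds hpK)] with p' hp'
      simp only [X, hχ0' _ hp', zero_smul]
  · by_cases hqK : q ∈ K
    · simp only [X, e.left_inv hq, e'.left_inv hq', map_smul]
      rw [moserVector_compat hα₀ hα₁ hf he he' hq hq' (hc q (hKO hqK) _ (hτ1 t))]
    · rw [hX0 e he t q hq hqK, hX0 e' he' t q hq' hqK, map_zero]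
  · have : χ (e.symm x) = 1 := hχ1 (interior_subset hxO)
    simp only [X, this, one_smul]

end MoserField

/-! ### Moser's method -/

section LinearODE

/-- Solutions of `y' = μ y` are multiplied by a positive factor which does not depend on the
solution. -/
lemma exists_pos_factor {μ : ℝ → ℝ} {T ε : ℝ} (hμ : ∀ t ∈ Metric.ball T ε, ContinuousAt μ t) {t : ℝ}
    (ht : t ∈ Metric.ball T ε) : ∃ k > 0, ∀ y : ℝ → ℝ,
      (∀ s ∈ Metric.ball T ε, HasDerivAt y (μ s * y s) s) → y t = k * y T := by
  have hT : T ∈ Metric.ball T ε := Metric.mem_ball_self (Metric.pos_of_mem_ball ht)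
  have hcont : ContinuousOn μ (Metric.ball T ε) := fun s hs => (hμ s hs).continuousWithinAt
  have hM : ∀ s ∈ Metric.ball T ε, HasDerivAt (fun s => ∫ r in T..s, μ r) (μ s) s := fun s hs =>
    intervalIntegral.integral_hasDerivAt_right
      ((hcont.mono ((convex_ball T ε).ordConnected.uIcc_subset hT hs)).intervalIntegrable)
      (hcont.stronglyMeasurableAtFilter Metric.isOpen_ball s hs) (hμ s hs)
  refine ⟨Real.exp (∫ r in T..t, μ r), Real.exp_pos _, fun y hy => ?_⟩
  have hd : ∀ s ∈ Metric.ball T ε,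
      HasDerivAt (fun s => y s * Real.exp (-∫ r in T..s, μ r)) 0 s := fun s hs => by
    exact ((hy s hs).mul (hM s hs).neg.exp).congr_deriv (by ring)
  have hconst := Metric.isOpen_ball.is_const_of_deriv_eq_zero
    (f := fun s => y s * Real.exp (-∫ r in T..s, μ r)) (convex_ball T ε).isPreconnected
    (fun s hs => (hd s hs).differentiableAt.differentiableWithinAt)
    (fun s hs => (hd s hs).deriv) ht hT
  simp only [intervalIntegral.integral_same, neg_zero, Real.exp_zero, mul_one] at hconst
  rw [← hconst, mul_left_comm, ← Real.exp_add]
  simp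

end LinearODE

section Local

/-- Moser's computation in coordinates: the pull-backs of the forms `A (t, ·)` by the flow `Ψ` of
the field `X`, with `A (X) = 0`, satisfy a linear differential equation if `i_X dA + ∂A/∂t` is a
multiple of `A`. -/
lemma hasDerivAt_moser {A : ℝ × E3 → (E3 →L[ℝ] ℝ)} {X Ψ : ℝ × E3 → E3} {t : ℝ} {x : E3}
    {b : E3 →L[ℝ] ℝ} {μ : ℝ} (hA : DifferentiableAt ℝ A (t, Ψ (t, x)))
    (hX : DifferentiableAt ℝ X (t, Ψ (t, x))) (hΨ : ContDiffAt ℝ ∞ Ψ (t, x))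
    (hflow : ∀ᶠ p in 𝓝 (t, x), HasDerivAt (fun s => Ψ (s, p.2)) (X (p.1, Ψ p)) p.1)
    (hAX : ∀ᶠ p in 𝓝 (t, Ψ (t, x)), A p (X p) = 0)
    (hb : HasDerivAt (fun s => A (s, Ψ (t, x))) b t)
    (hμ : ∀ w, dForm (fun y => A (t, y)) (Ψ (t, x)) (X (t, Ψ (t, x))) w + b w =
      μ * A (t, Ψ (t, x)) w) (w : E3) :
    HasDerivAt (fun s => A (s, Ψ (s, x)) (fderiv ℝ Ψ (s, x) (0, w)))
      (μ * A (t, Ψ (t, x)) (fderiv ℝ Ψ (t, x) (0, w))) t := by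
  set y := Ψ (t, x)
  set J := fderiv ℝ Ψ (t, x) (0, w) with hJ
  have hev : ∀ᶠ p in 𝓝 (t, x), fderiv ℝ Ψ p (1, 0) = X (p.1, Ψ p) := by
    have h1 : ∀ᶠ p in 𝓝 (t, x), ContDiffAt ℝ 1 Ψ p :=
      (hΨ.of_le (by exact_mod_cast le_top)).eventually (by simp)
    filter_upwards [h1, hflow] with p hp hp'
    exact ((hp.differentiableAt (by simp)).hasFDerivAt.comp_hasDerivAt p.1
      ((hasDerivAt_id p.1).prodMk (hasDerivAt_const p.1 p.2))).unique hp'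
  have hΨd := (hΨ.differentiableAt (by simp)).hasFDerivAt
  have hD2 : HasFDerivAt (fderiv ℝ Ψ) (fderiv ℝ (fderiv ℝ Ψ) (t, x)) (t, x) :=
    ((hΨ.fderiv_right (m := ∞) (by simp)).differentiableAt (by simp)).hasFDerivAt
  have hline : HasDerivAt (fun s : ℝ => (s, x)) ((1 : ℝ), (0 : E3)) t :=
    (hasDerivAt_id t).prodMk (hasDerivAt_const t x)
  have hΨt : HasDerivAt (fun s => Ψ (s, x)) (X (t, y)) t := hflow.self_of_nhds
  -- the variation of the flow satisfies the linearized equation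
  have hJ' : HasDerivAt (fun s => fderiv ℝ Ψ (s, x) (0, w)) (fderiv ℝ X (t, y) (0, J)) t := by
    have h0 : HasDerivAt (fun s => fderiv ℝ Ψ (s, x)) (fderiv ℝ (fderiv ℝ Ψ) (t, x) (1, 0)) t :=
      HasFDerivAt.comp_hasDerivAt (f := fun s : ℝ => (s, x)) t hD2 hline
    have h1 := h0.clm_apply (hasDerivAt_const t ((0 : ℝ), w))
    rw [map_zero, add_zero] at h1
    have hsymm : IsSymmSndFDerivAt ℝ Ψ (t, x) :=
      hΨ.isSymmSndFDerivAt (by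
        rw [minSmoothness_of_isRCLikeNormedField]
        exact ENat.LEInfty.out)
    have h2 : HasFDerivAt (fun p : ℝ × E3 => X (p.1, Ψ p)) ((fderiv ℝ X (t, y)).comp
        ((ContinuousLinearMap.fst ℝ ℝ E3).prod (fderiv ℝ Ψ (t, x)))) (t, x) :=
      HasFDerivAt.comp (g := X) (f := fun p : ℝ × E3 => (p.1, Ψ p)) (t, x) hX.hasFDerivAt
        (hasFDerivAt_fst.prodMk hΨd)
    have h3 : HasFDerivAt (fun p => fderiv ℝ Ψ p (1, 0))
        ((fderiv ℝ (fderiv ℝ Ψ) (t, x)).flip (1, 0)) (t, x) :=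
      (hD2.clm_apply (hasFDerivAt_const ((1 : ℝ), (0 : E3)) (t, x))).congr_fderiv (by
        ext <;> simp)
    have h4 := DFunLike.congr_fun (h3.unique (h2.congr_of_eventuallyEq hev)) (0, w)
    refine h1.congr_deriv ?_
    rw [hsymm.eq]
    simpa using h4
  have hA' : HasDerivAt (fun s => A (s, Ψ (s, x))) (fderiv ℝ A (t, y) (1, X (t, y))) t :=
    HasFDerivAt.comp_hasDerivAt (f := fun s => (s, Ψ (s, x))) t hA.hasFDerivAt
      ((hasDerivAt_id t).prodMk hΨt)
  have hb' : fderiv ℝ A (t, y) (1, 0) = b :=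
    (HasFDerivAt.comp_hasDerivAt (f := fun s => (s, y)) t hA.hasFDerivAt
      ((hasDerivAt_id t).prodMk (hasDerivAt_const t y))).unique hb
  have hAX' : A (t, y) (fderiv ℝ X (t, y) (0, J)) + fderiv ℝ A (t, y) (0, J) (X (t, y)) = 0 := by
    have h1 := hA.hasFDerivAt.clm_apply hX.hasFDerivAt
    have h2 := h1.unique ((hasFDerivAt_const (0 : ℝ) (t, y)).congr_of_eventuallyEq hAX)
    simpa using DFunLike.congr_fun h2 (0, J)
  have hslice : fderiv ℝ (fun y => A (t, y)) y =
      (fderiv ℝ A (t, y)).comp (ContinuousLinearMap.inr ℝ ℝ E3) :=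
    (hA.hasFDerivAt.comp y (hasFDerivAt_prodMk_right t y)).fderiv
  refine (hA'.clm_apply hJ').congr_deriv ?_
  have h5 := hμ J
  rw [dForm, hslice] at h5
  simp only [ContinuousLinearMap.comp_apply, ContinuousLinearMap.inr_apply] at h5
  have h6 : fderiv ℝ A (t, y) (1, X (t, y)) = b + fderiv ℝ A (t, y) (0, X (t, y)) := by
    rw [← hb', ← map_add]; simp
  rw [h6, add_apply, ← h5]
  linarith

end Local

section MoserFlow

variable {N : Type*} [TopologicalSpace N] [ChartedSpace E3 N]
variable {V : TimeField N} {Φ : ℝ → N → N} {s : ℝ}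

namespace TimeField

lemma IsEvolution.contMDiffAt (hΦ : V.IsEvolution s univ Φ) (t : ℝ) (q : N) :
    ContMDiffAt (𝓡 3) (𝓡 3) ∞ (Φ t) q :=
  ContMDiffAt.comp (g := fun p : N × ℝ => Φ p.2 p.1) (f := fun r : N => (r, t)) q
    (hΦ.smooth q t (mem_univ _)) (contMDiffAt_id.prodMk contMDiffAt_const)

lemma IsEvolution.continuous (hΦ : V.IsEvolution s univ Φ) :
    Continuous fun p : N × ℝ => Φ p.2 p.1 :=
  continuous_iff_continuousAt.2 fun p => (hΦ.smooth p.1 p.2 (mem_univ _)).continuousAt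

lemma IsEvolution.continuous_time (hΦ : V.IsEvolution s univ Φ) (q : N) :
    Continuous fun t => Φ t q :=
  hΦ.continuous.comp (Continuous.prodMk_right q)

/-- An evolution in charts. -/
lemma IsEvolution.contDiffAt_chart [IsManifold (𝓡 3) ∞ N] (hΦ : V.IsEvolution s univ Φ)
    {e e' : OpenPartialHomeomorph N E3} (he : e ∈ atlas E3 N) (he' : e' ∈ atlas E3 N) {t : ℝ} {x : E3}
    (hx : x ∈ e.target) (hx' : Φ t (e.symm x) ∈ e'.source) :
    ContDiffAt ℝ ∞ (fun p : ℝ × E3 => e' (Φ p.1 (e.symm p.2))) (t, x) := by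
  have h1 : ContMDiffAt 𝓘(ℝ, ℝ × E3) (𝓡 3) ∞ (fun p : ℝ × E3 => e.symm p.2) (t, x) :=
    ContMDiffAt.comp (I' := 𝓘(ℝ, E3)) (g := e.symm) (f := fun p : ℝ × E3 => p.2) (t, x)
      (contMDiffAt_chart_symm he hx) contDiffAt_snd.contMDiffAt
  have h2 : ContMDiffAt 𝓘(ℝ, ℝ × E3) 𝓘(ℝ, ℝ) ∞ (fun p : ℝ × E3 => p.1) (t, x) :=
    contDiffAt_fst.contMDiffAt
  have h3 : ContMDiffAt 𝓘(ℝ, ℝ × E3) (𝓡 3) ∞ (fun p : ℝ × E3 => Φ p.1 (e.symm p.2)) (t, x) :=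
    ContMDiffAt.comp (I' := (𝓡 3).prod 𝓘(ℝ, ℝ)) (g := fun p : N × ℝ => Φ p.2 p.1)
      (f := fun p : ℝ × E3 => (e.symm p.2, p.1)) (t, x) (hΦ.smooth _ t (mem_univ _)) (h1.prodMk h2)
  exact (ContMDiffAt.comp (I' := 𝓡 3) (g := e') (f := fun p : ℝ × E3 => Φ p.1 (e.symm p.2)) (t, x)
    (contMDiffAt_chart he' hx') h3).contDiffAt

/-- The value of a form on the derivative of an evolution, computed in charts. -/
lemma IsEvolution.inChart_mfderiv [IsManifold (𝓡 3) ∞ N] (hΦ : V.IsEvolution s univ Φ)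
    {e e' : OpenPartialHomeomorph N E3} (he : e ∈ atlas E3 N) (he' : e' ∈ atlas E3 N) {t : ℝ} {q : N}
    (hq : q ∈ e.source) (hq' : Φ t q ∈ e'.source) (α : OneForm N) (w : TangentSpace (𝓡 3) q) :
    α (Φ t q) (mfderiv (𝓡 3) (𝓡 3) (Φ t) q w) = α.inChart e' (e' (Φ t q))
      (fderiv ℝ (fun p : ℝ × E3 => e' (Φ p.1 (e.symm p.2))) (t, e q)
        (0, mfderiv (𝓡 3) 𝓘(ℝ, E3) e q w)) := by
  have hsm := hΦ.contDiffAt_chart (t := t) he he' (e.map_source hq) (by rwa [e.left_inv hq])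
  have hd := (hsm.differentiableAt (by simp)).hasFDerivAt.comp (e q)
    (hasFDerivAt_prodMk_right t (e q))
  rw [← α.inChart_mfderiv_comp he' ((hΦ.contMDiffAt t q).mdifferentiableAt (by simp)) hq']
  have h1 : e' ∘ Φ t =ᶠ[𝓝 q] (fun x => e' (Φ t (e.symm x))) ∘ e := by
    filter_upwards [e.open_source.mem_nhds hq] with r hr
    simp [e.left_inv hr]
  have h2 : MDifferentiableAt 𝓘(ℝ, E3) 𝓘(ℝ, E3) (fun x => e' (Φ t (e.symm x))) (e q) :=
    hd.differentiableAt.mdifferentiableAt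
  have h3 := mfderiv_comp q h2 ((contMDiffAt_chart he hq).mdifferentiableAt (by simp))
  have h4 : mfderiv 𝓘(ℝ, E3) 𝓘(ℝ, E3) (fun x => e' (Φ t (e.symm x))) (e q) = _ :=
    mfderiv_eq_fderiv.trans hd.fderiv
  rw [h1.mfderiv_eq, h3, h4]
  rfl

end TimeField

variable {α₀ α₁ : OneForm N} {f : N → ℝ} {τ : ℝ → ℝ} {O : Set N}

/-- The flow of the field of Moser's method respects the path of plane fields, locally in time. -/
lemma eventually_moser [IsManifold (𝓡 3) ∞ N] (hα₀ : α₀.SmoothOn univ) (hα₁ : α₁.SmoothOn univ)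
    (hf : ContMDiff (𝓡 3) 𝓘(ℝ, ℝ) ∞ f) (hτ : ContDiff ℝ ∞ τ) (hτ1 : ∀ t, τ t ∈ Icc (0 : ℝ) 1)
    (hO : IsOpen O) (hc : ∀ q ∈ O, ∀ c ∈ Icc (0 : ℝ) 1, (pathForm α₀ α₁ f c).IsContactAt q)
    (hV : ∀ e ∈ atlas E3 N, ∀ t, ∀ x ∈ e.target, e.symm x ∈ O →
        V.X e t x = deriv τ t • moserVector α₀ α₁ f e (τ t) x)
    (hΦ : V.IsEvolution s univ Φ) {T : ℝ} {q : N} (hT : Φ T q ∈ O) :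
    ∀ᶠ t in 𝓝 T, ∃ k > 0, ∀ w : TangentSpace (𝓡 3) q,
      pathForm α₀ α₁ f (τ t) (Φ t q) (mfderiv (𝓡 3) (𝓡 3) (Φ t) q w) =
        k * pathForm α₀ α₁ f (τ T) (Φ T q) (mfderiv (𝓡 3) (𝓡 3) (Φ T) q w) := by
  set e₀ := chartAt E3 q
  have he₀ : e₀ ∈ atlas E3 N := chart_mem_atlas _ _
  have hq : q ∈ e₀.source := mem_chart_source _ _
  set e := chartAt E3 (Φ T q)
  have he : e ∈ atlas E3 N := chart_mem_atlas _ _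
  have hev : ∀ᶠ t in 𝓝 T, Φ t q ∈ O ∩ e.source :=
    (hΦ.continuous_time q).continuousAt.eventually_mem
      ((hO.inter e.open_source).mem_nhds ⟨hT, mem_chart_source _ _⟩)
  obtain ⟨ε, hε, hball⟩ := Metric.eventually_nhds_iff_ball.1 hev
  let A : ℝ × E3 → (E3 →L[ℝ] ℝ) := fun p => (pathForm α₀ α₁ f (τ p.1)).inChart e p.2
  let X : ℝ × E3 → E3 := fun p => V.X e p.1 p.2
  let Ψ : ℝ × E3 → E3 := fun p => e (Φ p.1 (e₀.symm p.2))
  set x := e₀ q with hxdef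
  have hx : x ∈ e₀.target := e₀.map_source hq
  have hxq : e₀.symm x = q := e₀.left_inv hq
  have hΨx : ∀ t, Ψ (t, x) = e (Φ t q) := fun t => by simp only [Ψ, hxq]
  have hmem : ∀ t ∈ Metric.ball T ε, Ψ (t, x) ∈ e.target := fun t ht => by
    rw [hΨx]; exact e.map_source (hball t ht).2
  have hsymm : ∀ t ∈ Metric.ball T ε, e.symm (Ψ (t, x)) = Φ t q := fun t ht => by
    rw [hΨx]; exact e.left_inv (hball t ht).2
  have hτp : ∀ p : ℝ × E3, ContDiffAt ℝ ∞ (fun p : ℝ × E3 => (τ p.1, p.2)) p := fun p =>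
    (hτ.contDiffAt.comp p contDiffAt_fst).prodMk contDiffAt_snd
  have hA : ∀ p : ℝ × E3, p.2 ∈ e.target → ContDiffAt ℝ ∞ A p := fun p hp =>
    ContDiffAt.comp (g := fun p : ℝ × E3 => (pathForm α₀ α₁ f p.1).inChart e p.2)
      (f := fun p : ℝ × E3 => (τ p.1, p.2)) p (contDiffAt_pathForm hα₀ hα₁ hf he hp) (hτp p)
  have hΨ : ∀ t ∈ Metric.ball T ε, ContDiffAt ℝ ∞ Ψ (t, x) := fun t ht =>
    hΦ.contDiffAt_chart he₀ he hx (by rw [hxq]; exact (hball t ht).2)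
  have hΨc : ∀ t ∈ Metric.ball T ε, ContinuousAt (fun t => (t, Ψ (t, x))) t := fun t ht =>
    continuousAt_id.prodMk (ContinuousAt.comp (g := Ψ) (f := fun t => (t, x)) (hΨ t ht).continuousAt
      (continuousAt_id.prodMk continuousAt_const))
  -- the coefficient of the linear equation
  let b : ℝ → E3 →L[ℝ] ℝ := fun t => (pathVelocity α₀ α₁ f).inChart e (Ψ (t, x))
  let W : ℝ → ℝ := fun t => wedgeD (fun y => A (t, y)) (Ψ (t, x)) (stdE 0) (stdE 1) (stdE 2)
  let d : Fin 3 → Fin 3 → ℝ → ℝ := fun n m t =>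
    dForm (fun y => A (t, y)) (Ψ (t, x)) (stdE n) (stdE m)
  let μ : ℝ → ℝ := fun t => deriv τ t * ((W t)⁻¹ *
    (b t (stdE 0) * d 1 2 t + b t (stdE 1) * d 2 0 t + b t (stdE 2) * d 0 1 t))
  have hW : ∀ t ∈ Metric.ball T ε, W t ≠ 0 := fun t ht => by
    have := hc _ (hball t ht).1 (τ t) (hτ1 t) e he (hball t ht).2
    rwa [← hΨx] at this
  have hμ : ∀ t ∈ Metric.ball T ε, ContinuousAt μ t := by
    intro t ht
    have hAt := hA (t, Ψ (t, x)) (hmem t ht)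
    have c1 : ContinuousAt W t := ContinuousAt.comp
      (g := fun p : ℝ × E3 => wedgeD (fun y => A (p.1, y)) p.2 (stdE 0) (stdE 1) (stdE 2))
      (f := fun t => (t, Ψ (t, x))) (contDiffAt_wedgeD_family hAt _ _ _).continuousAt (hΨc t ht)
    have c2 : ∀ n m, ContinuousAt (d n m) t := fun n m => ContinuousAt.comp
      (g := fun p : ℝ × E3 => dForm (fun y => A (p.1, y)) p.2 (stdE n) (stdE m))
      (f := fun t => (t, Ψ (t, x))) (contDiffAt_dForm_family hAt _ _).continuousAt (hΨc t ht)
    have c3 : ContinuousAt b t := ContinuousAt.comp (g := (pathVelocity α₀ α₁ f).inChart e)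
      (f := fun t => Ψ (t, x)) (contDiffAt_pathVelocity hα₀ hα₁ hf he (hmem t ht)).continuousAt
      (continuousAt_snd.comp (hΨc t ht))
    have c4 : ∀ n, ContinuousAt (fun t => b t (stdE n)) t := fun n =>
      c3.clm_apply continuousAt_const
    have c5 : ContinuousAt (deriv τ) t := (hτ.continuous_deriv (by simp)).continuousAt
    exact c5.mul ((c1.inv₀ (hW t ht)).mul ((((c4 0).mul (c2 1 2)).add ((c4 1).mul (c2 2 0))).add
      ((c4 2).mul (c2 0 1))))
  have key : ∀ t ∈ Metric.ball T ε, ∀ w : E3, HasDerivAt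
      (fun r => A (r, Ψ (r, x)) (fderiv ℝ Ψ (r, x) (0, w)))
      (μ t * A (t, Ψ (t, x)) (fderiv ℝ Ψ (t, x) (0, w))) t := by
    intro t ht
    have hOx : ∀ᶠ p in 𝓝 (t, Ψ (t, x)), p.2 ∈ e.target ∧ e.symm p.2 ∈ O := by
      refine continuousAt_snd.eventually_mem ((e.isOpen_inter_preimage_symm hO).mem_nhds ⟨hmem t ht, ?_⟩)
      rw [mem_preimage, hsymm t ht]
      exact (hball t ht).1
    have hXV : ∀ p : ℝ × E3, p.2 ∈ e.target → e.symm p.2 ∈ O →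
        X p = deriv τ p.1 • moserVector α₀ α₁ f e (τ p.1) p.2 := fun p h1 h2 => hV e he _ _ h1 h2
    refine hasDerivAt_moser (b := deriv τ t • b t) (X := X)
      ((hA _ (hmem t ht)).differentiableAt (by simp))
      ((V.contDiffAt_chart he t (hmem t ht)).differentiableAt (by simp)) (hΨ t ht) ?_ ?_ ?_ ?_
    · have hsrc : ∀ᶠ p : ℝ × E3 in 𝓝 (t, x), Φ p.1 (e₀.symm p.2) ∈ e.source := by
        have h0 : ContinuousAt (fun p : ℝ × E3 => e₀.symm p.2) (t, x) := ContinuousAt.comp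
          (g := e₀.symm) (f := fun p : ℝ × E3 => p.2) (e₀.symm.continuousAt hx) continuousAt_snd
        have : ContinuousAt (fun p : ℝ × E3 => Φ p.1 (e₀.symm p.2)) (t, x) :=
          ContinuousAt.comp (g := fun p : N × ℝ => Φ p.2 p.1) (f := fun p : ℝ × E3 => (e₀.symm p.2, p.1))
            hΦ.continuous.continuousAt (h0.prodMk continuousAt_fst)
        refine this.eventually_mem (e.open_source.mem_nhds ?_)
        simp only [hxq]
        exact (hball t ht).2
      filter_upwards [hsrc] with p hp
      exact (hΦ.sol (e₀.symm p.2) p.1 (mem_univ _)).2 e he hp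
    · filter_upwards [hOx] with p hp
      rw [hXV p hp.1 hp.2, map_smul, moserVector, map_smul, apply_cross_self, smul_zero, smul_zero]
    · have h1 : HasDerivAt τ (deriv τ t) t := (hτ.differentiable (by simp) t).hasDerivAt
      have h2 := ((h1.const_sub 1).smul_const (α₀.inChart e (Ψ (t, x)))).add
        ((h1.mul_const (f (e.symm (Ψ (t, x))))).smul_const (α₁.inChart e (Ψ (t, x))))
      refine h2.congr_deriv ?_
      change _ = deriv τ t • (f (e.symm (Ψ (t, x))) • α₁.inChart e (Ψ (t, x)) -
        α₀.inChart e (Ψ (t, x)))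
      rw [smul_sub, smul_smul, neg_smul]
      abel
    · intro w
      have h1 := dForm_cross (fun y => A (t, y)) (Ψ (t, x)) (b t) w
      have h2 : X (t, Ψ (t, x)) = (deriv τ t * (W t)⁻¹) • cross (A (t, Ψ (t, x))) (b t) := by
        rw [hXV _ (hmem t ht) (by simpa only [hsymm t ht] using (hball t ht).1), mul_smul]
        rfl
      have h3 : ∀ (c : ℝ) (v : E3), dForm (fun y => A (t, y)) (Ψ (t, x)) (c • v) w =
          c * dForm (fun y => A (t, y)) (Ψ (t, x)) v w := fun c v => by
        simp only [dForm, map_smul, smul_apply, smul_eq_mul]; ring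
      rw [h2, h3, smul_apply, smul_eq_mul, mul_assoc (deriv τ t), mul_assoc (deriv τ t), ← mul_add,
        mul_assoc (W t)⁻¹, ← h1, mul_add (W t)⁻¹]
      change _ = deriv τ t * (_ + (W t)⁻¹ * (W t * b t w))
      rw [inv_mul_cancel_left₀ (hW t ht)]
  filter_upwards [Metric.ball_mem_nhds T hε] with t ht
  obtain ⟨k, hk, hky⟩ := exists_pos_factor hμ ht
  refine ⟨k, hk, fun w => ?_⟩
  have h1 := hky _ fun r hr => key r hr (mfderiv (𝓡 3) 𝓘(ℝ, E3) e₀ q w)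
  rw [hΦ.inChart_mfderiv he₀ he hq (hball t ht).2,
    hΦ.inChart_mfderiv he₀ he hq (hball T (Metric.mem_ball_self hε)).2, ← hΨx, ← hΨx]
  exact h1

/-- The flow of the field of Moser's method respects the path of plane fields. -/
theorem moser [IsManifold (𝓡 3) ∞ N] (hα₀ : α₀.SmoothOn univ) (hα₁ : α₁.SmoothOn univ)
    (hf : ContMDiff (𝓡 3) 𝓘(ℝ, ℝ) ∞ f) (hτ : ContDiff ℝ ∞ τ) (hτ1 : ∀ t, τ t ∈ Icc (0 : ℝ) 1)
    (hO : IsOpen O) (hc : ∀ q ∈ O, ∀ c ∈ Icc (0 : ℝ) 1, (pathForm α₀ α₁ f c).IsContactAt q)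
    (hV : ∀ e ∈ atlas E3 N, ∀ t, ∀ x ∈ e.target, e.symm x ∈ O →
        V.X e t x = deriv τ t • moserVector α₀ α₁ f e (τ t) x)
    (hΦ : V.IsEvolution s univ Φ) {J : Set ℝ} (hJ : IsPreconnected J) {q : N}
    (hq : ∀ t ∈ J, Φ t q ∈ O) {t t' : ℝ} (ht : t ∈ J) (ht' : t' ∈ J) :
    ∃ k > 0, ∀ w : TangentSpace (𝓡 3) q,
      pathForm α₀ α₁ f (τ t') (Φ t' q) (mfderiv (𝓡 3) (𝓡 3) (Φ t') q w) =
        k * pathForm α₀ α₁ f (τ t) (Φ t q) (mfderiv (𝓡 3) (𝓡 3) (Φ t) q w) := by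
  refine hJ.induction₂ (fun t t' => ∃ k > 0, ∀ w : TangentSpace (𝓡 3) q,
      pathForm α₀ α₁ f (τ t') (Φ t' q) (mfderiv (𝓡 3) (𝓡 3) (Φ t') q w) =
        k * pathForm α₀ α₁ f (τ t) (Φ t q) (mfderiv (𝓡 3) (𝓡 3) (Φ t) q w)) (fun T hT =>
      nhdsWithin_le_nhds (eventually_moser hα₀ hα₁ hf hτ hτ1 hO hc hV hΦ (hq T hT))) ?_ ?_ ht ht'
  · rintro a b c - - - ⟨k, hk, h⟩ ⟨k', hk', h'⟩
    exact ⟨k' * k, mul_pos hk' hk, fun w => by rw [h', h, mul_assoc]⟩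
  · rintro a b - - ⟨k, hk, h⟩
    exact ⟨k⁻¹, inv_pos.2 hk, fun w => by rw [h, inv_mul_cancel_left₀ hk.ne']⟩

end MoserFlow

/-! ### Fields tangent to a branched surface -/

/-- Cramer's rule. -/
lemma det3_smul_eq (u v w x : E3) :
    det3 u v w • x = det3 x v w • u + det3 u x w • v + det3 x u v • w := by
  ext n
  fin_cases n <;> simp [det3] <;> ring

namespace BranchedSurface

variable {h : ℝ → ℝ} {P : Type*} [TopologicalSpace P] {S : BranchedSurface h P}
variable {N : Type*} [TopologicalSpace N] [ChartedSpace E3 N]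
variable {i : P → N}

/-- The field of Moser's method is tangent to the sheets if the two forms have proportional
restrictions to the branched surface: on a tangent plane, both arguments of the cross product are
multiples of the same linear form. -/
lemma moserVector_tangent [IsManifold (𝓡 3) ∞ N] (hi : S.IsSmoothEmbedding i)
    {α₀ α₁ : OneForm N} {f : N → ℝ} {g : P → ℝ}
    (hgα : ∀ (p : P) (v : S.tangentPlane i p),
      α₁ (i p) (v : TangentSpace (𝓡 3) (i p)) = g p * α₀ (i p) (v : TangentSpace (𝓡 3) (i p)))
    {j} {k} {u : ℝ × ℝ} {e : OpenPartialHomeomorph N E3} (he : e ∈ atlas E3 N)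
    (hu : i (S.sheet j k u) ∈ e.source) (c : ℝ) :
    ∃ w, moserVector α₀ α₁ f e c (e (i (S.sheet j k u))) =
      fderiv ℝ (e ∘ i ∘ S.sheet j k) u w := by
  set p := S.sheet j k u
  set D := fderiv ℝ (e ∘ i ∘ S.sheet j k) u
  set a := (pathForm α₀ α₁ f c).inChart e (e (i p))
  set b := (pathVelocity α₀ α₁ f).inChart e (e (i p))
  set X := moserVector α₀ α₁ f e c (e (i p))
  have h1 : ∀ w, α₁ (i p) (mfderiv 𝓘(ℝ, ℝ × ℝ) (𝓡 3) (i ∘ S.sheet j k) u w) =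
      g p * α₀ (i p) (mfderiv 𝓘(ℝ, ℝ × ℝ) (𝓡 3) (i ∘ S.sheet j k) u w) := fun w =>
    hgα p ⟨_, S.mem_tangentPlane i j k u w⟩
  have ha : ∀ w, a (D w) = ((1 - c) + c * f (i p) * g p) *
      α₀ (i p) (mfderiv 𝓘(ℝ, ℝ × ℝ) (𝓡 3) (i ∘ S.sheet j k) u w) := fun w => by
    refine (hi.inChart_sheet he hu (pathForm α₀ α₁ f c) w).trans ?_
    rw [pathForm_apply]
    refine (congrArg _ (congrArg _ (h1 w))).trans ?_
    ring
  have hb : ∀ w, b (D w) = (f (i p) * g p - 1) *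
      α₀ (i p) (mfderiv 𝓘(ℝ, ℝ × ℝ) (𝓡 3) (i ∘ S.sheet j k) u w) := fun w => by
    refine (hi.inChart_sheet he hu (pathVelocity α₀ α₁ f) w).trans ?_
    change f (i p) * α₁ (i p) _ - α₀ (i p) _ = _
    refine (congrArg (fun r => f (i p) * r - _) (h1 w)).trans ?_
    ring
  have hX : ∀ v w, det3 X (D v) (D w) = 0 := fun v w => by
    simp only [X, moserVector, det3_smul]
    rw [det3_cross, ha, ha, hb, hb]
    ring
  obtain ⟨ν, hν⟩ := hi.exists_det3_pos he hu
  set E₁ := D (1, 0)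
  set E₂ := D (0, 1)
  have hcramer := det3_smul_eq E₁ E₂ ν X
  rw [hX, zero_smul, add_zero] at hcramer
  refine ⟨(det3 E₁ E₂ ν)⁻¹ • (det3 X E₂ ν • (1, 0) + det3 E₁ X ν • (0, 1)), ?_⟩
  rw [map_smul, map_add, map_smul, map_smul, ← hcramer, inv_smul_smul₀ hν.ne']

/-- A field which is tangent to the sheets has solutions in the branched surface. -/
lemma exists_solution_mem_range [IsManifold (𝓡 3) ∞ N] (hi : S.IsSmoothEmbedding i)
    {V : TimeField N} (hV : ∀ e ∈ atlas E3 N, ∀ t j k u, i (S.sheet j k u) ∈ e.source →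
      ∃ w, V.X e t (e (i (S.sheet j k u))) = fderiv ℝ (e ∘ i ∘ S.sheet j k) u w)
    (T : ℝ) (p : P) :
    ∃ γ : ℝ → N, γ T = i p ∧ (∀ᶠ t in 𝓝 T, V.IsSolAt γ t) ∧ ∀ t, γ t ∈ range i := by
  obtain ⟨j, k, u₀, rfl⟩ := S.exists_sheet_eq p
  set e := chartAt E3 (i (S.sheet j k u₀))
  have he : e ∈ atlas E3 N := chart_mem_atlas _ _
  have hu₀ : i (S.sheet j k u₀) ∈ e.source := mem_chart_source _ _
  set σ := e ∘ i ∘ S.sheet j k with hσdef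
  have hsrc : ∀ᶠ u in 𝓝 u₀, i (S.sheet j k u) ∈ e.source :=
    (hi.smooth j k).continuous.continuousAt.eventually_mem (e.open_source.mem_nhds hu₀)
  have hσ : ∀ u, i (S.sheet j k u) ∈ e.source → ContDiffAt ℝ ∞ σ u :=
    fun u hu => hi.contDiffAt_chart he hu
  obtain ⟨O, ρ, hO, huO, hρ, hinv⟩ := exists_local_left_inverse (σ := σ) (u := u₀)
    (hsrc.mono fun u hu => hσ u hu) (hi.injective_fderiv_chart he hu₀)
  -- the field on the parameter plane
  let w : ℝ × (ℝ × ℝ) → ℝ × ℝ := fun z => fderiv ℝ ρ (σ z.2) (V.X e z.1 (σ z.2))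
  have hσz : ContDiffAt ℝ ∞ (fun z : ℝ × (ℝ × ℝ) => σ z.2) (T, u₀) :=
    ContDiffAt.comp (g := σ) (T, u₀) (hσ u₀ hu₀) contDiffAt_snd
  have hw : ContDiffAt ℝ ∞ w (T, u₀) := by
    have h1 : ContDiffAt ℝ ∞ (fderiv ℝ ρ) (σ u₀) :=
      (hρ.contDiffAt (hO.mem_nhds huO)).fderiv_right (m := ∞) (by simp)
    have h2 : ContDiffAt ℝ ∞ (fun z : ℝ × (ℝ × ℝ) => fderiv ℝ ρ (σ z.2)) (T, u₀) :=
      ContDiffAt.comp (g := fderiv ℝ ρ) (f := fun z : ℝ × (ℝ × ℝ) => σ z.2) (T, u₀) h1 hσz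
    have h3 : ContDiffAt ℝ ∞ (fun z : ℝ × (ℝ × ℝ) => V.X e z.1 (σ z.2)) (T, u₀) :=
      ContDiffAt.comp (g := fun p : ℝ × E3 => V.X e p.1 p.2)
        (f := fun z : ℝ × (ℝ × ℝ) => (z.1, σ z.2)) (T, u₀)
        (V.contDiffAt_chart he T (e.map_source hu₀)) (contDiffAt_fst.prodMk hσz)
    exact h2.clm_apply h3
  have hgood : ∀ᶠ u in 𝓝 u₀, i (S.sheet j k u) ∈ e.source ∧
      ∀ t, V.X e t (σ u) = fderiv ℝ σ u (w (t, u)) := by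
    filter_upwards [hsrc, hinv.eventually_nhds,
      (hσ u₀ hu₀).continuousAt.eventually_mem (hO.mem_nhds huO)] with u h1 h2 h3
    refine ⟨h1, fun t => ?_⟩
    obtain ⟨w', hw'⟩ := hV e he t j k u h1
    have hρu : HasFDerivAt ρ (fderiv ℝ ρ (σ u)) (σ u) :=
      ((hρ.contDiffAt (hO.mem_nhds h3)).differentiableAt (by simp)).hasFDerivAt
    have hid := (hρu.comp u ((hσ u h1).differentiableAt (by simp)).hasFDerivAt).unique
      ((hasFDerivAt_id u).congr_of_eventuallyEq h2)
    have h4 : V.X e t (σ u) = fderiv ℝ σ u w' := hw'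
    have h5 : w (t, u) = w' := by
      simp only [w, h4]
      exact DFunLike.congr_fun hid w'
    rw [h5, h4]
  obtain ⟨z, hz0, ε, hε, hz⟩ := ContDiffAt.exists_forall_mem_closedBall_exists_eq_forall_mem_Ioo_hasDerivAt₀
    (f := fun z : ℝ × (ℝ × ℝ) => ((1 : ℝ), w z)) (x₀ := (T, u₀))
    ((contDiffAt_const.prodMk hw).of_le (by exact_mod_cast le_top)) T
  rw [← Real.ball_eq_Ioo] at hz
  have hT : T ∈ Metric.ball T ε := Metric.mem_ball_self hε
  have hz1 : ∀ t ∈ Metric.ball T ε, HasDerivAt (fun t => (z t).1) 1 t := fun t ht =>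
    (hasFDerivAt_fst (𝕜 := ℝ) (p := z t)).comp_hasDerivAt t (hz t ht)
  have hz2 : ∀ t ∈ Metric.ball T ε, HasDerivAt (fun t => (z t).2) (w (z t)) t := fun t ht =>
    (hasFDerivAt_snd (𝕜 := ℝ) (p := z t)).comp_hasDerivAt t (hz t ht)
  have htime : ∀ t ∈ Metric.ball T ε, (z t).1 = t := fun t ht => by
    have hd : ∀ t ∈ Metric.ball T ε, HasDerivAt (fun t => (z t).1 - t) 0 t := fun t ht =>
      ((hz1 t ht).sub (hasDerivAt_id t)).congr_deriv (sub_self 1)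
    have := Metric.isOpen_ball.is_const_of_deriv_eq_zero (f := fun t => (z t).1 - t)
      (convex_ball T ε).isPreconnected
      (fun s hs => (hd s hs).differentiableAt.differentiableWithinAt)
      (fun s hs => (hd s hs).deriv) ht hT
    simp only [hz0, sub_self] at this
    linarith
  refine ⟨fun t => i (S.sheet j k (z t).2), by simp only [hz0], ?_, fun t => mem_range_self _⟩
  have hzu : ContinuousAt (fun t => (z t).2) T := (hz2 T hT).continuousAt
  have hzgood := hzu.eventually (p := fun u => i (S.sheet j k u) ∈ e.source ∧
      ∀ t, V.X e t (σ u) = fderiv ℝ σ u (w (t, u))) (by simpa only [hz0] using hgood)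
  filter_upwards [hzgood, Metric.ball_mem_nhds T hε] with t ht htε
  refine TimeField.IsSolAt.of_chart ?_ he ht.1 ?_
  · exact ContinuousAt.comp (g := i ∘ S.sheet j k) (f := fun t => (z t).2)
      (hi.smooth j k).continuous.continuousAt (hz2 t htε).continuousAt
  · have h1 : HasDerivAt (σ ∘ fun t => (z t).2) (fderiv ℝ σ (z t).2 (w (z t))) t :=
      ((hσ _ ht.1).differentiableAt (by simp)).hasFDerivAt.comp_hasDerivAt t (hz2 t htε)
    refine h1.congr_deriv ?_
    have h2 := ht.2 t
    rw [show (t, (z t).2) = z t from Prod.ext (htime t htε).symm rfl] at h2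
    exact h2.symm

/-- The evolution of a field which is tangent to the sheets preserves the branched surface. -/
theorem evolution_mem_range [T2Space N] [IsManifold (𝓡 3) ∞ N] [CompactSpace P]
    (hi : S.IsSmoothEmbedding i) {V : TimeField N}
    (hV : ∀ e ∈ atlas E3 N, ∀ t j k u, i (S.sheet j k u) ∈ e.source →
      ∃ w, V.X e t (e (i (S.sheet j k u))) = fderiv ℝ (e ∘ i ∘ S.sheet j k) u w)
    {s : ℝ} {Φ : ℝ → N → N} (hΦ : V.IsEvolution s univ Φ) {q : N} {t₀ : ℝ}
    (h0 : Φ t₀ q ∈ range i) (t : ℝ) : Φ t q ∈ range i := by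
  have hclosed : IsClosed {t | Φ t q ∈ range i} :=
    (isCompact_range hi.isEmbedding.continuous).isClosed.preimage (hΦ.continuous_time q)
  have hopen : IsOpen {t | Φ t q ∈ range i} := by
    refine isOpen_iff_mem_nhds.2 fun T ⟨p, hp⟩ => ?_
    obtain ⟨γ, hγ, hsol, hmem⟩ := exists_solution_mem_range hi hV T p
    have := TimeField.IsSolAt.eventuallyEq (γ' := fun t => Φ t q) hsol
      (Filter.Eventually.of_forall fun t => hΦ.sol q t (mem_univ _)) (hγ.trans hp)
    filter_upwards [this] with t ht
    rw [← ht]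
    exact hmem t
  exact (IsClopen.eq_univ ⟨hclosed, hopen⟩ ⟨t₀, h0⟩ ▸ mem_univ t : t ∈ {t | Φ t q ∈ range i})

end BranchedSurface

/-! ### The isotopy -/

section Isotopy

variable {N : Type*} [TopologicalSpace N] [ChartedSpace E3 N]
variable {V : TimeField N} {Ev : ℝ → ℝ → N → N}

lemma OneForm.apply_mfderiv_of_eq_id (α : OneForm N) {Ψ : N → N} (hΨ : Ψ = id) (q : N)
    (w : TangentSpace (𝓡 3) q) : α (Ψ q) (mfderiv (𝓡 3) (𝓡 3) Ψ q w) = α q w := by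
  subst hΨ
  rw [mfderiv_id]
  rfl

/-- Going from the time `s` to the time `t` and back. -/
lemma TimeField.evolution_symm [T2Space N] (hEv : ∀ s, V.IsEvolution s univ (Ev s)) (s t : ℝ) (q : N) :
    Ev t s (Ev s t q) = q := by
  have := TimeField.IsSolAt.eqOn (γ := fun r => Ev t r (Ev s t q)) (γ' := fun r => Ev s r q)
    isOpen_univ isPreconnected_univ (fun r hr => (hEv t).sol _ r hr)
    (fun r hr => (hEv s).sol q r hr) (mem_univ t) ((hEv t).init _) (mem_univ s)
  simpa [(hEv s).init] using this

/-- The diffeomorphism given by an evolution on the open set `U`. -/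
def TimeField.evolutionDiffeomorph [T2Space N] (hEv : ∀ s, V.IsEvolution s univ (Ev s)) {U : Set N}
    (hU : IsOpen U) (s t : ℝ) : PartialDiffeomorph (𝓡 3) (𝓡 3) N N ∞ where
  toFun := Ev s t
  invFun := Ev t s
  source := U
  target := Ev t s ⁻¹' U
  map_source' q hq := by rwa [mem_preimage, evolution_symm hEv]
  map_target' _ hq := hq
  left_inv' q _ := evolution_symm hEv s t q
  right_inv' q _ := evolution_symm hEv t s q
  open_source := hU
  open_target := hU.preimage ((hEv t).continuous.comp (Continuous.prodMk_left s))
  contMDiffOn_toFun q _ := ((hEv s).contMDiffAt t q).contMDiffWithinAt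
  contMDiffOn_invFun q _ := ((hEv t).contMDiffAt s q).contMDiffWithinAt

variable {α₀ α₁ : OneForm N} {f : N → ℝ} {ξ₀ ξ₁ : PlaneField N}

/-- A diffeomorphism which maps `α₀` to a positive multiple of `α` maps the plane field defined
by `α₀` to the one defined by `α`. -/
lemma OneForm.defines_pullback {α : OneForm N} {F G : N → N} (hF : ContMDiff (𝓡 3) (𝓡 3) ∞ F)
    (hG : ContMDiff (𝓡 3) (𝓡 3) ∞ G) (hFG : F ∘ G = id) {U : Set N}
    (hα₀ : α₀.Defines ξ₀ univ) (h : ∀ q ∈ U, ∃ k > 0, ∀ w : TangentSpace (𝓡 3) q,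
      α (F q) (mfderiv (𝓡 3) (𝓡 3) F q w) = k * α₀ q w) :
    α.Defines (ξ₀.pullback G) (G ⁻¹' U) := by
  intro q hq
  obtain ⟨k, hk, hkw⟩ := h _ hq
  have h1 : ∀ v : TangentSpace (𝓡 3) q, α q v = k * α₀ (G q) (mfderiv (𝓡 3) (𝓡 3) G q v) := by
    intro v
    rw [← hkw, ← α.apply_mfderiv_of_eq_id hFG q v,
      mfderiv_comp q ((hF _).mdifferentiableAt (by simp)) ((hG q).mdifferentiableAt (by simp))]
    rfl
  obtain ⟨h2, h3⟩ := hα₀ (G q) (mem_univ _)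
  refine ⟨?_, ?_⟩
  · ext v
    change mfderiv (𝓡 3) (𝓡 3) G q v ∈ ξ₀.plane (G q) ↔ α q v = 0
    rw [h2, h1]
    simp [hk.ne']
  · ext v
    change mfderiv (𝓡 3) (𝓡 3) G q v ∈ ξ₀.pos (G q) ↔ 0 < α q v
    rw [h3, h1]
    simp [hk]

/-- A map which maps `α₀` to a positive multiple of `α₁` pulls back the plane field defined by `α₁`
to the one defined by `α₀`. -/
lemma OneForm.eqOn_pullback {F : N → N} {U : Set N} (hα₀ : α₀.Defines ξ₀ univ)
    (hα₁ : α₁.Defines ξ₁ univ) (h : ∀ q ∈ U, ∃ k > 0, ∀ w : TangentSpace (𝓡 3) q,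
      α₁ (F q) (mfderiv (𝓡 3) (𝓡 3) F q w) = k * α₀ q w) : ξ₀.EqOn (ξ₁.pullback F) U := by
  intro q hq
  obtain ⟨k, hk, hkw⟩ := h q hq
  obtain ⟨h2, h3⟩ := hα₀ q (mem_univ _)
  obtain ⟨h4, h5⟩ := hα₁ (F q) (mem_univ _)
  refine ⟨?_, ?_⟩
  · ext v
    change v ∈ ξ₀.plane q ↔ mfderiv (𝓡 3) (𝓡 3) F q v ∈ ξ₁.plane (F q)
    rw [h2, h4]
    change α₀ q v = 0 ↔ α₁ (F q) (mfderiv (𝓡 3) (𝓡 3) F q v) = 0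
    rw [hkw]
    simp [hk.ne']
  · ext v
    change v ∈ ξ₀.pos q ↔ mfderiv (𝓡 3) (𝓡 3) F q v ∈ ξ₁.pos (F q)
    rw [h3, h5]
    change 0 < α₀ q v ↔ 0 < α₁ (F q) (mfderiv (𝓡 3) (𝓡 3) F q v)
    rw [hkw]
    simp [hk]

end Isotopy

end BranchedContact

end

open BranchedContact in
theorem mainTheorem3
    {N : Type*} [TopologicalSpace N] [T2Space N] [SigmaCompactSpace N]
    [ChartedSpace E3 N] [IsManifold (𝓡 3) ∞ N] (hN : IsOrientedAtlas N)
    {P : Type*} [TopologicalSpace P] [CompactSpace P]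
    (h : ℝ → ℝ) (hh : IsProfile h) (S : BranchedSurface h P)
    (i : P → N) (hi : S.IsSmoothEmbedding i)
    (ξ₀ ξ₁ : PlaneField N) (hξ₀ : ξ₀.IsContact) (hξ₁ : ξ₁.IsContact)
    (hF : S.charFoliation i ξ₀ = S.charFoliation i ξ₁) :
    ∃ (U₀ : Set N) (φ : ℝ → PartialDiffeomorph (𝓡 3) (𝓡 3) N N ∞),
      IsOpen U₀ ∧ range i ⊆ U₀ ∧
      ContMDiffOn ((𝓡 3).prod 𝓘(ℝ, ℝ)) (𝓡 3) ∞ (fun x : N × ℝ => φ x.2 x.1)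
        (U₀ ×ˢ Icc (0 : ℝ) 1) ∧
      (∀ t ∈ Icc (0 : ℝ) 1,
        (φ t).source = U₀ ∧ range i ⊆ (φ t).target ∧ φ t '' range i = range i) ∧
      (∀ q ∈ U₀, φ 0 q = q) ∧
      ξ₀.EqOn (ξ₁.pullback (φ 1)) U₀ ∧
      (∀ t ∈ Icc (0 : ℝ) 1,
        S.charFoliation i (ξ₀.pushforward (φ t)) = S.charFoliation i ξ₀ ∧
        S.charFoliation i (ξ₀.pushforward (φ t)) = S.charFoliation i ξ₁) := by
  obtain ⟨α₀, hα₀, hαξ₀⟩ := hξ₀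
  obtain ⟨α₁, hα₁, hαξ₁⟩ := hξ₁
  obtain ⟨g, hg, hgpos, hgα⟩ := BranchedSurface.exists_factor hi hα₀ hα₁ hαξ₀ hαξ₁ hF
  obtain ⟨f, hf, hfpos, O, hO, hiO, hOc⟩ :=
    BranchedSurface.exists_contact_path hh hi hα₀ hα₁ hg hgpos hgα
  -- a smooth parameter with values in `[0, 1]` for all times makes the field of Moser's method smooth
  -- on the whole real line
  have hτ : ContDiff ℝ ∞ Real.smoothTransition := Real.smoothTransition.contDiff
  have hτ1 : ∀ t, Real.smoothTransition t ∈ Icc (0 : ℝ) 1 := fun t =>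
    ⟨Real.smoothTransition.nonneg t, Real.smoothTransition.le_one t⟩
  obtain ⟨V, K, O', hK, hVK, hO', hiO', hO'O, hV⟩ := exists_moserField hα₀.1 hα₁.1 hf hτ hτ1
    (isCompact_range hi.isEmbedding.continuous) hO hiO hOc
  have hO'c : ∀ q ∈ O', ∀ c ∈ Icc (0 : ℝ) 1, (pathForm α₀ α₁ f c).IsContactAt q := fun q hq =>
    hOc q (hO'O hq)
  choose Ev hEv using fun s => TimeField.exists_evolution hK hVK s
  -- the evolution preserves the branched surface
  have hmem : ∀ s t, ∀ q ∈ range i, Ev s t q ∈ range i := by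
    intro s t q hq
    refine BranchedSurface.evolution_mem_range hi ?_ (hEv s) (t₀ := s) (by rwa [(hEv s).init]) t
    intro e he t j k u hu
    obtain ⟨w, hw⟩ := BranchedSurface.moserVector_tangent (f := f) hi hgα he hu
      (Real.smoothTransition t)
    refine ⟨deriv Real.smoothTransition t • w, ?_⟩
    rw [hV e he t _ (e.map_source hu) (by rw [e.left_inv hu]; exact hiO' (mem_range_self _)), hw,
      map_smul]
  -- the points which stay where the path consists of contact forms, and where the field is not cut off
  let U₀ : Set N := {q | ∀ t ∈ Icc (0 : ℝ) 1, Ev 0 t q ∈ O'}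
  have hU₀ : IsOpen U₀ := isOpen_iff_mem_nhds.2 fun q hq =>
    isCompact_Icc.eventually_forall_of_forall_eventually fun t ht =>
      (hEv 0).continuous.continuousAt.eventually_mem (hO'.mem_nhds (hq t ht))
  have hiU₀ : range i ⊆ U₀ := fun q hq t _ => hiO' (hmem 0 t q hq)
  have hmoser : ∀ t ∈ Icc (0 : ℝ) 1, ∀ q ∈ U₀, ∃ k > 0, ∀ w : TangentSpace (𝓡 3) q,
      pathForm α₀ α₁ f (Real.smoothTransition t) (Ev 0 t q) (mfderiv (𝓡 3) (𝓡 3) (Ev 0 t) q w) =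
        k * α₀ q w := by
    intro t ht q hq
    obtain ⟨k, hk, hkw⟩ := moser hα₀.1 hα₁.1 hf hτ hτ1 hO' hO'c hV (hEv 0) isPreconnected_Icc hq
      (left_mem_Icc.2 zero_le_one) ht
    refine ⟨k, hk, fun w => ?_⟩
    rw [hkw, OneForm.apply_mfderiv_of_eq_id _ (funext (hEv 0).init), pathForm_apply,
      Real.smoothTransition.zero]
    ring
  refine ⟨U₀, fun t => TimeField.evolutionDiffeomorph hEv hU₀ 0 t, hU₀, hiU₀,
    fun p _ => ((hEv 0).smooth p.1 p.2 (mem_univ _)).contMDiffWithinAt,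
    fun t _ => ⟨rfl, fun q hq => hiU₀ (hmem t 0 q hq), ?_⟩, fun q _ => (hEv 0).init q, ?_, ?_⟩
  · refine Subset.antisymm (image_subset_iff.2 fun q hq => hmem 0 t q hq) fun q hq =>
      ⟨Ev t 0 q, hmem t 0 q hq, TimeField.evolution_symm hEv t 0 q⟩
  · refine OneForm.eqOn_pullback (F := Ev 0 1) hαξ₀ hαξ₁ fun q hq => ?_
    obtain ⟨k, hk, hkw⟩ := hmoser 1 (right_mem_Icc.2 zero_le_one) q hq
    have hfq := hfpos (Ev 0 1 q)
    refine ⟨k / f (Ev 0 1 q), by positivity, fun w => ?_⟩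
    have h1 := hkw w
    rw [pathForm_apply, Real.smoothTransition.one] at h1
    rw [div_mul_eq_mul_div, eq_div_iff hfq.ne', ← h1]
    ring
  · intro t ht
    set c := Real.smoothTransition t with hcdef
    have hdef : (pathForm α₀ α₁ f c).Defines
        (ξ₀.pushforward (TimeField.evolutionDiffeomorph hEv hU₀ 0 t)) (Ev t 0 ⁻¹' U₀) :=
      OneForm.defines_pullback (F := Ev 0 t) (fun q => (hEv 0).contMDiffAt t q)
        (fun q => (hEv t).contMDiffAt 0 q) (funext (TimeField.evolution_symm hEv t 0)) hαξ₀
        (hmoser t ht)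
    have hfg : S.IsSmooth fun p => (1 - c) + c * f (i p) * g p := by
      have h1 := hi.isSmooth_comp isOpen_univ (subset_univ _) hf.contMDiffOn
      intro j k
      exact contDiff_const.add ((contDiff_const.mul (h1 j k)).mul (hg j k))
    have hfgpos : ∀ p, 0 < (1 - c) + c * f (i p) * g p := fun p => by
      have h1 := mul_pos (hfpos (i p)) (hgpos p)
      obtain ⟨h2, h3⟩ := hτ1 t
      rcases h2.eq_or_lt with h4 | h4
      · rw [hcdef, ← h4]; norm_num
      · rw [mul_assoc]
        exact add_pos_of_nonneg_of_pos (sub_nonneg.2 h3) (mul_pos h4 h1)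
    have key : S.charFoliation i ξ₀ =
        S.charFoliation i (ξ₀.pushforward (TimeField.evolutionDiffeomorph hEv hU₀ 0 t)) := by
      refine BranchedSurface.charFoliation_eq hi isOpen_univ
        (TimeField.evolutionDiffeomorph hEv hU₀ 0 t).open_target (subset_univ _)
        (fun q hq => hiU₀ (hmem t 0 q hq)) hα₀.1 (smoothOn_pathForm hα₀.1 hα₁.1 hf c _)
        (fun q _ => hα₀.ne_zero q) (fun q hq => ?_) hαξ₀ hdef hfg hfgpos fun p v => ?_
      · have h1 : Ev 0 t (Ev t 0 q) ∈ O' := hq t ht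
        rw [TimeField.evolution_symm hEv] at h1
        exact (hO'c q h1 c (hτ1 t)).ne_zero
      · rw [pathForm_apply, hgα]
        ring
    exact ⟨key.symm, key.symm.trans hF⟩
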